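/- Conventions. All locally convex spaces are real and Hausdorff. For locally convex spaces $E,F$ and $k\in\mathbb N_0\cup\{\infty\}$, a map $f\colon U\to F$ on an open set $U\subseteq E$ is $C^k$ (in the sense of Bastiani, i.e. Keller's $C^k_c$) if $f$ is continuous, the iterated directional derivatives $d^{(j)}f(x,y_1,\dots,y_j)=(D_{y_j}\cdots D_{y_1}f)(x)$ exist for all $j\in\mathbb N$ with $j\le k$, $x\in U$, $y_1,\dots,y_j\in E$, and all maps $d^{(j)}f\colon U\times E^j\to F$ are continuous. Smooth ($C^\infty$) manifolds and Lie groups modelled on $E$, and $C^k$-maps between them, are defined accordingly through charts. Let $E$ be a sequentially complete locally convex space and $p\in[1,\infty]$. A map $\gamma\colon[a,b]\to E$ is in $\mathcal L^p([a,b],E)$ if it is Lusin measurable (there are compact sets $K_j\subseteq[a,b]$, $j\in\mathbb N$, with $\gamma|_{K_j}$ continuous and $[a,b]\setminus\bigcup_jK_j$ of Lebesgue measure $0$) and $\|\gamma\|_{\mathcal L^p,q}:=\|q\circ\gamma\|_{\mathcal L^p}<\infty$ for each continuous seminorm $q$ on $E$. A function $\eta\colon[a,b]\to E$ is $AC_{L^p}$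 if $\eta(t)=\eta(a)+\int_a^t\gamma(s)\,ds$ (weak integral) for all $t\in[a,b]$, for some $\gamma\in\mathcal L^p([a,b],E)$; then $\gamma$ is unique up to a null set and we write $\eta'=[\gamma]$. The space $AC_{L^p}([0,1],E)$ carries the locally convex topology given by the seminorms $\eta\mapsto q(\eta(0))+\|\eta'\|_{L^p,q}$, for $q$ ranging through the continuous seminorms on $E$. If $G$ is a Lie group modelled on $E$, a continuous map $\eta\colon[0,1]\to G$ is $AC_{L^p}$ if there are $0=t_0<\dots<t_n=1$ and charts $\phi_j\colon U_j\to V_j\subseteq E$ of $G$ such that $\eta([t_{j-1},t_j])\subseteq U_j$ and $\phi_j\circ\eta|_{[t_{j-1},t_j]}$ is $AC_{L^p}$ for $j=1,\dots,n$. The set $AC_{L^p}([0,1],G)$ of all such maps is a Lie group under pointwise multiplication, whose smooth structure is given by the atlas of all charts $$\{\eta\in AC_{L^p}([0,1],G)\colon (\eta\gamma^{-1})([0,1])\subseteq U\}\to\{x\in AC_{L^p}([0,1],E)\colon x([0,1])\subseteq V\},\quad \eta\mapsto\phi\circ(\eta\gamma^{-1}),$$ with $\phi\colon U\to V\subseteq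 E$ a chart of $G$ with $e\in U$ and $\gamma\in AC_{L^p}([0,1],G)$. Theorem. Let $G$ and $H$ be Lie groups modelled on sequentially complete locally convex spaces $E$ and $F$, respectively. Let $k\in\mathbb N_0\cup\{\infty\}$, $p\in[1,\infty]$, and let $f\colon G\to H$ be a $C^{k+2}$-map. Then $f\circ\gamma\in AC_{L^p}([0,1],H)$ for each $\gamma\in AC_{L^p}([0,1],G)$, and the map $$AC_{L^p}([0,1],f)\colon AC_{L^p}([0,1],G)\to AC_{L^p}([0,1],H),\quad \gamma\mapsto f\circ\gamma$$ is $C^k$. -/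

import Mathlib

open Set Filter Topology MeasureTheory
open scoped ENNReal

noncomputable section

/-! ## Calculus in locally convex spaces -/

section Calculus

variable {E F : Type*} [AddCommGroup E] [Module ℝ E] [TopologicalSpace E]
  [AddCommGroup F] [Module ℝ F] [TopologicalSpace F]

/-- Every Cauchy sequence of the topological vector space `E` converges. -/
def SeqCompleteTVS (E : Type*) [AddCommGroup E] [TopologicalSpace E] : Prop :=
  ∀ u : ℕ → E,
    (∀ V ∈ 𝓝 (0 : E), ∃ N : ℕ, ∀ m, N ≤ m → ∀ n, N ≤ n → u m - u n ∈ V) →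
      ∃ x, Tendsto u atTop (𝓝 x)

/-- `v` is the directional derivative of `f` at `x` in the direction `y`. -/
def HasDirDeriv (f : E → F) (v : F) (x y : E) : Prop :=
  Tendsto (fun t : ℝ => t⁻¹ • (f (x + t • y) - f x)) (𝓝[≠] 0) (𝓝 v)

/-- `U` is open and `f` is `C^k` on `U` in the sense of Bastiani (Keller's `C^k_c`-theory): the
iterated directional derivatives `d j x (y₁, …, y_j) = (D_{y_j} ⋯ D_{y₁} f) x` exist for `j ≤ k`,
`x ∈ U`, and are continuous on `U × E^j`. Only the values of `f` on `U` matter. -/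
def ContDiffLC (k : ℕ∞) (f : E → F) (U : Set E) : Prop :=
  IsOpen U ∧ ∃ d : (j : ℕ) → E → (Fin j → E) → F,
    (∀ x ∈ U, ∀ y, d 0 x y = f x) ∧
    (∀ j : ℕ, (j : ℕ∞) + 1 ≤ k → ∀ x ∈ U, ∀ y : Fin (j + 1) → E,
      HasDirDeriv (fun z => d j z (Fin.init y)) (d (j + 1) x y) x (y (Fin.last j))) ∧
    (∀ j : ℕ, (j : ℕ∞) ≤ k →
      ContinuousOn (fun z : E × (Fin j → E) => d j z.1 z.2) (U ×ˢ univ))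

/-- `f : M → N` is `C^k` with respect to the families of charts `A` of `M` and `B` of `N`: it is
continuous, and in any two charts it is a `C^k`-map on an open set. -/
def ContDiffInCharts {M N : Type*} [TopologicalSpace M] [TopologicalSpace N] (k : ℕ∞)
    (A : Set (PartialEquiv M E)) (B : Set (PartialEquiv N F)) (f : M → N) : Prop :=
  Continuous f ∧ ∀ φ ∈ A, ∀ ψ ∈ B,
    ContDiffLC k (fun x => ψ (f (φ.symm x))) {x | x ∈ φ.target ∧ f (φ.symm x) ∈ ψ.source}

end Calculus

/-! ## Manifolds and Lie groups modelled on locally convex spaces -/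

section LieGroups

variable (E : Type*) [AddCommGroup E] [Module ℝ E] [TopologicalSpace E]
  (G : Type*) [TopologicalSpace G] [ChartedSpace E G]

/-- `G` is a Lie group modelled on `E`: a topological group with an atlas whose changes of charts
are smooth and in which multiplication and inversion are smooth (here `⊤ : ℕ∞` is `C^∞`). -/
class LieGroupLC [Group G] : Prop where
  isTopologicalGroup : IsTopologicalGroup G
  smooth_transition : ∀ φ ∈ atlas E G, ∀ ψ ∈ atlas E G,
    ContDiffLC ⊤ (fun x : E => ψ (φ.symm x)) {x | x ∈ φ.target ∧ φ.symm x ∈ ψ.source}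
  smooth_mul : ∀ φ ∈ atlas E G, ∀ φ' ∈ atlas E G, ∀ ψ ∈ atlas E G,
    ContDiffLC ⊤ (fun z : E × E => ψ (φ.symm z.1 * φ'.symm z.2))
      {z | z.1 ∈ φ.target ∧ z.2 ∈ φ'.target ∧ φ.symm z.1 * φ'.symm z.2 ∈ ψ.source}
  smooth_inv : ∀ φ ∈ atlas E G, ∀ ψ ∈ atlas E G,
    ContDiffLC ⊤ (fun x : E => ψ (φ.symm x)⁻¹)
      {x | x ∈ φ.target ∧ (φ.symm x)⁻¹ ∈ ψ.source}

/-- The charts of the smooth manifold `G`: the elements of the maximal atlas. -/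
def lcCharts : Set (OpenPartialHomeomorph G E) :=
  {φ | ∀ ψ ∈ atlas E G,
    ContDiffLC ⊤ (fun x : E => ψ (φ.symm x)) {x | x ∈ φ.target ∧ φ.symm x ∈ ψ.source} ∧
    ContDiffLC ⊤ (fun x : E => φ (ψ.symm x)) {x | x ∈ ψ.target ∧ ψ.symm x ∈ φ.source}}

/-- The charts of `G`, without their topological part. -/
def lcChartsPE : Set (PartialEquiv G E) :=
  (fun φ : OpenPartialHomeomorph G E => φ.toPartialEquiv) '' lcCharts E G

end LieGroups

/-! ## `L^p`-functions and absolutely continuous functions with values in `E` -/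

section Lp

/-- Lusin measurability of `γ` on `I ⊆ ℝ`. -/
def LusinMeasurableOn {X : Type*} [TopologicalSpace X] (γ : ℝ → X) (I : Set ℝ) : Prop :=
  ∃ K : ℕ → Set ℝ, (∀ j, IsCompact (K j) ∧ K j ⊆ I ∧ ContinuousOn γ (K j)) ∧
    volume (I \ ⋃ j, K j) = 0

variable {E : Type*} [AddCommGroup E] [Module ℝ E] [TopologicalSpace E]

/-- `γ ∈ 𝓛^p(I, E)`. -/
def MemLpLC (p : ℝ≥0∞) (γ : ℝ → E) (I : Set ℝ) : Prop :=
  LusinMeasurableOn γ I ∧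
    ∀ q : Seminorm ℝ E, Continuous q → eLpNorm (fun s => q (γ s)) p (volume.restrict I) < ∞

/-- `η(t) = η(a) + ∫_a^t γ(s) ds` for all `t ∈ [a, b]`, as a weak integral. -/
def IsWeakPrimitiveOn (γ η : ℝ → E) (a b : ℝ) : Prop :=
  ∀ t ∈ Icc a b, ∀ l : E →L[ℝ] ℝ,
    IntervalIntegrable (fun s => l (γ s)) volume a t ∧
      l (η t - η a) = ∫ s in a..t, l (γ s)

/-- `η` restricts to an `AC_{L^p}`-function `[a, b] → E`. -/
def IsACOn (p : ℝ≥0∞) (η : ℝ → E) (a b : ℝ) : Prop :=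
  ∃ γ : ℝ → E, MemLpLC p γ (Icc a b) ∧ IsWeakPrimitiveOn γ η a b

theorem LusinMeasurableOn.comp₂ {X Y Z : Type*} [TopologicalSpace X] [TopologicalSpace Y]
    [TopologicalSpace Z] {γ : ℝ → X} {δ : ℝ → Y} {I : Set ℝ} (hγ : LusinMeasurableOn γ I)
    (hδ : LusinMeasurableOn δ I) {f : X × Y → Z} (hf : Continuous f) :
    LusinMeasurableOn (fun s => f (γ s, δ s)) I := by
  obtain ⟨K, hK, hK0⟩ := hγ
  obtain ⟨L, hL, hL0⟩ := hδ
  refine ⟨fun n => K n.unpair.1 ∩ L n.unpair.2, fun n => ⟨(hK _).1.inter (hL _).1, ?_, ?_⟩, ?_⟩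
  · exact inter_subset_left.trans (hK _).2.1
  · exact hf.comp_continuousOn
      (((hK _).2.2.mono inter_subset_left).prodMk ((hL _).2.2.mono inter_subset_right))
  · refine measure_mono_null ?_ (measure_union_null hK0 hL0)
    rintro x ⟨hxI, hx⟩
    by_contra hcon
    simp only [mem_union, Set.mem_sdiff, hxI, true_and, not_or, not_not, mem_iUnion] at hcon
    obtain ⟨⟨i, hi⟩, ⟨j, hj⟩⟩ := hcon
    exact hx (mem_iUnion.2 ⟨Nat.pair i j, by simpa using ⟨hi, hj⟩⟩)

theorem LusinMeasurableOn.comp {X Z : Type*} [TopologicalSpace X] [TopologicalSpace Z]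
    {γ : ℝ → X} {I : Set ℝ} (hγ : LusinMeasurableOn γ I) {f : X → Z} (hf : Continuous f) :
    LusinMeasurableOn (fun s => f (γ s)) I :=
  hγ.comp₂ hγ (f := fun z => f z.1) (hf.comp continuous_fst)

theorem LusinMeasurableOn.aestronglyMeasurable {γ : ℝ → ℝ} {I : Set ℝ}
    (hγ : LusinMeasurableOn γ I) : AEStronglyMeasurable γ (volume.restrict I) := by
  obtain ⟨K, hK, hK0⟩ := hγ
  have h1 : AEStronglyMeasurable γ (volume.restrict (⋃ j, K j)) :=
    aestronglyMeasurable_iUnion_iff.2 fun j =>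
      (hK j).2.2.aestronglyMeasurable (hK j).1.measurableSet
  have h2 : AEStronglyMeasurable γ (volume.restrict ((⋃ j, K j) ∪ (I \ ⋃ j, K j))) := by
    rw [aestronglyMeasurable_union_iff]
    refine ⟨h1, ?_⟩
    rw [Measure.restrict_eq_zero.2 hK0]
    exact aestronglyMeasurable_zero_measure _
  refine h2.mono_measure (Measure.restrict_mono ?_ le_rfl)
  intro x hx
  by_cases h : x ∈ ⋃ j, K j
  · exact Or.inl h
  · exact Or.inr ⟨hx, h⟩

theorem MemLpLC.memLp {p : ℝ≥0∞} {γ : ℝ → E} {I : Set ℝ} (h : MemLpLC p γ I)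
    {q : Seminorm ℝ E} (hq : Continuous q) : MemLp (fun s => q (γ s)) p (volume.restrict I) :=
  ⟨(h.1.comp hq).aestronglyMeasurable, h.2 q hq⟩

theorem MemLpLC.zero (p : ℝ≥0∞) {a b : ℝ} : MemLpLC p (0 : ℝ → E) (Icc a b) := by
  refine ⟨⟨fun _ => Icc a b, fun _ => ⟨isCompact_Icc, subset_rfl, continuousOn_const⟩, ?_⟩, ?_⟩
  · simp [iUnion_const]
  · intro q _
    simp

theorem IsWeakPrimitiveOn.add {γ γ' η η' : ℝ → E} {a b : ℝ} (h : IsWeakPrimitiveOn γ η a b)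
    (h' : IsWeakPrimitiveOn γ' η' a b) : IsWeakPrimitiveOn (γ + γ') (η + η') a b := by
  intro t ht l
  obtain ⟨i1, e1⟩ := h t ht l
  obtain ⟨i2, e2⟩ := h' t ht l
  refine ⟨?_, ?_⟩
  · simpa using i1.add i2
  · simp only [Pi.add_apply, map_add]
    rw [intervalIntegral.integral_add i1 i2, ← e1, ← e2]
    simp only [map_sub, map_add]
    ring

theorem IsWeakPrimitiveOn.smul {γ η : ℝ → E} {a b : ℝ} (c : ℝ) (h : IsWeakPrimitiveOn γ η a b) :
    IsWeakPrimitiveOn (c • γ) (c • η) a b := by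
  intro t ht l
  obtain ⟨i1, e1⟩ := h t ht l
  refine ⟨?_, ?_⟩
  · simpa using i1.const_mul c
  · simp only [Pi.smul_apply, map_smul, smul_eq_mul]
    rw [intervalIntegral.integral_const_mul, ← e1, ← smul_sub, map_smul, smul_eq_mul]

theorem IsWeakPrimitiveOn.zero {a b : ℝ} : IsWeakPrimitiveOn (0 : ℝ → E) 0 a b := by
  intro t _ l
  simp

theorem MemLpLC.add [IsTopologicalAddGroup E] {p : ℝ≥0∞} {γ δ : ℝ → E} {I : Set ℝ} (hγ : MemLpLC p γ I)
    (hδ : MemLpLC p δ I) : MemLpLC p (γ + δ) I := by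
  have hL : LusinMeasurableOn (γ + δ) I := hγ.1.comp₂ hδ.1 continuous_add
  refine ⟨hL, fun q hq => ?_⟩
  refine (((hγ.memLp hq).add (hδ.memLp hq)).mono (hL.comp hq).aestronglyMeasurable ?_).2
  refine Eventually.of_forall fun s => ?_
  simp only [Real.norm_eq_abs, abs_of_nonneg (apply_nonneg q _), Pi.add_apply]
  exact (map_add_le_add q _ _).trans (le_abs_self _)

theorem MemLpLC.smul [ContinuousSMul ℝ E] {p : ℝ≥0∞} {γ : ℝ → E} {I : Set ℝ} (c : ℝ) (hγ : MemLpLC p γ I) :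
    MemLpLC p (c • γ) I := by
  have hL : LusinMeasurableOn (c • γ) I := hγ.1.comp (continuous_const_smul c)
  refine ⟨hL, fun q hq => ?_⟩
  have : (fun s => q ((c • γ) s)) = fun s => ‖c‖ * q (γ s) := by
    funext s; simp [map_smul_eq_mul]
  rw [this]
  exact ((hγ.memLp hq).const_mul _).2

variable [IsTopologicalAddGroup E] [ContinuousSMul ℝ E]

/-- The space `AC_{L^p}([0,1], E)`, as a linear subspace of the functions `[0,1] → E`. -/
def acSubmodule (p : ℝ≥0∞) (E : Type*) [AddCommGroup E] [Module ℝ E] [TopologicalSpace E]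
    [IsTopologicalAddGroup E] [ContinuousSMul ℝ E] : Submodule ℝ (unitInterval → E) where
  carrier := {η | IsACOn p (IccExtend zero_le_one η) 0 1}
  add_mem' := by
    rintro η ξ ⟨γ, hγ, h⟩ ⟨δ, hδ, h'⟩
    exact ⟨γ + δ, hγ.add hδ, h.add h'⟩
  zero_mem' := ⟨0, MemLpLC.zero p, IsWeakPrimitiveOn.zero⟩
  smul_mem' := by
    rintro c η ⟨γ, hγ, h⟩
    exact ⟨c • γ, hγ.smul c, h.smul c⟩

/-- The vector space `AC_{L^p}([0,1], E)`. It gets its own topology below, which is not the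
topology of pointwise convergence. -/
def ACSpace (p : ℝ≥0∞) (E : Type*) [AddCommGroup E] [Module ℝ E] [TopologicalSpace E]
    [IsTopologicalAddGroup E] [ContinuousSMul ℝ E] : Type _ :=
  acSubmodule p E

namespace ACSpace

variable {p : ℝ≥0∞}

instance : AddCommGroup (ACSpace p E) := inferInstanceAs (AddCommGroup (acSubmodule p E))

instance : Module ℝ (ACSpace p E) := inferInstanceAs (Module ℝ (acSubmodule p E))

/-- The underlying function of an element of `AC_{L^p}([0,1], E)`. -/
def toFun (η : ACSpace p E) : unitInterval → E := Subtype.val (p := (· ∈ acSubmodule p E)) η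

instance : CoeFun (ACSpace p E) (fun _ => unitInterval → E) := ⟨toFun⟩

/-- An element of `AC_{L^p}([0,1], E)` from its underlying function. -/
def mk (η : unitInterval → E) (h : η ∈ acSubmodule p E) : ACSpace p E :=
  (⟨η, h⟩ : acSubmodule p E)

theorem mem (η : ACSpace p E) : (η : unitInterval → E) ∈ acSubmodule p E :=
  Subtype.property (p := (· ∈ acSubmodule p E)) η

@[simp] theorem mk_apply (η : unitInterval → E) (h : η ∈ acSubmodule p E) (t : unitInterval) :
    mk η h t = η t := rfl

theorem ext {η ξ : ACSpace p E} (h : ∀ t, η t = ξ t) : η = ξ :=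
  Subtype.ext (p := (· ∈ acSubmodule p E)) (funext h)

/-- A representative of the derivative `η' ∈ L^p([0,1], E)`. -/
def derivRep (η : ACSpace p E) : ℝ → E := η.mem.choose

theorem memLpLC_derivRep (η : ACSpace p E) : MemLpLC p η.derivRep (Icc 0 1) :=
  η.mem.choose_spec.1

theorem isWeakPrimitiveOn_derivRep (η : ACSpace p E) :
    IsWeakPrimitiveOn η.derivRep (IccExtend zero_le_one (η : unitInterval → E)) 0 1 :=
  η.mem.choose_spec.2

end ACSpace

variable [LocallyConvexSpace ℝ E]

theorem exists_functional_eq_seminorm {q : Seminorm ℝ E} (hq : Continuous q) (v : E) :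
    ∃ l : E →L[ℝ] ℝ, l v = q v ∧ ∀ x, |l x| ≤ q x := by
  by_cases hv : v = 0
  · exact ⟨0, by simp [hv], fun x => by simp⟩
  obtain ⟨l, hl, hle⟩ := Module.Dual.exists_continuous_extension_of_le_seminorm_real
    (Submodule.span ℝ {v}) ((q v) • (LinearEquiv.coord ℝ E v hv : _ →ₗ[ℝ] ℝ)) hq (by
      rintro ⟨x, hx⟩
      obtain ⟨c, rfl⟩ := Submodule.mem_span_singleton.1 hx
      have : (LinearEquiv.coord ℝ E v hv) ⟨c • v, hx⟩ = c := by
        have h := LinearEquiv.coord_apply_smul ℝ E v hv ⟨c • v, hx⟩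
        exact smul_left_injective ℝ hv h
      simp only [LinearMap.smul_apply, LinearEquiv.coe_coe, this, smul_eq_mul, map_smul_eq_mul]
      rw [mul_comm]
      exact mul_le_mul_of_nonneg_right (le_abs_self c) (apply_nonneg q v))
  refine ⟨l, ?_, hle⟩
  have := hl ⟨v, Submodule.mem_span_singleton_self v⟩
  rw [this]
  simp [LinearEquiv.coord_self]

/-- The derivative of an `AC`-function is unique almost everywhere, measured by any continuous
seminorm. -/
theorem ae_seminorm_sub_eq_zero {p : ℝ≥0∞} {γ δ η : ℝ → E}
    (hγ : MemLpLC p γ (Icc 0 1)) (hδ : MemLpLC p δ (Icc 0 1))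
    (h : IsWeakPrimitiveOn γ η 0 1) (h' : IsWeakPrimitiveOn δ η 0 1)
    {q : Seminorm ℝ E} (hq : Continuous q) :
    ∀ᵐ s ∂(volume.restrict (Icc (0 : ℝ) 1)), q (γ s - δ s) = 0 := by
  have hL : LusinMeasurableOn (fun s => γ s - δ s) (Icc 0 1) := hγ.1.comp₂ hδ.1 continuous_sub
  have hzero : ∀ l : E →L[ℝ] ℝ, ∀ᵐ s, s ∈ Icc (0 : ℝ) 1 → l (γ s - δ s) = 0 := by
    intro l
    have i1 := (h 1 (by simp) l).1
    have i2 := (h' 1 (by simp) l).1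
    have hne0 : ∀ᵐ s : ℝ, s ≠ 0 := by simp [ae_iff, measure_singleton]
    have hne1 : ∀ᵐ s : ℝ, s ≠ 1 := by simp [ae_iff, measure_singleton]
    filter_upwards [i1.ae_hasDerivAt_integral, i2.ae_hasDerivAt_integral, hne0, hne1] with
      s h1 h2 h3 h4 hs
    have hs' : s ∈ uIcc (0 : ℝ) 1 := by rwa [uIcc_of_le zero_le_one]
    have d1 := h1 hs' 0 (by simp)
    have d2 := h2 hs' 0 (by simp)
    have hnhds : Icc (0 : ℝ) 1 ∈ 𝓝 s :=
      Icc_mem_nhds (lt_of_le_of_ne hs.1 (Ne.symm h3)) (lt_of_le_of_ne hs.2 h4)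
    have heq : (fun x => ∫ t in (0 : ℝ)..x, l (γ t)) =ᶠ[𝓝 s] fun x => ∫ t in (0 : ℝ)..x, l (δ t) := by
      filter_upwards [hnhds] with x hx
      rw [← (h x hx l).2, ← (h' x hx l).2]
    have := (d1.congr_of_eventuallyEq heq.symm).unique d2
    simp [this]
  obtain ⟨K, hK, hK0⟩ := hL
  have hKj : ∀ j, ∀ᵐ s, s ∈ K j → q (γ s - δ s) = 0 := by
    intro j
    obtain ⟨D, hDK, hDc, hD⟩ := (hK j).1.isSeparable.exists_countable_dense_subset
    choose l hl hle using fun s : ℝ => exists_functional_eq_seminorm hq (γ s - δ s)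
    have hall : ∀ᵐ s, ∀ d ∈ D, s ∈ Icc (0 : ℝ) 1 → l d (γ s - δ s) = 0 :=
      (ae_ball_iff hDc).2 fun d _ => hzero (l d)
    filter_upwards [hall] with s hs hsK
    refine le_antisymm (le_of_forall_pos_le_add fun ε hε => ?_) (apply_nonneg q _)
    have hc : ContinuousWithinAt
        (fun r => q ((γ r - δ r) - (γ s - δ s))) (K j) s :=
      hq.continuousAt.comp_continuousWithinAt
        (((hK j).2.2 s hsK).sub continuousWithinAt_const)
    have hlt : ∀ᶠ r in 𝓝[K j] s, q ((γ r - δ r) - (γ s - δ s)) < ε / 2 := by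
      refine hc.eventually (gt_mem_nhds ?_)
      simpa using half_pos hε
    obtain ⟨V, hV, hVs⟩ := mem_nhdsWithin_iff_exists_mem_nhds_inter.1 hlt
    obtain ⟨d, hdV, hdD⟩ := mem_closure_iff_nhds.1 (hD hsK) V hV
    have hd : q ((γ d - δ d) - (γ s - δ s)) < ε / 2 := hVs ⟨hdV, hDK hdD⟩
    have h0 : l d (γ s - δ s) = 0 := hs d hdD ((hK j).2.1 hsK)
    have h1 : q (γ d - δ d) ≤ q ((γ d - δ d) - (γ s - δ s)) := by
      have h2 := hle d ((γ d - δ d) - (γ s - δ s))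
      rw [map_sub, h0, sub_zero, hl] at h2
      exact (le_abs_self _).trans h2
    have h3 : q (γ s - δ s) ≤ q (γ d - δ d) + q ((γ d - δ d) - (γ s - δ s)) := by
      have := map_sub_le_add q (γ d - δ d) ((γ d - δ d) - (γ s - δ s))
      simpa using this
    linarith
  have hnull : ∀ᵐ s, s ∉ Icc (0 : ℝ) 1 \ ⋃ j, K j := measure_eq_zero_iff_ae_notMem.1 hK0
  rw [ae_restrict_iff' measurableSet_Icc]
  filter_upwards [ae_all_iff.2 hKj, hnull] with s h1 h2 hs
  by_cases hsK : s ∈ ⋃ j, K j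
  · obtain ⟨j, hj⟩ := mem_iUnion.1 hsK
    exact h1 j hj
  · exact absurd ⟨hs, hsK⟩ h2

namespace ACSpace

variable {p : ℝ≥0∞}

/-- `‖η'‖_{L^p, q}`. -/
def lpDeriv (q : Seminorm ℝ E) (η : ACSpace p E) : ℝ :=
  (eLpNorm (fun s => q (η.derivRep s)) p (volume.restrict (Icc 0 1))).toReal

theorem lpDeriv_eq {q : Seminorm ℝ E} (hq : Continuous q) (η : ACSpace p E) {γ : ℝ → E}
    (hγ : MemLpLC p γ (Icc 0 1))
    (h : IsWeakPrimitiveOn γ (IccExtend zero_le_one (η : unitInterval → E)) 0 1) :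
    lpDeriv q η = (eLpNorm (fun s => q (γ s)) p (volume.restrict (Icc 0 1))).toReal := by
  unfold lpDeriv
  congr 1
  refine eLpNorm_congr_ae ?_
  filter_upwards [ae_seminorm_sub_eq_zero η.memLpLC_derivRep hγ η.isWeakPrimitiveOn_derivRep h hq]
    with s hs
  have h1 := abs_sub_map_le_sub q (η.derivRep s) (γ s)
  rw [hs] at h1
  exact sub_eq_zero.1 (abs_nonpos_iff.1 h1)

/-- The seminorm `η ↦ q(η(0)) + ‖η'‖_{L^p, q}` on `AC_{L^p}([0,1], E)`. -/
def acSeminorm [hp : Fact (1 ≤ p)] (q : {q : Seminorm ℝ E // Continuous q}) :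
    Seminorm ℝ (ACSpace p E) :=
  Seminorm.of (fun η => q.1 (η 0) + lpDeriv q.1 η)
    (by
      intro η ξ
      have hη := η.memLpLC_derivRep
      have hξ := ξ.memLpLC_derivRep
      have e := lpDeriv_eq q.2 (η + ξ) (hη.add hξ)
        (η.isWeakPrimitiveOn_derivRep.add ξ.isWeakPrimitiveOn_derivRep)
      have mη := hη.memLp q.2
      have mξ := hξ.memLp q.2
      have h1 : lpDeriv q.1 (η + ξ) ≤ lpDeriv q.1 η + lpDeriv q.1 ξ := by
        rw [e]
        unfold lpDeriv
        rw [← ENNReal.toReal_add mη.2.ne mξ.2.ne]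
        refine ENNReal.toReal_mono (ENNReal.add_ne_top.2 ⟨mη.2.ne, mξ.2.ne⟩) ?_
        refine le_trans (eLpNorm_mono_real ?_) (eLpNorm_add_le mη.1 mξ.1 hp.out)
        intro s
        rw [Real.norm_eq_abs, abs_of_nonneg (apply_nonneg q.1 _)]
        exact map_add_le_add q.1 _ _
      have h2 : q.1 ((η + ξ : ACSpace p E) 0) ≤ q.1 (η 0) + q.1 (ξ 0) :=
        map_add_le_add q.1 _ _
      linarith)
    (by
      intro c η
      have e := lpDeriv_eq q.2 (c • η) (η.memLpLC_derivRep.smul c)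
        (η.isWeakPrimitiveOn_derivRep.smul c)
      have h1 : lpDeriv q.1 (c • η) = ‖c‖ * lpDeriv q.1 η := by
        rw [e]
        unfold lpDeriv
        have : (fun s => q.1 ((c • η.derivRep) s)) = ‖c‖ • fun s => q.1 (η.derivRep s) := by
          funext s
          simp [map_smul_eq_mul]
        rw [this, eLpNorm_const_smul, ENNReal.toReal_mul]
        simp
      have h2 : q.1 ((c • η : ACSpace p E) 0) = ‖c‖ * q.1 (η 0) := map_smul_eq_mul q.1 _ _
      rw [h1, h2, mul_add])

/-- The locally convex topology of `AC_{L^p}([0,1], E)`, defined by the seminorms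
`η ↦ q(η(0)) + ‖η'‖_{L^p, q}`, i.e. the one for which `η ↦ (η(0), η')` is an isomorphism onto
`E × L^p([0,1], E)` (if `E` is sequentially complete). -/
instance [Fact (1 ≤ p)] : TopologicalSpace (ACSpace p E) :=
  haveI : Nonempty {q : Seminorm ℝ E // Continuous q} := ⟨⟨0, continuous_const⟩⟩
  (SeminormFamily.moduleFilterBasis
    (fun q : {q : Seminorm ℝ E // Continuous q} => acSeminorm (p := p) q)).topology

theorem withSeminorms [Fact (1 ≤ p)] :
    WithSeminorms (fun q : {q : Seminorm ℝ E // Continuous q} => acSeminorm (p := p) q) :=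
  ⟨rfl⟩

end ACSpace

end Lp

/-! ## The Lie group `AC_{L^p}([0,1], G)` -/

section ACMaps

variable (p : ℝ≥0∞) (E : Type*) [AddCommGroup E] [Module ℝ E] [TopologicalSpace E]
  {G : Type*} [TopologicalSpace G] [ChartedSpace E G]

/-- `η : [0,1] → G` is an `AC_{L^p}`-map to the manifold `G` modelled on `E`. -/
def IsACMap (η : unitInterval → G) : Prop :=
  Continuous η ∧ ∃ (n : ℕ) (t : Fin (n + 1) → ℝ), StrictMono t ∧ t 0 = 0 ∧ t (Fin.last n) = 1 ∧
    ∀ j : Fin n, ∃ φ ∈ lcCharts E G,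
      MapsTo (IccExtend zero_le_one η) (Icc (t j.castSucc) (t j.succ)) φ.source ∧
      IsACOn p (fun s => φ (IccExtend zero_le_one η s)) (t j.castSucc) (t j.succ)

variable (G) in
/-- The set `AC_{L^p}([0,1], G)`. -/
@[ext]
structure ACMap where
  toFun : unitInterval → G
  isACMap : IsACMap p E toFun

variable {p E}

instance : CoeFun (ACMap p E G) (fun _ => unitInterval → G) := ⟨ACMap.toFun⟩

variable [IsTopologicalAddGroup E] [ContinuousSMul ℝ E]

open Classical in
/-- The chart `η ↦ φ ∘ (η γ⁻¹)` of `AC_{L^p}([0,1], G)` around `γ`, where `φ : U → V` is a chart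
of `G` around the neutral element and products are pointwise. Its inverse is
`x ↦ (φ⁻¹ ∘ x) γ`. The source consists of the `η` with `η γ⁻¹ ∈ AC_{L^p}([0,1], U)` and the target
is `AC_{L^p}([0,1], V)`. (That pointwise products and compositions with charts are again `AC_{L^p}`
is a fact for Lie groups with sequentially complete modelling space, so the second condition in
`source` and in `target` excludes nothing, and the `else` branches are never used on them.) -/
def acChart [Group G] (φ : OpenPartialHomeomorph G E) (γ : ACMap p E G) :
    PartialEquiv (ACMap p E G) (ACSpace p E) where
  toFun η :=
    if h : (fun t => φ (η t * (γ t)⁻¹)) ∈ acSubmodule p E then ACSpace.mk _ h else 0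
  invFun x :=
    if h : IsACMap p E (fun t => φ.symm (x t) * γ t) then ⟨_, h⟩ else γ
  source := {η | (∀ t, η t * (γ t)⁻¹ ∈ φ.source) ∧
    (fun t => φ (η t * (γ t)⁻¹)) ∈ acSubmodule p E}
  target := {x | (∀ t, x t ∈ φ.target) ∧ IsACMap p E (fun t => φ.symm (x t) * γ t)}
  map_source' := by
    rintro η ⟨h1, h2⟩
    have e : (fun t => φ.symm (φ (η t * (γ t)⁻¹)) * γ t) = η := by
      funext t; simp [φ.left_inv (h1 t)]
    simp only [dif_pos h2, Set.mem_ofPred_eq, ACSpace.mk_apply, e]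
    exact ⟨fun t => φ.map_source (h1 t), η.isACMap⟩
  map_target' := by
    rintro x ⟨h1, h2⟩
    have e : (fun t => φ (φ.symm (x t) * γ t * (γ t)⁻¹)) = x := by
      funext t; simp [φ.right_inv (h1 t)]
    simp only [dif_pos h2, Set.mem_ofPred_eq, e]
    exact ⟨fun t => by simpa using φ.map_target (h1 t), x.mem⟩
  left_inv' := by
    rintro η ⟨h1, h2⟩
    have e : (fun t => φ.symm (φ (η t * (γ t)⁻¹)) * γ t) = η := by
      funext t; simp [φ.left_inv (h1 t)]
    simp only [dif_pos h2, ACSpace.mk_apply, e, dif_pos η.isACMap]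
  right_inv' := by
    rintro x ⟨h1, h2⟩
    have e : (fun t => φ (φ.symm (x t) * γ t * (γ t)⁻¹)) = x := by
      funext t; simp [φ.right_inv (h1 t)]
    simp only [dif_pos h2, e, dif_pos x.mem]
    exact ACSpace.ext fun t => rfl

variable (p E G) in
/-- The atlas of the Lie group `AC_{L^p}([0,1], G)`: the charts `η ↦ φ ∘ η` for the charts `φ` of
`G` around the neutral element, and their right translates. -/
def acCharts [Group G] : Set (PartialEquiv (ACMap p E G) (ACSpace p E)) :=
  {c | ∃ φ ∈ lcCharts E G, (1 : G) ∈ φ.source ∧ ∃ γ : ACMap p E G, c = acChart φ γ}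

/-- The topology of `AC_{L^p}([0,1], G)`: a set is open if and only if its inverse image in
the domain `AC_{L^p}([0,1], V)` of every parametrization `x ↦ (φ⁻¹ ∘ x) γ` is open. -/
instance [Group G] [LocallyConvexSpace ℝ E] [Fact (1 ≤ p)] : TopologicalSpace (ACMap p E G) :=
  ⨆ c : acCharts p E G,
    TopologicalSpace.coinduced (fun x : c.1.target => c.1.symm x.1) inferInstance

end ACMaps

end

/-!
Let `f : G → H` be `C^(k+2)`. In charts of the two Lie groups of absolutely continuous maps, centred
at `γ` and `δ`, the map `η ↦ f ∘ η` becomes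
`x ↦ ψ ∘ (f ∘ ((φ⁻¹ ∘ x) · γ) · δ⁻¹)`,
so the theorem is a statement about superposition operators `η ↦ g ∘ η` on the locally convex spaces
`AC([0,1], E)`.

*Chain rule.* If `g` is `C²` and `η` is absolutely continuous with derivative `η'`, then `g ∘ η` is
absolutely continuous with derivative `dg (η, η')` (`isWeakPrimitiveOn_comp`). The integral is
a weak one, so the claim is about `l ∘ g` for a continuous linear functional `l`. Near the compact
image of `η`, a single continuous seminorm `P` controls `dg` and its oscillation. Therefore the
difference of `l ∘ g ∘ η` and `∫ l (dg (η, η'))` has increments that are small relative to those of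
`∫ P (η')`, and such a function is constant (`eq_of_increments_small`).

*Superposition operators.* The same kind of estimate near a compact set shows that `η ↦ g ∘ η` is
continuous when `g` is `C²` (`ACSpace.continuousOn_postcomp`). When `g` is `C³`, Taylor's formula
and the symmetry of the second derivative show that it has the directional derivative
`dg ∘ (η, ξ)` in the direction `ξ` (`ACSpace.hasDirDeriv_postcomp`). This derivative is again a
superposition operator, with one order of differentiability less, so an induction on `n` gives a
`C^n`-operator for each `g` of class `C^(n+2)` (`ACSpace.bastianiOn_postcomp`). The induction runs
over the recursive notion `BastianiOn`, which is compared with `ContDiffLC` by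
`ContDiffLC.bastianiOn` and `contDiffLC_of_bastianiOn`.

*Removal of the time dependence.* The translations by `γ` and `δ` depend on `t`. On the pieces of a
fine partition both maps run in chart domains, and there the operator above is the superposition
operator of the time-independent `C^(k+2)`-map `localRep`, which takes the coordinates of `γ t` and
`δ t` as further arguments, applied to `x` restricted to the piece and paired with a fixed function.
Restriction to a piece, extended by constants (`ACSpace.retract`), is continuous and linear, and a
function on `[0,1]` is recovered from its restrictions by a telescoping sum, which gives the
smoothness in charts (`bastianiOn_chartDom`). Continuity for the topologies of the Lie groups
follows, as these are final with respect to the charts (`continuous_postcomp_acMap`).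
-/

set_option linter.unusedSectionVars false

/-! ### Mean value estimates in locally convex spaces -/

section MeanValue

variable {E F : Type*} [AddCommGroup E] [Module ℝ E] [TopologicalSpace E]
  [AddCommGroup F] [Module ℝ F] [TopologicalSpace F]

theorem HasDirDeriv.unique [T2Space F] {f : E → F} {v w : F} {x y : E}
    (hv : HasDirDeriv f v x y) (hw : HasDirDeriv f w x y) : v = w :=
  tendsto_nhds_unique hv hw

theorem HasDirDeriv.smul [ContinuousSMul ℝ F] {f : E → F} {v : F} {x y : E}
    (h : HasDirDeriv f v x y) (c : ℝ) : HasDirDeriv f (c • v) x (c • y) := by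
  by_cases hc : c = 0
  · subst hc
    simp only [HasDirDeriv, smul_zero, zero_smul, add_zero, sub_self]
    exact tendsto_const_nhds
  · have h1 : Tendsto (fun t : ℝ => t * c) (𝓝[≠] 0) (𝓝[≠] 0) := by
      refine tendsto_nhdsWithin_iff.2 ⟨?_, ?_⟩
      · exact ((continuous_mul_const c).tendsto' 0 0 (by simp)).mono_left nhdsWithin_le_nhds
      · filter_upwards [self_mem_nhdsWithin] with t ht
        exact mul_ne_zero ht hc
    refine ((h.comp h1).const_smul c).congr fun t => ?_
    simp only [Function.comp_apply, smul_smul, mul_inv_rev]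
    rw [mul_inv_cancel_left₀ hc]

theorem HasDirDeriv.congr_of_isOpen [IsTopologicalAddGroup E] [ContinuousSMul ℝ E]
    {f g : E → F} {v : F} {x y : E} {U : Set E} (hU : IsOpen U) (hx : x ∈ U)
    (hfg : EqOn f g U) (h : HasDirDeriv f v x y) : HasDirDeriv g v x y := by
  have hc : Tendsto (fun t : ℝ => x + t • y) (𝓝[≠] 0) (𝓝 x) :=
    (Continuous.tendsto' (by fun_prop) 0 x (by simp)).mono_left nhdsWithin_le_nhds
  refine Tendsto.congr' ?_ h
  filter_upwards [hc.eventually (hU.mem_nhds hx)] with t ht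
  rw [hfg ht, hfg hx]

/-- A directional derivative along a line gives the derivative of every continuous linear
functional of the restriction to the line. -/
theorem HasDirDeriv.hasDerivAt {f : E → F} {v : F} {z w : E} {u : ℝ}
    (h : HasDirDeriv f v (z + u • w) w) (l : F →L[ℝ] ℝ) :
    HasDerivAt (fun r : ℝ => l (f (z + r • w))) (l v) u := by
  rw [hasDerivAt_iff_tendsto_slope_zero]
  refine ((l.continuous.tendsto v).comp h).congr fun t => ?_
  simp only [Function.comp_apply, map_smul, map_sub, add_smul, add_assoc]

variable [IsTopologicalAddGroup F] [ContinuousSMul ℝ F] [LocallyConvexSpace ℝ F]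

/-- The mean value inequality for a continuous seminorm. -/
theorem seminorm_sub_sub_le_of_hasDirDeriv {q : Seminorm ℝ F} (hq : Continuous q)
    {g : E → F} {dg : ℝ → F} {z w : E} {v : F} {C : ℝ}
    (hd : ∀ u ∈ Icc (0 : ℝ) 1, HasDirDeriv g (dg u) (z + u • w) w)
    (hC : ∀ u ∈ Icc (0 : ℝ) 1, q (dg u - v) ≤ C) :
    q (g (z + w) - g z - v) ≤ C := by
  obtain ⟨l, hl, hle⟩ := exists_functional_eq_seminorm hq (g (z + w) - g z - v)
  have h1 : ∀ u ∈ Icc (0 : ℝ) 1,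
      HasDerivWithinAt (fun r : ℝ => l (g (z + r • w)) - r * l v) (l (dg u) - l v) (Icc 0 1) u := by
    intro u hu
    exact (((hd u hu).hasDerivAt l).sub
      ((hasDerivAt_id u).mul_const (l v))).hasDerivWithinAt.congr_deriv (by simp)
  have h2 := norm_image_sub_le_of_norm_deriv_le_segment_01' h1 (C := C) (fun u hu => by
    rw [← map_sub]
    exact (hle _).trans (hC u ⟨hu.1, hu.2.le⟩))
  rw [← hl]
  simp only [one_smul, zero_smul, add_zero, one_mul, zero_mul, sub_zero, Real.norm_eq_abs] at h2
  refine (le_abs_self _).trans (le_trans (le_of_eq ?_) h2)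
  congr 1
  simp only [map_sub]
  ring

theorem tendsto_of_forall_seminorm {α : Type*} {l : Filter α} {u : α → F} {v : F}
    (h : ∀ q : Seminorm ℝ F, Continuous q → ∀ ε > 0, ∀ᶠ a in l, q (u a - v) ≤ ε) :
    Tendsto u l (𝓝 v) := by
  have hF := with_gaugeSeminormFamily (𝕜 := ℝ) (E := F)
  rw [hF.tendsto_nhds u v]
  intro i ε hε
  filter_upwards [h _ (hF.continuous_seminorm i) (ε / 2) (half_pos hε)] with a ha
  linarith

variable [IsTopologicalAddGroup E] [ContinuousSMul ℝ E]

/-- Difference quotients of a `C^1`-map converge also when base point and direction move. -/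
theorem tendsto_diffQuotient {α : Type*} {l : Filter α} {g : E → F} {dg : E × E → F} {V : Set E}
    (hV : IsOpen V) (hd : ∀ x ∈ V, ∀ y, HasDirDeriv g (dg (x, y)) x y)
    (hc : ContinuousOn dg (V ×ˢ univ)) {t : α → ℝ} {z w : α → E} {z₀ w₀ : E} (hz₀ : z₀ ∈ V)
    (ht : Tendsto t l (𝓝 0)) (ht0 : ∀ᶠ a in l, t a ≠ 0) (hz : Tendsto z l (𝓝 z₀))
    (hw : Tendsto w l (𝓝 w₀)) :
    Tendsto (fun a => (t a)⁻¹ • (g (z a + t a • w a) - g (z a))) l (𝓝 (dg (z₀, w₀))) := by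
  refine tendsto_of_forall_seminorm fun q hq ε hε => ?_
  have hcont : ContinuousAt (fun r : E × E => q (dg r - dg (z₀, w₀))) (z₀, w₀) :=
    hq.continuousAt.comp
      ((hc.continuousAt ((hV.prod isOpen_univ).mem_nhds ⟨hz₀, trivial⟩)).sub continuousAt_const)
  have hev : ∀ᶠ r : E × E in 𝓝 (z₀, w₀), r.1 ∈ V ∧ q (dg r - dg (z₀, w₀)) < ε := by
    refine (continuousAt_fst.eventually (hV.mem_nhds hz₀)).and (hcont.eventually (gt_mem_nhds ?_))
    simpa using hε
  have hmap : Continuous fun r : ((ℝ × E) × E) × ℝ =>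
    ((r.1.1.2 + (r.2 * r.1.1.1) • r.1.2, r.1.2) : E × E) := by fun_prop
  -- compactness of `[0,1]` makes the estimate uniform along the segments
  have hunif : ∀ᶠ r : (ℝ × E) × E in 𝓝 ((0, z₀), w₀), ∀ u ∈ Icc (0 : ℝ) 1,
      r.1.2 + (u * r.1.1) • r.2 ∈ V ∧
        q (dg (r.1.2 + (u * r.1.1) • r.2, r.2) - dg (z₀, w₀)) < ε := by
    refine isCompact_Icc.eventually_forall_of_forall_eventually fun u _ => ?_
    exact (hmap.tendsto' (((0, z₀), w₀), u) (z₀, w₀) (by simp)).eventually hev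
  filter_upwards [((ht.prodMk_nhds hz).prodMk_nhds hw).eventually hunif, ht0] with a ha h0
  have key : q (g (z a + t a • w a) - g (z a) - t a • dg (z₀, w₀)) ≤ |t a| * ε := by
    refine seminorm_sub_sub_le_of_hasDirDeriv hq
      (dg := fun u => t a • dg (z a + (u * t a) • w a, w a)) (fun u hu => ?_) (fun u hu => ?_)
    · have := (hd _ (ha u hu).1 (w a)).smul (t a)
      rwa [← smul_smul u] at this ⊢
    · rw [← smul_sub, map_smul_eq_mul, Real.norm_eq_abs]
      exact mul_le_mul_of_nonneg_left (ha u hu).2.le (abs_nonneg _)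
  have e : (t a)⁻¹ • (g (z a + t a • w a) - g (z a)) - dg (z₀, w₀)
      = (t a)⁻¹ • (g (z a + t a • w a) - g (z a) - t a • dg (z₀, w₀)) := by
    rw [smul_sub _ _ (t a • _), inv_smul_smul₀ h0]
  rw [e, map_smul_eq_mul, norm_inv, Real.norm_eq_abs]
  rw [inv_mul_le_iff₀ (abs_pos.2 h0)]
  exact key

/-- The derivative of a `C^1`-map is additive in the direction. -/
theorem dirDeriv_add [T2Space F] {g : E → F} {dg : E × E → F} {V : Set E}
    (hV : IsOpen V) (hd : ∀ x ∈ V, ∀ y, HasDirDeriv g (dg (x, y)) x y)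
    (hc : ContinuousOn dg (V ×ˢ univ)) {x : E} (hx : x ∈ V) (y y' : E) :
    dg (x, y + y') = dg (x, y) + dg (x, y') := by
  refine (hd x hx (y + y')).unique ?_
  have h0 : ∀ᶠ t : ℝ in 𝓝[≠] 0, t ≠ 0 := self_mem_nhdsWithin
  have hid : Tendsto (fun t : ℝ => t) (𝓝[≠] 0) (𝓝 0) := nhdsWithin_le_nhds
  have h1 := tendsto_diffQuotient hV hd hc hx hid h0 (z := fun t => x + t • y) (w := fun _ => y')
    ((Continuous.tendsto' (by fun_prop) 0 x (by simp)).mono_left nhdsWithin_le_nhds)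
    tendsto_const_nhds
  refine ((hd x hx y).add h1).congr fun t => ?_
  rw [← smul_add]
  congr 1
  rw [smul_add, ← add_assoc]
  abel

end MeanValue

/-! ### The recursive form of Bastiani's calculus -/

section Recursive

universe u v w

/-- `f` is `C^n` on `U` in Bastiani's sense, defined by recursion: `f` is continuous and, for
`n > 0`, has directional derivatives `df (x, y)` that form a `C^(n-1)`-map on `U × E`. In contrast
to `ContDiffLC`, the order is finite and all derivatives, also those with respect to the direction
`y`, are taken on the product space. -/
def BastianiOn {F : Type v} [AddCommGroup F] [Module ℝ F] [TopologicalSpace F] :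
    ℕ → ∀ {E : Type u} [AddCommGroup E] [Module ℝ E] [TopologicalSpace E],
      (E → F) → Set E → Prop
  | 0, _, _, _, _, f, U => ContinuousOn f U
  | n + 1, E, _, _, _, f, U => ContinuousOn f U ∧ ∃ df : E × E → F,
      (∀ x ∈ U, ∀ y, HasDirDeriv f (df (x, y)) x y) ∧ BastianiOn n df (U ×ˢ univ)

variable {F : Type v} [AddCommGroup F] [Module ℝ F] [TopologicalSpace F]

theorem BastianiOn.continuousOn {n : ℕ} {E : Type u} [AddCommGroup E] [Module ℝ E]
    [TopologicalSpace E] {f : E → F} {U : Set E} (h : BastianiOn n f U) : ContinuousOn f U := by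
  cases n with
  | zero => exact h
  | succ n => exact h.1

theorem BastianiOn.of_succ : ∀ (n : ℕ) {E : Type u} [AddCommGroup E] [Module ℝ E]
    [TopologicalSpace E] {f : E → F} {U : Set E}, BastianiOn (n + 1) f U → BastianiOn n f U
  | 0, _, _, _, _, _, _, h => h.1
  | n + 1, _, _, _, _, _, _, ⟨hc, df, hd, hdf⟩ => ⟨hc, df, hd, BastianiOn.of_succ n hdf⟩

theorem BastianiOn.of_le {m n : ℕ} (hmn : m ≤ n) {E : Type u} [AddCommGroup E] [Module ℝ E]
    [TopologicalSpace E] {f : E → F} {U : Set E} (h : BastianiOn n f U) : BastianiOn m f U := by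
  induction hmn with
  | refl => exact h
  | step _ ih => exact ih (BastianiOn.of_succ _ h)

theorem BastianiOn.mono : ∀ {n : ℕ} {E : Type u} [AddCommGroup E] [Module ℝ E]
    [TopologicalSpace E] {f : E → F} {U V : Set E}, BastianiOn n f U → V ⊆ U → BastianiOn n f V
  | 0, _, _, _, _, _, _, _, h, hVU => ContinuousOn.mono h hVU
  | _ + 1, _, _, _, _, _, _, _, ⟨hc, df, hd, hdf⟩, hVU =>
    ⟨hc.mono hVU, df, fun x hx => hd x (hVU hx), hdf.mono (prod_mono hVU subset_rfl)⟩

theorem BastianiOn.congr {n : ℕ} {E : Type u} [AddCommGroup E] [Module ℝ E]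
    [TopologicalSpace E] [IsTopologicalAddGroup E] [ContinuousSMul ℝ E] {f g : E → F} {U : Set E}
    (h : BastianiOn n f U) (hU : IsOpen U) (hfg : EqOn f g U) : BastianiOn n g U := by
  cases n with
  | zero => exact ContinuousOn.congr h hfg.symm
  | succ n =>
    obtain ⟨hc, df, hd, hdf⟩ := h
    exact ⟨hc.congr hfg.symm, df, fun x hx y => (hd x hx y).congr_of_isOpen hU hx hfg, hdf⟩

theorem BastianiOn.comp_affine : ∀ {n : ℕ} {E : Type u} [AddCommGroup E] [Module ℝ E]
    [TopologicalSpace E] [ContinuousAdd E] {E' : Type w} [AddCommGroup E'] [Module ℝ E']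
    [TopologicalSpace E'] {f : E → F} {U : Set E},
    BastianiOn n f U → ∀ (A : E' →L[ℝ] E) (b : E),
      BastianiOn n (fun x => f (A x + b)) {x | A x + b ∈ U}
  | 0, _, _, _, _, _, _, _, _, _, _, _, h, A, b =>
    ContinuousOn.comp h (A.continuous.add continuous_const).continuousOn fun _ hx => hx
  | n + 1, _, _, _, _, _, _, _, _, _, _, _, ⟨hc, df, hd, hdf⟩, A, b => by
    refine ⟨hc.comp (A.continuous.add continuous_const).continuousOn fun _ hx => hx,
      fun z => df ((A.prodMap A) z + (b, 0)), fun x hx y => ?_, ?_⟩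
    · have e : (A.prodMap A) (x, y) + (b, 0) = (A x + b, A y) := by ext <;> simp
      have := hd _ hx (A y)
      simp only [HasDirDeriv, map_add, map_smul, e] at this ⊢
      refine this.congr fun t => ?_
      rw [add_right_comm]
    · exact (hdf.comp_affine (A.prodMap A) (b, 0)).mono fun z hz => ⟨hz.1, trivial⟩

theorem BastianiOn.comp_clm {n : ℕ} {E : Type u} [AddCommGroup E] [Module ℝ E]
    [TopologicalSpace E] [ContinuousAdd E] {E' : Type w} [AddCommGroup E'] [Module ℝ E']
    [TopologicalSpace E'] {f : E → F} {U : Set E} (h : BastianiOn n f U) (A : E' →L[ℝ] E) :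
    BastianiOn n (fun x => f (A x)) (A ⁻¹' U) :=
  (by simpa using h.comp_affine A 0 : BastianiOn n (fun x => f (A x)) {x | A x ∈ U})

theorem BastianiOn.clm_comp {F' : Type w} [AddCommGroup F'] [Module ℝ F'] [TopologicalSpace F'] :
    ∀ {n : ℕ} {E : Type u} [AddCommGroup E] [Module ℝ E]
    [TopologicalSpace E] {f : E → F} {U : Set E} (L : F →L[ℝ] F'),
    BastianiOn n f U → BastianiOn n (fun x => L (f x)) U
  | 0, _, _, _, _, _, _, L, h => L.continuous.comp_continuousOn h
  | n + 1, _, _, _, _, _, _, L, ⟨hc, df, hd, hdf⟩ => by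
    refine ⟨L.continuous.comp_continuousOn hc, fun z => L (df z), fun x hx y => ?_,
      hdf.clm_comp L⟩
    refine ((L.continuous.tendsto _).comp (hd x hx y)).congr fun t => ?_
    simp only [Function.comp_apply, map_smul, map_sub]

theorem BastianiOn.prodMk {F' : Type w} [AddCommGroup F'] [Module ℝ F'] [TopologicalSpace F'] :
    ∀ {n : ℕ} {E : Type u} [AddCommGroup E] [Module ℝ E]
    [TopologicalSpace E] {f : E → F} {g : E → F'} {U : Set E},
    BastianiOn n f U → BastianiOn n g U → BastianiOn n (fun x => (f x, g x)) U
  | 0, _, _, _, _, _, _, _, h, h' => ContinuousOn.prodMk h h'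
  | _ + 1, _, _, _, _, _, _, _, ⟨hc, df, hd, hdf⟩, ⟨hc', df', hd', hdf'⟩ =>
    ⟨hc.prodMk hc', fun z => (df z, df' z), fun x hx y => (hd x hx y).prodMk_nhds (hd' x hx y),
      hdf.prodMk hdf'⟩

theorem BastianiOn.const : ∀ {n : ℕ} {E : Type u} [AddCommGroup E] [Module ℝ E]
    [TopologicalSpace E] (c : F) (U : Set E), BastianiOn n (fun _ => c) U
  | 0, _, _, _, _, _, _ => continuousOn_const
  | _ + 1, _, _, _, _, c, _ => by
    refine ⟨continuousOn_const, fun _ => 0, fun x _ y => ?_, BastianiOn.const 0 _⟩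
    simpa [HasDirDeriv] using tendsto_const_nhds

theorem BastianiOn.add [ContinuousAdd F] {n : ℕ} {E : Type u} [AddCommGroup E] [Module ℝ E]
    [TopologicalSpace E] {f g : E → F} {U : Set E} (hf : BastianiOn n f U)
    (hg : BastianiOn n g U) : BastianiOn n (fun x => f x + g x) U :=
  (hf.prodMk hg).clm_comp (ContinuousLinearMap.fst ℝ F F + ContinuousLinearMap.snd ℝ F F)

theorem BastianiOn.sum [ContinuousAdd F] {n : ℕ} {E : Type u} [AddCommGroup E] [Module ℝ E]
    [TopologicalSpace E] {ι : Type*} (s : Finset ι) {f : ι → E → F} {U : Set E}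
    (hf : ∀ i ∈ s, BastianiOn n (f i) U) : BastianiOn n (fun x => ∑ i ∈ s, f i x) U := by
  classical
  induction s using Finset.induction_on with
  | empty => simpa using BastianiOn.const (0 : F) U
  | insert i s hi ih =>
    simp only [Finset.sum_insert hi]
    exact (hf i (Finset.mem_insert_self i s)).add
      (ih fun j hj => hf j (Finset.mem_insert_of_mem hj))

/-- The chain rule. -/
theorem BastianiOn.comp {F' : Type w} [AddCommGroup F'] [Module ℝ F'] [TopologicalSpace F']
    [IsTopologicalAddGroup F'] [ContinuousSMul ℝ F'] [LocallyConvexSpace ℝ F'] :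
    ∀ {n : ℕ} {E : Type u} [AddCommGroup E] [Module ℝ E]
    [TopologicalSpace E] [IsTopologicalAddGroup E] [ContinuousSMul ℝ E]
    {F : Type v} [AddCommGroup F] [Module ℝ F] [TopologicalSpace F]
    [IsTopologicalAddGroup F] [ContinuousSMul ℝ F]
    {f : E → F} {g : F → F'} {U : Set E} {V : Set F},
    IsOpen V → BastianiOn n g V → BastianiOn n f U → MapsTo f U V →
      BastianiOn n (fun x => g (f x)) U
  | 0, _, _, _, _, _, _, _, _, _, _, _, _, _, _, _, _, _, hg, hf, hUV => ContinuousOn.comp hg hf hUV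
  | n + 1, E, _, _, _, _, _, _, _, _, _, _, _, f, g, U, V, hV, hg, ⟨hc, df, hd, hdf⟩, hUV => by
    obtain ⟨hgc, dg, hdg, hddg⟩ := hg
    refine ⟨hgc.comp hc hUV, fun z => dg (f z.1, df z), fun x hx y => ?_, ?_⟩
    · have h0 : ∀ᶠ t : ℝ in 𝓝[≠] 0, t ≠ 0 := self_mem_nhdsWithin
      have hid : Tendsto (fun t : ℝ => t) (𝓝[≠] 0) (𝓝 0) := nhdsWithin_le_nhds
      have := tendsto_diffQuotient hV hdg hddg.continuousOn (hUV hx) hid h0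
        (z := fun _ => f x) tendsto_const_nhds (hd x hx y)
      refine this.congr' ?_
      filter_upwards [h0] with t ht
      rw [smul_inv_smul₀ ht, add_sub_cancel]
    · have h1 : BastianiOn n (fun z : E × E => f z.1) (U ×ˢ univ) :=
        ((BastianiOn.of_succ n (f := f) ⟨hc, df, hd, hdf⟩).comp_clm
          (ContinuousLinearMap.fst ℝ E E)).mono fun z hz => hz.1
      exact hddg.comp (hV.prod isOpen_univ) (h1.prodMk hdf) fun z hz => ⟨hUV hz.1, trivial⟩

/-- The value of the directional derivative, and `0` where there is none. -/
noncomputable def dirDeriv {E : Type u} [AddCommGroup E] [Module ℝ E] (f : E → F) (x y : E) : F :=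
  open Classical in if h : ∃ v, HasDirDeriv f v x y then h.choose else 0

theorem HasDirDeriv.dirDeriv_eq [T2Space F] {E : Type u} [AddCommGroup E] [Module ℝ E]
    [TopologicalSpace E] {f : E → F} {v : F} {x y : E} (h : HasDirDeriv f v x y) :
    dirDeriv f x y = v := by
  have h' : ∃ v, HasDirDeriv f v x y := ⟨v, h⟩
  rw [dirDeriv, dif_pos h']
  exact h'.choose_spec.unique h

/-- Being `C^n` is a local property: the derivative is unique, hence local derivatives agree with
the global function `dirDeriv`. -/
theorem BastianiOn.of_locally [T2Space F] : ∀ {n : ℕ} {E : Type u} [AddCommGroup E] [Module ℝ E]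
    [TopologicalSpace E] [IsTopologicalAddGroup E] [ContinuousSMul ℝ E] {f : E → F} {U : Set E},
    (∀ x ∈ U, ∃ V, IsOpen V ∧ x ∈ V ∧ V ⊆ U ∧ BastianiOn n f V) → BastianiOn n f U
  | 0, _, _, _, _, _, _, f, _, h => fun x hx => by
    obtain ⟨V, hV, hxV, _, hb⟩ := h x hx
    exact (ContinuousOn.continuousAt hb (hV.mem_nhds hxV)).continuousWithinAt
  | n + 1, E, _, _, _, _, _, f, U, h => by
    refine ⟨fun x hx => ?_, fun z => dirDeriv f z.1 z.2, fun x hx y => ?_,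
      BastianiOn.of_locally fun z hz => ?_⟩
    · obtain ⟨V, hV, hxV, _, hb⟩ := h x hx
      exact (hb.1.continuousAt (hV.mem_nhds hxV)).continuousWithinAt
    · obtain ⟨V, hV, hxV, _, _, df, hd, _⟩ := h x hx
      simpa only [(hd x hxV y).dirDeriv_eq] using hd x hxV y
    · obtain ⟨V, hV, hxV, hVU, _, df, hd, hdf⟩ := h z.1 hz.1
      exact ⟨V ×ˢ univ, hV.prod isOpen_univ, ⟨hxV, trivial⟩, prod_mono hVU subset_rfl,
        hdf.congr (hV.prod isOpen_univ) fun r hr => (hd r.1 hr.1 r.2).dirDeriv_eq.symm⟩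

end Recursive

/-! ### Comparison of the two descriptions of `C^k`-maps -/

section Comparison

universe u v

variable {E : Type u} [AddCommGroup E] [Module ℝ E] [TopologicalSpace E]
  {F : Type v} [AddCommGroup F] [Module ℝ F] [TopologicalSpace F]

/-- `d` is a family of iterated directional derivatives of `f` as required by `ContDiffLC`. -/
structure IsDerivFamily (k : ℕ∞) (f : E → F) (U : Set E) (d : (j : ℕ) → E → (Fin j → E) → F) :
    Prop where
  zero : ∀ x ∈ U, ∀ y, d 0 x y = f x
  deriv : ∀ j : ℕ, (j : ℕ∞) + 1 ≤ k → ∀ x ∈ U, ∀ y : Fin (j + 1) → E,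
    HasDirDeriv (fun z => d j z (Fin.init y)) (d (j + 1) x y) x (y (Fin.last j))
  cont : ∀ j : ℕ, (j : ℕ∞) ≤ k →
    ContinuousOn (fun z : E × (Fin j → E) => d j z.1 z.2) (U ×ˢ univ)

theorem HasDirDeriv.add [ContinuousAdd F] {f g : E → F} {v w : F} {x y : E}
    (hf : HasDirDeriv f v x y) (hg : HasDirDeriv g w x y) :
    HasDirDeriv (fun z => f z + g z) (v + w) x y := by
  refine (Tendsto.add hf hg).congr fun t => ?_
  rw [← smul_add, add_sub_add_comm]

theorem HasDirDeriv.const_smul [ContinuousSMul ℝ F] {f : E → F} {v : F} {x y : E}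
    (hf : HasDirDeriv f v x y) (c : ℝ) : HasDirDeriv (fun z => c • f z) (c • v) x y := by
  refine (Tendsto.const_smul hf c).congr fun t => ?_
  rw [smul_comm, smul_sub]

theorem Fin.snoc_init_eq_update {X : Type*} {j : ℕ} (y : Fin (j + 1) → X) (a : X) :
    (Fin.snoc (Fin.init y) a : Fin (j + 1) → X) = Function.update y (Fin.last j) a := by
  conv_rhs => rw [← Fin.snoc_init_self y]
  rw [Fin.update_snoc_last]

namespace IsDerivFamily

variable {k : ℕ∞} {f : E → F} {U : Set E} {d : (j : ℕ) → E → (Fin j → E) → F}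

theorem hasDirDeriv_snoc (h : IsDerivFamily k f U d) {j : ℕ} (hj : (j : ℕ∞) + 1 ≤ k) {x : E}
    (hx : x ∈ U) (y : Fin j → E) (v : E) :
    HasDirDeriv (fun z => d j z y) (d (j + 1) x (Fin.snoc y v)) x v := by
  simpa using h.deriv j hj x hx (Fin.snoc y v)

theorem continuousOn_comp (h : IsDerivFamily k f U d) {j : ℕ} (hj : (j : ℕ∞) ≤ k)
    {X : Type*} [TopologicalSpace X] {a : X → E} {b : X → Fin j → E} {S : Set X}
    (ha : ContinuousOn a S) (hb : ContinuousOn b S) (hS : MapsTo a S U) :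
    ContinuousOn (fun x => d j (a x) (b x)) S :=
  (h.cont j hj).comp (ha.prodMk hb) fun _ hx => ⟨hS hx, trivial⟩

variable [IsTopologicalAddGroup E] [ContinuousSMul ℝ E]
  [IsTopologicalAddGroup F] [ContinuousSMul ℝ F] [LocallyConvexSpace ℝ F] [T2Space F]

/-- The iterated directional derivatives are multilinear in the directions. -/
theorem exists_multilinearMap (h : IsDerivFamily k f U d) (hU : IsOpen U) :
    ∀ j : ℕ, (j : ℕ∞) ≤ k → ∀ x ∈ U, ∃ M : MultilinearMap ℝ (fun _ : Fin j => E) F,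
      ∀ y, M y = d j x y := by
  intro j
  induction j with
  | zero =>
    intro _ x _
    exact ⟨{ toFun := d 0 x, map_update_add' := fun _ i => i.elim0,
             map_update_smul' := fun _ i => i.elim0 }, fun _ => rfl⟩
  | succ j ih =>
    intro hj x hx
    have hj1 : (j : ℕ∞) + 1 ≤ k := by exact_mod_cast hj
    have hj0 : (j : ℕ∞) ≤ k := le_trans le_self_add hj1
    choose! M hM using ih hj0
    refine ⟨{ toFun := d (j + 1) x, map_update_add' := ?_, map_update_smul' := ?_ },
      fun _ => rfl⟩
    · intro inst y i a b
      obtain rfl : inst = instDecidableEqFin _ := Subsingleton.elim _ _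
      obtain ⟨i, rfl⟩ | rfl := i.eq_castSucc_or_eq_last
      · have e : ∀ c, HasDirDeriv (fun z => M z (Function.update (Fin.init y) i c))
            (d (j + 1) x (Function.update y i.castSucc c)) x (y (Fin.last j)) := by
          intro c
          have := h.deriv j hj1 x hx (Function.update y i.castSucc c)
          rw [Function.update_of_ne (Fin.castSucc_lt_last i).ne'] at this
          refine this.congr_of_isOpen hU hx fun z hz => ?_
          simp only [hM z hz, Fin.init_update_castSucc]
        refine (e (a + b)).unique ?_
        simp only [MultilinearMap.map_update_add]
        exact (e a).add (e b)
      · simp only [← Fin.snoc_init_eq_update]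
        refine dirDeriv_add (g := fun z => d j z (Fin.init y))
          (dg := fun z => d (j + 1) z.1 (Fin.snoc (Fin.init y) z.2)) hU
          (fun z hz v => h.hasDirDeriv_snoc hj1 hz _ v) ?_ hx a b
        exact h.continuousOn_comp hj continuousOn_fst
          (Continuous.continuousOn (by fun_prop)) fun z hz => hz.1
    · intro inst y i c a
      obtain rfl : inst = instDecidableEqFin _ := Subsingleton.elim _ _
      obtain ⟨i, rfl⟩ | rfl := i.eq_castSucc_or_eq_last
      · have e : ∀ c, HasDirDeriv (fun z => M z (Function.update (Fin.init y) i c))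
            (d (j + 1) x (Function.update y i.castSucc c)) x (y (Fin.last j)) := by
          intro c
          have := h.deriv j hj1 x hx (Function.update y i.castSucc c)
          rw [Function.update_of_ne (Fin.castSucc_lt_last i).ne'] at this
          refine this.congr_of_isOpen hU hx fun z hz => ?_
          simp only [hM z hz, Fin.init_update_castSucc]
        refine (e (c • a)).unique ?_
        simp only [MultilinearMap.map_update_smul]
        exact (e a).const_smul c
      · simp only [← Fin.snoc_init_eq_update]
        exact (h.hasDirDeriv_snoc hj1 hx _ (c • a)).unique
          ((h.hasDirDeriv_snoc hj1 hx _ a).smul c)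

/-- The derivative of `(x, y) ↦ d j x y`, as a map on the product space. -/
theorem hasDirDeriv_prod (h : IsDerivFamily k f U d) (hU : IsOpen U) {j : ℕ}
    (hj : (j : ℕ∞) + 1 ≤ k) {x : E} (hx : x ∈ U) (y : Fin j → E) (v : E) (w : Fin j → E) :
    HasDirDeriv (fun z : E × (Fin j → E) => d j z.1 z.2)
      (d (j + 1) x (Fin.snoc y v) + ∑ i, d j x (Function.update y i (w i))) (x, y) (v, w) := by
  classical
  have hj0 : (j : ℕ∞) ≤ k := le_trans le_self_add hj
  choose! M hM using h.exists_multilinearMap hU j hj0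
  have hcx : Tendsto (fun t : ℝ => x + t • v) (𝓝[≠] 0) (𝓝 x) :=
    (Continuous.tendsto' (by fun_prop) 0 x (by simp)).mono_left nhdsWithin_le_nhds
  have hxU := hcx.eventually (hU.mem_nhds hx)
  have h0 : ∀ᶠ t : ℝ in 𝓝[≠] 0, t ≠ 0 := self_mem_nhdsWithin
  -- the directions are moved one at a time
  have key : ∀ s : Finset (Fin j), Tendsto (fun t : ℝ =>
      t⁻¹ • (d j (x + t • v) (fun i => if i ∈ s then y i + t • w i else y i)
        - d j (x + t • v) y)) (𝓝[≠] 0) (𝓝 (∑ i ∈ s, d j x (Function.update y i (w i)))) := by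
    intro s
    induction s using Finset.induction_on with
    | empty => simp
    | insert a s ha ih =>
      rw [Finset.sum_insert ha]
      have hca : Tendsto (fun t : ℝ => d j (x + t • v)
          (Function.update (fun i => if i ∈ s then y i + t • w i else y i) a (w a)))
          (𝓝[≠] 0) (𝓝 (d j x (Function.update y a (w a)))) := by
        have hc := (h.cont j hj0).continuousAt (x := (x, Function.update y a (w a)))
          ((hU.prod isOpen_univ).mem_nhds ⟨hx, trivial⟩)
        refine Tendsto.comp (f := fun t : ℝ => (x + t • v,
          Function.update (fun i => if i ∈ s then y i + t • w i else y i) a (w a))) hc ?_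
        refine hcx.prodMk_nhds (tendsto_pi_nhds.2 fun i => ?_)
        by_cases hia : i = a
        · subst hia
          simpa using tendsto_const_nhds
        · simp only [Function.update_of_ne hia]
          split_ifs
          · exact (Continuous.tendsto' (by fun_prop) 0 _ (by simp)).mono_left nhdsWithin_le_nhds
          · exact tendsto_const_nhds
      refine (hca.add ih).congr' ?_
      filter_upwards [h0, hxU] with t ht hxt
      have e1 : (fun i => if i ∈ insert a s then y i + t • w i else y i) =
          Function.update (fun i => if i ∈ s then y i + t • w i else y i) a (y a + t • w a) := by
        funext i
        by_cases hia : i = a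
        · subst hia; simp
        · simp [hia]
      have e2 : Function.update (fun i => if i ∈ s then y i + t • w i else y i) a (y a) =
          fun i => if i ∈ s then y i + t • w i else y i := by
        funext i
        by_cases hia : i = a
        · subst hia; simp [ha]
        · simp [hia]
      rw [e1, ← hM _ hxt, ← hM _ hxt, ← hM _ hxt, ← hM _ hxt, MultilinearMap.map_update_add,
        MultilinearMap.map_update_smul, e2, add_comm (M _ _) (t • _), add_sub_assoc, smul_add,
        inv_smul_smul₀ ht]
  have hu := key Finset.univ
  have hv := h.hasDirDeriv_snoc hj hx y v
  refine (Tendsto.add hv hu).congr fun t => ?_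
  rw [← smul_add]
  simp only [Finset.mem_univ, if_true, Prod.fst_add, Prod.snd_add, Prod.smul_fst, Prod.smul_snd]
  congr 1
  rw [sub_add_sub_comm, add_comm (d j (x + t • v) y), add_sub_add_right_eq_sub]
  rfl

/-- The `j`-th derivative of a `C^k`-map is a `C^(k-j)`-map on the product space, as its derivatives
are sums of derivatives of order `j` and `j + 1`, composed with continuous linear maps. -/
theorem bastianiOn_prod (h : IsDerivFamily k f U d) (hU : IsOpen U) : ∀ n j : ℕ,
    (j : ℕ∞) + n ≤ k → BastianiOn n (fun z : E × (Fin j → E) => d j z.1 z.2) (U ×ˢ univ) := by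
  intro n
  induction n with
  | zero => exact fun j hj => h.cont j (by simpa using hj)
  | succ n ih =>
    intro j hj
    have hj1 : ((j + 1 : ℕ) : ℕ∞) + n ≤ k := by
      refine le_trans (le_of_eq ?_) hj
      push_cast
      rw [add_assoc, add_comm 1 (n : ℕ∞)]
    have hj0 : (j : ℕ∞) + n ≤ k := le_trans (by gcongr; simp) hj
    have hj2 : (j : ℕ∞) + 1 ≤ k := le_trans (by gcongr; simp) hj
    refine ⟨h.cont j (le_trans le_self_add hj), fun z => d (j + 1) z.1.1 (Fin.snoc z.1.2 z.2.1) +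
      ∑ i, d j z.1.1 (Function.update z.1.2 i (z.2.2 i)),
      fun z hz w => h.hasDirDeriv_prod hU hj2 hz.1 z.2 w.1 w.2, ?_⟩
    refine BastianiOn.add ?_ (BastianiOn.sum _ fun i _ => ?_)
    · let A : (E × (Fin j → E)) × (E × (Fin j → E)) →L[ℝ] E × (Fin (j + 1) → E) :=
        { toFun := fun z => (z.1.1, Fin.snoc z.1.2 z.2.1)
          map_add' := fun a b => by
            refine Prod.ext rfl (funext fun i => ?_)
            refine Fin.lastCases ?_ (fun i => ?_) i <;> simp
          map_smul' := fun c a => by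
            refine Prod.ext rfl (funext fun i => ?_)
            refine Fin.lastCases ?_ (fun i => ?_) i <;> simp
          cont := by fun_prop }
      exact ((ih (j + 1) hj1).comp_clm A).mono fun z hz => ⟨hz.1.1, trivial⟩
    · let A : (E × (Fin j → E)) × (E × (Fin j → E)) →L[ℝ] E × (Fin j → E) :=
        { toFun := fun z => (z.1.1, Function.update z.1.2 i (z.2.2 i))
          map_add' := fun a b => by
            refine Prod.ext rfl (funext fun l => ?_)
            by_cases hl : l = i
            · subst hl; simp
            · simp [hl]
          map_smul' := fun c a => by
            refine Prod.ext rfl (funext fun l => ?_)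
            by_cases hl : l = i
            · subst hl; simp
            · simp [hl]
          cont := by fun_prop }
      exact ((ih j hj0).comp_clm A).mono fun z hz => ⟨hz.1.1, trivial⟩

end IsDerivFamily

variable [IsTopologicalAddGroup E] [ContinuousSMul ℝ E]
  [IsTopologicalAddGroup F] [ContinuousSMul ℝ F] [T2Space F]

theorem ContDiffLC.bastianiOn [LocallyConvexSpace ℝ F] {k : ℕ∞} {f : E → F} {U : Set E}
    (h : ContDiffLC k f U) {n : ℕ} (hn : (n : ℕ∞) ≤ k) : BastianiOn n f U := by
  obtain ⟨hU, d, h0, h1, h2⟩ := h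
  have hd : IsDerivFamily k f U d := ⟨h0, h1, h2⟩
  refine (((hd.bastianiOn_prod hU n 0 (by simpa using hn)).comp_clm
    (ContinuousLinearMap.inl ℝ E (Fin 0 → E))).mono fun x hx => ⟨hx, trivial⟩).congr hU
      fun x hx => ?_
  exact h0 x hx _

/-- The iterated directional derivative `D_{y_j} ⋯ D_{y_1} f (x)`. -/
noncomputable def iterDirDeriv (f : E → F) : (j : ℕ) → E → (Fin j → E) → F
  | 0, x, _ => f x
  | j + 1, x, y => dirDeriv (fun z => iterDirDeriv f j z (Fin.init y)) x (y (Fin.last j))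

theorem BastianiOn.iterDirDeriv {f : E → F} {U : Set E} (hU : IsOpen U) : ∀ (j m : ℕ),
    BastianiOn (m + j) f U →
      BastianiOn m (fun z : E × (Fin j → E) => iterDirDeriv f j z.1 z.2) (U ×ˢ univ)
  | 0, _, h => (h.comp_clm (ContinuousLinearMap.fst ℝ E (Fin 0 → E))).mono fun _ hx => hx.1
  | j + 1, m, h => by
    obtain ⟨-, dg, hd, hdg⟩ := BastianiOn.iterDirDeriv hU j (m + 1) (by convert h using 1; ring)
    let A : E × (Fin (j + 1) → E) →L[ℝ] (E × (Fin j → E)) × (E × (Fin j → E)) :=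
      { toFun := fun z => ((z.1, Fin.init z.2), (z.2 (Fin.last j), 0))
        map_add' := fun a b => by ext <;> simp [Fin.init]
        map_smul' := fun c a => by ext <;> simp [Fin.init]
        cont := by fun_prop }
    refine ((hdg.comp_clm A).mono fun z hz => ⟨⟨hz.1, trivial⟩, trivial⟩).congr
      (hU.prod isOpen_univ) fun z hz => ?_
    have h1 := hd (z.1, Fin.init z.2) ⟨hz.1, trivial⟩ (z.2 (Fin.last j), 0)
    have h2 : HasDirDeriv (fun r => _root_.iterDirDeriv f j r (Fin.init z.2))
        (dg ((z.1, Fin.init z.2), (z.2 (Fin.last j), 0))) z.1 (z.2 (Fin.last j)) := by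
      simpa [HasDirDeriv] using h1
    exact h2.dirDeriv_eq.symm

/-- The iterated derivatives in fixed directions are restrictions of the derivatives on the product
spaces to directions with second component `0`. -/
theorem contDiffLC_of_bastianiOn {k : ℕ∞} {f : E → F} {U : Set E} (hU : IsOpen U)
    (h : ∀ n : ℕ, (n : ℕ∞) ≤ k → BastianiOn n f U) : ContDiffLC k f U := by
  refine ⟨hU, iterDirDeriv f, fun _ _ _ => rfl, fun j hj x hx y => ?_, fun j hj => ?_⟩
  · obtain ⟨-, dg, hd, -⟩ := BastianiOn.iterDirDeriv hU j 1
      (h (1 + j) (by push_cast; rwa [add_comm]))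
    have h1 := hd (x, Fin.init y) ⟨hx, trivial⟩ (y (Fin.last j), 0)
    have h2 : HasDirDeriv (fun r => iterDirDeriv f j r (Fin.init y))
        (dg ((x, Fin.init y), (y (Fin.last j), 0))) x (y (Fin.last j)) := by
      simpa [HasDirDeriv] using h1
    simpa only [iterDirDeriv, h2.dirDeriv_eq] using h2
  · exact (BastianiOn.iterDirDeriv hU j 0 (by simpa using h j hj)).continuousOn

end Comparison

/-! ### Symmetry of second derivatives and seminorm estimates near compact sets -/

section Estimates

variable {E : Type*} [AddCommGroup E] [Module ℝ E] [TopologicalSpace E]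
  [IsTopologicalAddGroup E] [ContinuousSMul ℝ E]
  {F : Type*} [AddCommGroup F] [Module ℝ F] [TopologicalSpace F]
  [IsTopologicalAddGroup F] [ContinuousSMul ℝ F] [LocallyConvexSpace ℝ F] [T2Space F]

namespace IsDerivFamily

variable {k : ℕ∞} {f : E → F} {U : Set E} {d : (j : ℕ) → E → (Fin j → E) → F}

theorem hasDirDeriv_one (h : IsDerivFamily k f U d) (hU : IsOpen U) (hk : 1 ≤ k) {x : E}
    (hx : x ∈ U) (v : E) : HasDirDeriv f (d 1 x ![v]) x v := by
  refine (h.deriv 0 (by simpa using hk) x hx ![v]).congr_of_isOpen hU hx fun z hz => ?_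
  exact h.zero z hz _

theorem hasDirDeriv_two (h : IsDerivFamily k f U d) (hk : 2 ≤ k) {x : E}
    (hx : x ∈ U) (v w : E) : HasDirDeriv (fun z => d 1 z ![v]) (d 2 x ![v, w]) x w := by
  have e : (Fin.init ![v, w] : Fin 1 → E) = ![v] := by
    funext i; fin_cases i; rfl
  have := h.deriv 1 (le_trans (by norm_num) hk) x hx ![v, w]
  rwa [e] at this

theorem hasDirDeriv_three (h : IsDerivFamily k f U d) (hk : 3 ≤ k) {x : E}
    (hx : x ∈ U) (v w u : E) : HasDirDeriv (fun z => d 2 z ![v, w]) (d 3 x ![v, w, u]) x u := by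
  have e : (Fin.init ![v, w, u] : Fin 2 → E) = ![v, w] := by
    funext i; fin_cases i <;> rfl
  have := h.deriv 2 (le_trans (by norm_num) hk) x hx ![v, w, u]
  rwa [e] at this

theorem map_smul_one (h : IsDerivFamily k f U d) (hU : IsOpen U) (hk : 1 ≤ k) {x : E}
    (hx : x ∈ U) (c : ℝ) (v : E) : d 1 x ![c • v] = c • d 1 x ![v] :=
  (h.hasDirDeriv_one hU hk hx (c • v)).unique ((h.hasDirDeriv_one hU hk hx v).smul c)

theorem map_add_one (h : IsDerivFamily k f U d) (hU : IsOpen U) (hk : 1 ≤ k) {x : E}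
    (hx : x ∈ U) (v w : E) : d 1 x ![v + w] = d 1 x ![v] + d 1 x ![w] := by
  refine dirDeriv_add (dg := fun z => d 1 z.1 ![z.2]) hU
    (fun z hz y => h.hasDirDeriv_one hU hk hz y) ?_ hx v w
  exact h.continuousOn_comp (by simpa using hk) continuousOn_fst
    (Continuous.continuousOn (by fun_prop)) fun z hz => hz.1

theorem map_smul_two (h : IsDerivFamily k f U d) (hk : 2 ≤ k) {x : E}
    (hx : x ∈ U) (c : ℝ) (v w : E) : d 2 x ![v, c • w] = c • d 2 x ![v, w] :=
  (h.hasDirDeriv_two hk hx v (c • w)).unique ((h.hasDirDeriv_two hk hx v w).smul c)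

/-- The second order difference quotients converge to the second derivative. -/
theorem tendsto_second_diffQuotient (h : IsDerivFamily k f U d) (hU : IsOpen U) (hk : 2 ≤ k)
    {x : E} (hx : x ∈ U) (v w : E) :
    Tendsto (fun t : ℝ => (t * t)⁻¹ •
      (f (x + t • v + t • w) - f (x + t • v) - (f (x + t • w) - f x)))
      (𝓝[≠] 0) (𝓝 (d 2 x ![v, w])) := by
  refine tendsto_of_forall_seminorm fun q hq ε hε => ?_
  have hk1 : (1 : ℕ∞) ≤ k := le_trans (by norm_num) hk
  have hcont : ContinuousAt (fun r : E => q (d 2 r ![v, w] - d 2 x ![v, w])) x :=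
    hq.continuousAt.comp (((h.continuousOn_comp hk continuousOn_id continuousOn_const
      (fun _ hz => hz)).continuousAt (hU.mem_nhds hx)).sub continuousAt_const)
  have hev : ∀ᶠ r : E in 𝓝 x, r ∈ U ∧ q (d 2 r ![v, w] - d 2 x ![v, w]) < ε := by
    refine (continuousAt_id.eventually (hU.mem_nhds hx)).and (hcont.eventually (gt_mem_nhds ?_))
    simpa using hε
  have hunif : ∀ᶠ t : ℝ in 𝓝 0, ∀ u ∈ Icc (0 : ℝ) 1 ×ˢ Icc (0 : ℝ) 1,
      (x + (u.1 * t) • v + (u.2 * t) • w) ∈ U ∧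
        q (d 2 (x + (u.1 * t) • v + (u.2 * t) • w) ![v, w] - d 2 x ![v, w]) < ε := by
    refine (isCompact_Icc.prod isCompact_Icc).eventually_forall_of_forall_eventually fun u _ => ?_
    have hmap : Continuous fun r : ℝ × ℝ × ℝ =>
      x + (r.2.1 * r.1) • v + (r.2.2 * r.1) • w := by fun_prop
    exact (hmap.tendsto' (0, u) x (by simp)).eventually hev
  filter_upwards [nhdsWithin_le_nhds hunif, self_mem_nhdsWithin] with t ht h0
  have h0 : t ≠ 0 := h0
  have hU' : ∀ u ∈ Icc (0 : ℝ) 1, x + (u * t) • v ∈ U := fun u hu => by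
    simpa using (ht (u, 0) ⟨hu, by simp⟩).1
  have hU'' : ∀ u ∈ Icc (0 : ℝ) 1, x + (u * t) • v + t • w ∈ U := fun u hu => by
    simpa using (ht (u, 1) ⟨hu, by simp⟩).1
  have inner : ∀ u ∈ Icc (0 : ℝ) 1, q (d 1 (x + (u * t) • v + t • w) ![v]
      - d 1 (x + (u * t) • v) ![v] - t • d 2 x ![v, w]) ≤ |t| * ε := by
    intro u hu
    refine seminorm_sub_sub_le_of_hasDirDeriv hq (g := fun z => d 1 z ![v])
      (dg := fun r => t • d 2 (x + (u * t) • v + (r * t) • w) ![v, w]) (fun r hr => ?_)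
      (fun r hr => ?_)
    · have := (h.hasDirDeriv_two hk (ht (u, r) ⟨hu, hr⟩).1 v w).smul t
      rwa [← smul_smul r] at this ⊢
    · rw [← smul_sub, map_smul_eq_mul, Real.norm_eq_abs]
      exact mul_le_mul_of_nonneg_left (ht (u, r) ⟨hu, hr⟩).2.le (abs_nonneg _)
  have key : q ((f (x + t • v + t • w) - f (x + t • v)) - (f (x + t • w) - f x)
      - (t * t) • d 2 x ![v, w]) ≤ (t * t) * ε := by
    refine seminorm_sub_sub_le_of_hasDirDeriv hq (g := fun z => f (z + t • w) - f z)
      (dg := fun u => t • (d 1 (x + (u * t) • v + t • w) ![v] - d 1 (x + (u * t) • v) ![v]))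
      (fun u hu => ?_) (fun u hu => ?_)
    · have h1 := (h.hasDirDeriv_one hU hk1 (hU'' u hu) v).smul t
      have h2 := (h.hasDirDeriv_one hU hk1 (hU' u hu) v).smul t
      rw [smul_sub]
      have h3 := h1.sub h2
      refine (by rwa [← smul_smul u] at h3 ⊢ : Tendsto _ _ _).congr fun r => ?_
      rw [← smul_sub, sub_sub_sub_comm, smul_smul, add_right_comm (x + _) (t • w)]
    · rw [← smul_smul t t, ← smul_sub, map_smul_eq_mul, Real.norm_eq_abs]
      refine (mul_le_mul_of_nonneg_left (inner u hu) (abs_nonneg _)).trans (le_of_eq ?_)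
      rw [← mul_assoc, abs_mul_abs_self]
  have hpos : 0 < t * t := mul_self_pos.2 h0
  have e : ∀ a b : F, (t * t)⁻¹ • a - b = (t * t)⁻¹ • (a - (t * t) • b) := fun a b => by
    rw [smul_sub, inv_smul_smul₀ hpos.ne']
  rw [e, map_smul_eq_mul, norm_inv, Real.norm_eq_abs, abs_of_pos hpos, inv_mul_le_iff₀ hpos]
  exact key

/-- Schwarz's theorem. -/
theorem symm_two (h : IsDerivFamily k f U d) (hU : IsOpen U) (hk : 2 ≤ k) {x : E}
    (hx : x ∈ U) (v w : E) : d 2 x ![v, w] = d 2 x ![w, v] := by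
  refine tendsto_nhds_unique (h.tendsto_second_diffQuotient hU hk hx v w) ?_
  refine (h.tendsto_second_diffQuotient hU hk hx w v).congr fun t => ?_
  congr 1
  rw [add_right_comm]
  abel

end IsDerivFamily

variable [LocallyConvexSpace ℝ E]

theorem exists_seminorm_ball_subset {V : Set E} {x₀ : E} (hV : V ∈ 𝓝 x₀) :
    ∃ P : Seminorm ℝ E, Continuous P ∧ ∀ x, P (x - x₀) < 1 → x ∈ V := by
  have h0 : (fun y => x₀ + y) ⁻¹' V ∈ 𝓝 (0 : E) :=
    (continuous_const.add continuous_id).continuousAt.preimage_mem_nhds (by simpa using hV)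
  obtain ⟨s, ⟨hs0, hso, hs⟩, hsV⟩ := (nhds_hasBasis_absConvex_open ℝ E).mem_iff.1 h0
  let S : AbsConvexOpenSets ℝ E := ⟨s, hs0, hso, hs⟩
  refine ⟨gaugeSeminormFamily ℝ E S,
    (with_gaugeSeminormFamily (𝕜 := ℝ) (E := E)).continuous_seminorm S, fun x hx => ?_⟩
  have : x - x₀ ∈ (gaugeSeminormFamily ℝ E S).ball 0 1 := by simpa [Seminorm.mem_ball] using hx
  rw [gaugeSeminormFamily_ball] at this
  simpa using hsV this

/-- A map that is multilinear in the directions and continuous is bounded, near a compact set, by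
the product of the values of one continuous seminorm. -/
theorem exists_seminorm_prod_bound {m : ℕ} (hm : 0 < m) {U : Set E} (hU : IsOpen U)
    {D : E → (Fin m → E) → F} (hc : ContinuousOn (fun z : E × (Fin m → E) => D z.1 z.2) (U ×ˢ univ))
    (hD : ∀ x ∈ U, ∃ M : MultilinearMap ℝ (fun _ : Fin m => E) F, ∀ y, M y = D x y)
    {K : Set E} (hK : IsCompact K) (hKU : K ⊆ U) {q : Seminorm ℝ F} (hq : Continuous q) :
    ∃ P : Seminorm ℝ E, Continuous P ∧ ∀ x₀ ∈ K, ∀ x, P (x - x₀) < 1 →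
      x ∈ U ∧ ∀ v, q (D x v) ≤ ∏ i, P (v i) := by
  refine hK.induction_on ⟨0, continuous_const, by simp⟩ ?_ ?_ ?_
  · rintro s t hst ⟨P, hP, h⟩
    exact ⟨P, hP, fun x₀ hx₀ => h x₀ (hst hx₀)⟩
  · rintro s t ⟨P, hP, h⟩ ⟨Q, hQ, h'⟩
    refine ⟨P + Q, hP.add hQ, fun x₀ hx₀ x hx => ?_⟩
    rw [add_apply] at hx
    rcases hx₀ with hx₀ | hx₀
    · obtain ⟨h1, h2⟩ := h x₀ hx₀ x (by linarith [apply_nonneg Q (x - x₀)])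
      exact ⟨h1, fun v => (h2 v).trans (Finset.prod_le_prod (fun i _ => apply_nonneg P _)
        fun i _ => le_add_of_nonneg_right (apply_nonneg Q _))⟩
    · obtain ⟨h1, h2⟩ := h' x₀ hx₀ x (by linarith [apply_nonneg P (x - x₀)])
      exact ⟨h1, fun v => (h2 v).trans (Finset.prod_le_prod (fun i _ => apply_nonneg Q _)
        fun i _ => le_add_of_nonneg_left (apply_nonneg P _))⟩
  · intro x₀ hx₀
    have hx₀U := hKU hx₀
    have hone : ∃ P : Seminorm ℝ E, Continuous P ∧ ∀ x, P (x - x₀) < 1 → x ∈ U ∧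
        ∀ v : Fin m → E, (∀ i, P (v i) < 1) → q (D x v) ≤ 1 := by
      have hz : D x₀ 0 = 0 := by
        obtain ⟨M, hM⟩ := hD x₀ hx₀U
        rw [← hM]
        exact M.map_coord_zero ⟨0, hm⟩ rfl
      have h1 : ∀ᶠ z : E × (Fin m → E) in 𝓝 (x₀, 0), z.1 ∈ U ∧ q (D z.1 z.2) < 1 := by
        refine (continuousAt_fst.eventually (hU.mem_nhds hx₀U)).and ?_
        exact (hq.continuousAt.comp (hc.continuousAt ((hU.prod isOpen_univ).mem_nhds
          ⟨hx₀U, trivial⟩))).eventually (gt_mem_nhds (by simp [hz]))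
      rw [nhds_prod_eq, nhds_pi] at h1
      obtain ⟨A, hA, B, hB, hAB⟩ := Filter.mem_prod_iff.1 h1
      obtain ⟨I, hI, t, ht, htB⟩ := Filter.mem_pi.1 hB
      have ht' : (⋂ i, t i) ∈ 𝓝 (0 : E) := Filter.iInter_mem.2 ht
      obtain ⟨P, hP, hPA⟩ := exists_seminorm_ball_subset hA
      obtain ⟨Q, hQ, hQt⟩ := exists_seminorm_ball_subset ht'
      refine ⟨P + Q, hP.add hQ, fun x hx => ?_⟩
      rw [add_apply] at hx
      have hxA : x ∈ A := hPA x (by linarith [apply_nonneg Q (x - x₀)])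
      refine ⟨(hAB (mk_mem_prod hxA (mem_of_mem_nhds (by rwa [nhds_pi])) :
        (x, (0 : Fin m → E)) ∈ A ×ˢ B)).1, fun v hv => ?_⟩
      refine (hAB (mk_mem_prod hxA (htB fun i _ => ?_) : (x, v) ∈ A ×ˢ B)).2.le
      refine mem_iInter.1 (hQt (v i) ?_) i
      have := hv i
      rw [add_apply] at this
      rw [sub_zero]
      linarith [apply_nonneg P (v i)]
    -- homogeneity turns the bound by `1` into a bound by the product, for each base point; `P` is
    -- doubled so that balls of radius `1` around points close to `x₀` are covered
    obtain ⟨P, hP, h⟩ := hone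
    have h2 : ∀ x, (P + P) (x - x₀) < 2 → x ∈ U ∧ ∀ v, q (D x v) ≤ ∏ i, (P + P) (v i) := by
      intro x hx
      rw [add_apply] at hx
      obtain ⟨hxU, hxv⟩ := h x (by linarith)
      refine ⟨hxU, fun v => ?_⟩
      obtain ⟨M, hM⟩ := hD x hxU
      -- some `P (v i)` may be `0`, so the vectors are scaled by `P (v i) + ε`, and `ε → 0`
      have hlim : Tendsto (fun ε : ℝ => ∏ i, ((P + P) (v i) + ε)) (𝓝[>] 0)
          (𝓝 (∏ i, (P + P) (v i))) :=
        (Continuous.tendsto' (by fun_prop) 0 _ (by simp)).mono_left nhdsWithin_le_nhds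
      refine ge_of_tendsto hlim ?_
      filter_upwards [self_mem_nhdsWithin] with ε hε
      have hε : 0 < ε := hε
      have hpos : ∀ i, 0 < (P + P) (v i) + ε := fun i =>
        add_pos_of_nonneg_of_pos (apply_nonneg _ _) hε
      have hv : v = fun i => ((P + P) (v i) + ε) • (((P + P) (v i) + ε)⁻¹ • v i) := by
        funext i
        rw [smul_inv_smul₀ (hpos i).ne']
      have hw := hxv (fun i => ((P + P) (v i) + ε)⁻¹ • v i) fun i => by
        rw [map_smul_eq_mul, norm_inv, Real.norm_eq_abs, abs_of_pos (hpos i),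
          inv_mul_lt_iff₀ (hpos i), mul_one, add_apply]
        linarith [apply_nonneg P (v i)]
      have hpr : 0 ≤ ∏ i, ((P + P) (v i) + ε) := Finset.prod_nonneg fun i _ => (hpos i).le
      calc q (D x v) = q (M fun i => ((P + P) (v i) + ε) • (((P + P) (v i) + ε)⁻¹ • v i)) := by
            rw [← hv, hM]
        _ = (∏ i, ((P + P) (v i) + ε)) * q (D x fun i => ((P + P) (v i) + ε)⁻¹ • v i) := by
            rw [M.map_smul_univ (fun i => (P + P) (v i) + ε), map_smul_eq_mul, hM,
              Real.norm_eq_abs, abs_of_nonneg hpr]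
        _ ≤ ∏ i, ((P + P) (v i) + ε) := mul_le_of_le_one_right hpr hw
    have hcPP : Continuous (P + P : Seminorm ℝ E) := hP.add hP
    refine ⟨{x₁ | (P + P) (x₁ - x₀) < 1}, mem_nhdsWithin_of_mem_nhds ?_, P + P, hcPP,
      fun x₁ hx₁ x hx => h2 x ?_⟩
    · exact (hcPP.comp (continuous_id.sub continuous_const)).continuousAt.preimage_mem_nhds
        (Iio_mem_nhds (by simp))
    · have h3 := map_add_le_add (P + P) (x - x₁) (x₁ - x₀)
      rw [sub_add_sub_cancel] at h3
      have h4 : (P + P) (x₁ - x₀) < 1 := hx₁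
      linarith

namespace IsDerivFamily

variable {k : ℕ∞} {f : E → F} {U : Set E} {d : (j : ℕ) → E → (Fin j → E) → F}

theorem exists_seminorm_bound (h : IsDerivFamily k f U d) (hU : IsOpen U) {m : ℕ} (hm : 0 < m)
    (hk : (m : ℕ∞) ≤ k) {K : Set E} (hK : IsCompact K) (hKU : K ⊆ U) {q : Seminorm ℝ F}
    (hq : Continuous q) : ∃ P : Seminorm ℝ E, Continuous P ∧ ∀ x₀ ∈ K, ∀ x, P (x - x₀) < 1 →
      x ∈ U ∧ ∀ v, q (d m x v) ≤ ∏ i, P (v i) :=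
  exists_seminorm_prod_bound hm hU (h.cont m hk) (h.exists_multilinearMap hU m hk) hK hKU hq

/-- Near a compact set, a `C^2`-map and its first derivative are Lipschitz with respect to
a single continuous seminorm. -/
theorem exists_lipschitz_bound (h : IsDerivFamily k f U d) (hU : IsOpen U) (hk : 2 ≤ k)
    {K : Set E} (hK : IsCompact K) (hKU : K ⊆ U) {q : Seminorm ℝ F} (hq : Continuous q) :
    ∃ P : Seminorm ℝ E, Continuous P ∧ ∀ x₀ ∈ K, ∀ x, P (x - x₀) < 1 →
      x ∈ U ∧ q (f x - f x₀) ≤ P (x - x₀) ∧ ∀ v, q (d 1 x ![v]) ≤ P v ∧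
        q (d 1 x ![v] - d 1 x₀ ![v]) ≤ P v * P (x - x₀) := by
  have hk1 : (1 : ℕ∞) ≤ k := le_trans (by norm_num) hk
  obtain ⟨P, hP, h1⟩ := h.exists_seminorm_bound hU one_pos (by exact_mod_cast hk1) hK hKU hq
  obtain ⟨Q, hQ, h2⟩ := h.exists_seminorm_bound hU two_pos (by exact_mod_cast hk) hK hKU hq
  have hPle : ∀ v, P v ≤ (P + Q) v := fun v => le_add_of_nonneg_right (apply_nonneg Q v)
  have hQle : ∀ v, Q v ≤ (P + Q) v := fun v => le_add_of_nonneg_left (apply_nonneg P v)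
  refine ⟨P + Q, hP.add hQ, fun x₀ hx₀ x hx => ?_⟩
  have seg : ∀ R : Seminorm ℝ E, R (x - x₀) < 1 → ∀ u ∈ Icc (0 : ℝ) 1,
      R (x₀ + u • (x - x₀) - x₀) < 1 := by
    intro R hR u hu
    rw [add_sub_cancel_left, map_smul_eq_mul, Real.norm_eq_abs, abs_of_nonneg hu.1]
    exact (mul_le_of_le_one_left (apply_nonneg _ _) hu.2).trans_lt hR
  have hxP := (hPle _).trans_lt hx
  have hxQ := (hQle _).trans_lt hx
  refine ⟨(h1 x₀ hx₀ x hxP).1, ?_, fun v => ⟨?_, ?_⟩⟩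
  · have := seminorm_sub_sub_le_of_hasDirDeriv hq (g := f) (z := x₀) (w := x - x₀) (v := 0)
      (C := (P + Q) (x - x₀)) (fun u hu =>
        h.hasDirDeriv_one hU hk1 (h1 x₀ hx₀ _ (seg P hxP u hu)).1 (x - x₀)) (fun u hu => by
        rw [sub_zero]
        refine ((h1 x₀ hx₀ _ (seg P hxP u hu)).2 _).trans ?_
        simp)
    simpa using this
  · refine ((h1 x₀ hx₀ x hxP).2 _).trans ?_
    simp
  · have := seminorm_sub_sub_le_of_hasDirDeriv hq (g := fun z => d 1 z ![v]) (z := x₀)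
      (w := x - x₀) (v := 0) (C := (P + Q) v * (P + Q) (x - x₀)) (fun u hu =>
        h.hasDirDeriv_two hk (h2 x₀ hx₀ _ (seg Q hxQ u hu)).1 v (x - x₀)) (fun u hu => by
        rw [sub_zero]
        refine ((h2 x₀ hx₀ _ (seg Q hxQ u hu)).2 _).trans ?_
        rw [Fin.prod_univ_two]
        exact mul_le_mul (hQle v) (hQle (x - x₀)) (apply_nonneg _ _) (apply_nonneg _ _))
    simpa using this

/-- The second order Taylor estimate for the first derivative of a `C^3`-map near a compact set. -/
theorem exists_taylor_bound (h : IsDerivFamily k f U d) (hU : IsOpen U) (hk : 3 ≤ k)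
    {K : Set E} (hK : IsCompact K) (hKU : K ⊆ U) {q : Seminorm ℝ F} (hq : Continuous q) :
    ∃ P : Seminorm ℝ E, Continuous P ∧ ∀ x ∈ K, ∀ y, P y < 1 → x + y ∈ U ∧ ∀ v,
      q (d 1 (x + y) ![v] - d 1 x ![v] - d 2 x ![v, y]) ≤ P v * P y ^ 2 := by
  have hk2 : (2 : ℕ∞) ≤ k := le_trans (by norm_num) hk
  obtain ⟨P, hP, h3⟩ := h.exists_seminorm_bound hU three_pos (by exact_mod_cast hk) hK hKU hq
  refine ⟨P, hP, fun x hx y hy => ?_⟩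
  have seg : ∀ u ∈ Icc (0 : ℝ) 1, P (u • y) ≤ P y := by
    intro u hu
    rw [map_smul_eq_mul, Real.norm_eq_abs, abs_of_nonneg hu.1]
    exact mul_le_of_le_one_left (apply_nonneg _ _) hu.2
  have hmem : ∀ u ∈ Icc (0 : ℝ) 1, x + u • y ∈ U := fun u hu =>
    (h3 x hx _ (by rw [add_sub_cancel_left]; exact (seg u hu).trans_lt hy)).1
  refine ⟨by simpa using hmem 1 (by simp), fun v => ?_⟩
  -- the mean value inequality is used twice, for `d 1` and for `d 2`
  refine seminorm_sub_sub_le_of_hasDirDeriv hq (g := fun z => d 1 z ![v])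
    (fun u hu => h.hasDirDeriv_two hk2 (hmem u hu) v y) (fun u hu => ?_)
  have := seminorm_sub_sub_le_of_hasDirDeriv hq (g := fun z => d 2 z ![v, y]) (z := x)
      (w := u • y) (v := 0) (C := P v * P y ^ 2)
      (dg := fun r => u • d 3 (x + (r * u) • y) ![v, y, y])
      (fun r hr => ?_) (fun r hr => ?_)
  · simpa using this
  · have hru : r * u ∈ Icc (0 : ℝ) 1 := ⟨mul_nonneg hr.1 hu.1, mul_le_one₀ hr.2 hu.1 hu.2⟩
    have := (h.hasDirDeriv_three hk (hmem _ hru) v y y).smul u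
    rwa [← smul_smul r] at this ⊢
  · have hru : r * u ∈ Icc (0 : ℝ) 1 := ⟨mul_nonneg hr.1 hu.1, mul_le_one₀ hr.2 hu.1 hu.2⟩
    rw [sub_zero, map_smul_eq_mul, Real.norm_eq_abs, abs_of_nonneg hu.1]
    refine (mul_le_of_le_one_left (apply_nonneg _ _) hu.2).trans ?_
    refine ((h3 x hx _ (by rw [add_sub_cancel_left]; exact (seg _ hru).trans_lt hy)).2 _).trans ?_
    simp [Fin.prod_univ_three, pow_two, mul_assoc]

end IsDerivFamily

end Estimates

/-! ### Absolutely continuous functions -/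

section AbsolutelyContinuous

/-- If the increments of `R` over short intervals are small relative to those of `A`, then `R` is
constant. -/
theorem eq_of_increments_small {R A : ℝ → ℝ} {t : ℝ} (ht : 0 ≤ t)
    (h : ∀ ε > 0, ∃ δ > 0, ∀ s s', 0 ≤ s → s ≤ s' → s' ≤ t → s' - s < δ →
      |R s' - R s| ≤ ε * (A s' - A s)) : R t = R 0 := by
  have key : ∀ ε > 0, |R t - R 0| ≤ ε * (A t - A 0) := by
    intro ε hε
    obtain ⟨δ, hδ, H⟩ := h ε hε
    obtain ⟨n, hn⟩ := exists_nat_gt (t / δ)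
    have hn0 : 0 < (n : ℝ) := (div_nonneg ht hδ.le).trans_lt hn
    let s : ℕ → ℝ := fun i => i * (t / n)
    have hsn : s n = t := by simp only [s]; field_simp
    have hs0 : s 0 = 0 := by simp [s]
    have hstep : ∀ i, s (i + 1) - s i = t / n := fun i => by simp only [s]; push_cast; ring
    have hmono : Monotone s := fun i j hij => by
      simp only [s]
      gcongr
    have hlt : t / n < δ := by
      rw [div_lt_iff₀ hn0, mul_comm]
      exact (div_lt_iff₀ hδ).1 hn
    rw [← hsn, ← hs0, ← Finset.sum_range_sub (fun i => R (s i)) n,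
      ← Finset.sum_range_sub (fun i => A (s i)) n, Finset.mul_sum]
    refine (Finset.abs_sum_le_sum_abs _ _).trans (Finset.sum_le_sum fun i hi => ?_)
    refine H _ _ ?_ (hmono i.le_succ) ?_ ((hstep i).trans_lt hlt)
    · rw [← hs0]; exact hmono i.zero_le
    · rw [← hsn]; exact hmono (Finset.mem_range.1 hi)
  by_contra hne
  have hpos : 0 < |R t - R 0| := abs_pos.2 (sub_ne_zero.2 hne)
  have h1 := key 1 one_pos
  rw [one_mul] at h1
  have hA : 0 < A t - A 0 := hpos.trans_le h1
  have h2 := key (|R t - R 0| / (2 * (A t - A 0))) (by positivity)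
  have h3 : |R t - R 0| / (2 * (A t - A 0)) * (A t - A 0) = |R t - R 0| / 2 := by
    field_simp
  linarith

variable {E : Type*} [AddCommGroup E] [Module ℝ E] [TopologicalSpace E]
  {p : ℝ≥0∞}

theorem MemLpLC.integrableOn [hp : Fact (1 ≤ p)] {γ : ℝ → E} {a b : ℝ}
    (h : MemLpLC p γ (Icc a b)) {q : Seminorm ℝ E} (hq : Continuous q) :
    IntegrableOn (fun s => q (γ s)) (Icc a b) :=
  (h.memLp hq).integrable hp.out

theorem intervalIntegrable_of_integrableOn_unit {φ : ℝ → ℝ} (h : IntegrableOn φ (Icc 0 1))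
    {s t : ℝ} (hs : s ∈ Icc (0 : ℝ) 1) (ht : t ∈ Icc (0 : ℝ) 1) :
    IntervalIntegrable φ volume s t := by
  rw [intervalIntegrable_iff]
  exact h.mono_set (uIoc_subset_uIcc.trans (uIcc_subset_Icc hs ht))

theorem IsWeakPrimitiveOn.apply_sub {γ η : ℝ → E} {a b : ℝ} (h : IsWeakPrimitiveOn γ η a b)
    {s t : ℝ} (hs : s ∈ Icc a b) (ht : t ∈ Icc a b) (l : E →L[ℝ] ℝ) :
    IntervalIntegrable (fun r => l (γ r)) volume s t ∧
      l (η t - η s) = ∫ r in s..t, l (γ r) := by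
  obtain ⟨i1, e1⟩ := h s hs l
  obtain ⟨i2, e2⟩ := h t ht l
  refine ⟨i1.symm.trans i2, ?_⟩
  rw [← intervalIntegral.integral_interval_sub_left i2 i1, ← e1, ← e2, ← map_sub]
  congr 1
  abel

variable [IsTopologicalAddGroup E] [ContinuousSMul ℝ E] [LocallyConvexSpace ℝ E]

theorem IsWeakPrimitiveOn.seminorm_sub_le [Fact (1 ≤ p)] {γ η : ℝ → E}
    (hγ : MemLpLC p γ (Icc 0 1)) (h : IsWeakPrimitiveOn γ η 0 1) {q : Seminorm ℝ E}
    (hq : Continuous q) {s t : ℝ} (hs : 0 ≤ s) (hst : s ≤ t) (ht : t ≤ 1) :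
    q (η t - η s) ≤ ∫ r in s..t, q (γ r) := by
  obtain ⟨l, hl, hle⟩ := exists_functional_eq_seminorm hq (η t - η s)
  have hs' : s ∈ Icc (0 : ℝ) 1 := ⟨hs, hst.trans ht⟩
  have ht' : t ∈ Icc (0 : ℝ) 1 := ⟨hs.trans hst, ht⟩
  obtain ⟨i, e⟩ := h.apply_sub hs' ht' l
  rw [← hl, e]
  exact intervalIntegral.integral_mono_on hst i
    (intervalIntegrable_of_integrableOn_unit (hγ.integrableOn hq) hs' ht')
    fun r _ => (le_abs_self _).trans (hle _)

theorem IsWeakPrimitiveOn.continuousOn [Fact (1 ≤ p)] {γ η : ℝ → E}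
    (hγ : MemLpLC p γ (Icc 0 1)) (h : IsWeakPrimitiveOn γ η 0 1) : ContinuousOn η (Icc 0 1) := by
  intro s hs
  refine tendsto_of_forall_seminorm fun q hq ε hε => ?_
  have hi := hγ.integrableOn hq
  have hc : ContinuousOn (fun t => ∫ r in (0 : ℝ)..t, q (γ r)) (Icc 0 1) := by
    have := intervalIntegral.continuousOn_primitive_interval
      (μ := volume) (f := fun r => q (γ r)) (a := 0) (b := 1) (by rwa [uIcc_of_le zero_le_one])
    rwa [uIcc_of_le zero_le_one] at this
  have hd := Metric.tendsto_nhds.1 (hc s hs) ε hε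
  filter_upwards [hd, self_mem_nhdsWithin] with t ht htI
  have hsub : ∀ {a b : ℝ}, a ∈ Icc (0 : ℝ) 1 → b ∈ Icc (0 : ℝ) 1 →
      (∫ r in (0 : ℝ)..b, q (γ r)) - ∫ r in (0 : ℝ)..a, q (γ r) = ∫ r in a..b, q (γ r) :=
    fun ha hb => intervalIntegral.integral_interval_sub_left
      (intervalIntegrable_of_integrableOn_unit hi (by simp) hb)
      (intervalIntegrable_of_integrableOn_unit hi (by simp) ha)
  rw [Real.dist_eq] at ht
  rcases le_total s t with hst | hst
  · rw [hsub hs htI] at ht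
    exact (h.seminorm_sub_le hγ hq hs.1 hst htI.2).trans ((le_abs_self _).trans ht.le)
  · rw [abs_sub_comm, hsub htI hs] at ht
    rw [map_sub_rev]
    exact (h.seminorm_sub_le hγ hq htI.1 hst hs.2).trans ((le_abs_self _).trans ht.le)

instance isProbabilityMeasure_restrict_unit :
    IsProbabilityMeasure (volume.restrict (Icc (0 : ℝ) 1)) :=
  ⟨by simp⟩

theorem IsWeakPrimitiveOn.seminorm_le [hp : Fact (1 ≤ p)] {γ η : ℝ → E}
    (hγ : MemLpLC p γ (Icc 0 1)) (h : IsWeakPrimitiveOn γ η 0 1) {q : Seminorm ℝ E}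
    (hq : Continuous q) {t : ℝ} (ht : t ∈ Icc (0 : ℝ) 1) :
    q (η t) ≤ q (η 0) + (eLpNorm (fun s => q (γ s)) p (volume.restrict (Icc 0 1))).toReal := by
  have h1 := h.seminorm_sub_le hγ hq le_rfl ht.1 ht.2
  have h2 : q (η t) ≤ q (η 0) + q (η t - η 0) := by
    simpa using map_add_le_add q (η 0) (η t - η 0)
  have hi := hγ.integrableOn hq
  have h3 : ∫ r in (0 : ℝ)..t, q (γ r) ≤ ∫ r in Icc (0 : ℝ) 1, q (γ r) := by
    rw [intervalIntegral.integral_of_le ht.1]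
    exact setIntegral_mono_set hi (Eventually.of_forall fun r => apply_nonneg q _)
      (LE.le.eventuallyLE (Ioc_subset_Icc_self.trans (Icc_subset_Icc_right ht.2)))
  have h4 : ∫ r in Icc (0 : ℝ) 1, q (γ r)
      = (eLpNorm (fun s => q (γ s)) 1 (volume.restrict (Icc 0 1))).toReal := by
    rw [eLpNorm_one_eq_lintegral_enorm, ← integral_norm_eq_lintegral_enorm hi.1]
    simp [abs_of_nonneg (apply_nonneg q _)]
  have h5 : eLpNorm (fun s => q (γ s)) 1 (volume.restrict (Icc 0 1))
      ≤ eLpNorm (fun s => q (γ s)) p (volume.restrict (Icc 0 1)) :=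
    eLpNorm_le_eLpNorm_of_exponent_le hp.out hi.1
  have h6 := ENNReal.toReal_mono (hγ.2 q hq).ne h5
  linarith

theorem LusinMeasurableOn.comp_continuousOn {X Y Z : Type*} [TopologicalSpace X]
    [TopologicalSpace Y] [TopologicalSpace Z] {η : ℝ → X} {γ : ℝ → Y} {I : Set ℝ} {O : Set X}
    (hη : ContinuousOn η I) (hηO : MapsTo η I O) (hγ : LusinMeasurableOn γ I) {D : X × Y → Z}
    (hD : ContinuousOn D (O ×ˢ univ)) : LusinMeasurableOn (fun s => D (η s, γ s)) I := by
  obtain ⟨K, hK, hK0⟩ := hγ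
  exact ⟨K, fun j => ⟨(hK j).1, (hK j).2.1, hD.comp (((hη.mono (hK j).2.1)).prodMk (hK j).2.2)
    fun s hs => ⟨hηO ((hK j).2.1 hs), trivial⟩⟩, hK0⟩

variable {F : Type*} [AddCommGroup F] [Module ℝ F] [TopologicalSpace F]
  [IsTopologicalAddGroup F] [ContinuousSMul ℝ F] [LocallyConvexSpace ℝ F] [T2Space F]

namespace IsDerivFamily

variable {k : ℕ∞} {g : E → F} {O : Set E} {d : (j : ℕ) → E → (Fin j → E) → F}

/-- The derivative `v ↦ d 1 x v` at a point, followed by a functional. -/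
theorem exists_clm (h : IsDerivFamily k g O d) (hO : IsOpen O) (hk : 1 ≤ k) {x : E} (hx : x ∈ O)
    (l : F →L[ℝ] ℝ) : ∃ L : E →L[ℝ] ℝ, ∀ v, L v = l (d 1 x ![v]) := by
  refine ⟨{ toFun := fun v => l (d 1 x ![v])
            map_add' := fun v w => by rw [h.map_add_one hO hk hx, map_add]
            map_smul' := fun c v => by rw [h.map_smul_one hO hk hx, map_smul]; rfl
            cont := ?_ }, fun v => rfl⟩
  refine l.continuous.comp ?_
  rw [← continuousOn_univ]
  exact h.continuousOn_comp (by simpa using hk) continuousOn_const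
    (Continuous.continuousOn (by fun_prop)) fun _ _ => hx

theorem memLpLC_comp [Fact (1 ≤ p)] (h : IsDerivFamily k g O d) (hO : IsOpen O) (hk : 1 ≤ k)
    {γ η : ℝ → E} (hγ : MemLpLC p γ (Icc 0 1)) (hη : ContinuousOn η (Icc 0 1))
    (hηO : MapsTo η (Icc 0 1) O) : MemLpLC p (fun s => d 1 (η s) ![γ s]) (Icc 0 1) := by
  have hL : LusinMeasurableOn (fun s => d 1 (η s) ![γ s]) (Icc 0 1) :=
    LusinMeasurableOn.comp_continuousOn (D := fun z => d 1 z.1 ![z.2]) hη hηO hγ.1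
      (h.continuousOn_comp (by simpa using hk) continuousOn_fst
        (Continuous.continuousOn (by fun_prop)) fun z hz => hz.1)
  refine ⟨hL, fun q hq => ?_⟩
  obtain ⟨P, hP, hb⟩ := h.exists_seminorm_bound hO one_pos (by simpa using hk)
    (isCompact_Icc.image_of_continuousOn hη) hηO.image_subset hq
  refine lt_of_le_of_lt (eLpNorm_mono_ae ?_) (hγ.2 P hP)
  rw [ae_restrict_iff' measurableSet_Icc]
  refine Eventually.of_forall fun s hs => ?_
  have := (hb (η s) (mem_image_of_mem _ hs) (η s) (by simp)).2 ![γ s]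
  simpa [abs_of_nonneg (apply_nonneg q _), abs_of_nonneg (apply_nonneg P _)] using this

/-- The chain rule for absolutely continuous functions: `g ∘ η` is a weak primitive of
`s ↦ dg (η s, γ s)` if `η` is one of `γ`. -/
theorem isWeakPrimitiveOn_comp [Fact (1 ≤ p)] (h : IsDerivFamily k g O d) (hO : IsOpen O)
    (hk : 2 ≤ k) {γ η : ℝ → E} (hγ : MemLpLC p γ (Icc 0 1)) (hη : IsWeakPrimitiveOn γ η 0 1)
    (hηO : MapsTo η (Icc 0 1) O) :
    IsWeakPrimitiveOn (fun s => d 1 (η s) ![γ s]) (fun s => g (η s)) 0 1 := by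
  have hk1 : (1 : ℕ∞) ≤ k := le_trans (by norm_num) hk
  have hc := hη.continuousOn hγ
  intro t ht l
  let q : Seminorm ℝ F := (normSeminorm ℝ ℝ).comp l.toLinearMap
  have hqa : ∀ v, q v = |l v| := fun v => rfl
  have hq : Continuous q := by
    change Continuous fun v => |l v|
    fun_prop
  have hω := h.memLpLC_comp hO hk1 hγ hc hηO
  set ω : ℝ → ℝ := fun s => l (d 1 (η s) ![γ s]) with hω_def
  have hωi : IntegrableOn ω (Icc 0 1) := by
    have := hω.integrableOn hq
    exact (integrable_norm_iff (hω.1.comp l.continuous).aestronglyMeasurable).1 this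
  have iω : ∀ {a b : ℝ}, a ∈ Icc (0 : ℝ) 1 → b ∈ Icc (0 : ℝ) 1 → IntervalIntegrable ω volume a b :=
    fun ha hb => intervalIntegrable_of_integrableOn_unit hωi ha hb
  refine ⟨iω (by simp) ht, ?_⟩
  obtain ⟨P, hP, hb⟩ := h.exists_lipschitz_bound hO hk
    (isCompact_Icc.image_of_continuousOn hc) hηO.image_subset hq
  have hPi := hγ.integrableOn hP
  have iP : ∀ {a b : ℝ}, a ∈ Icc (0 : ℝ) 1 → b ∈ Icc (0 : ℝ) 1 →
      IntervalIntegrable (fun r => P (γ r)) volume a b :=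
    fun ha hb => intervalIntegrable_of_integrableOn_unit hPi ha hb
  -- the error on an interval on which `η` varies by at most `ε`
  have loc : ∀ ε < 1, ∀ s s', 0 ≤ s → s ≤ s' → s' ≤ 1 → (∀ r ∈ Icc s s', P (η r - η s) ≤ ε) →
      |l (g (η s')) - l (g (η s)) - ∫ r in s..s', ω r| ≤ 2 * ε * ∫ r in s..s', P (γ r) := by
    intro ε hε s s' hs hss hs' hvar
    have hsI : s ∈ Icc (0 : ℝ) 1 := ⟨hs, hss.trans hs'⟩
    have hsI' : s' ∈ Icc (0 : ℝ) 1 := ⟨hs.trans hss, hs'⟩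
    have hsub : Icc s s' ⊆ Icc 0 1 := Icc_subset_Icc hs hs'
    set w := η s' - η s with hw
    have hwε : P w ≤ ε := hvar s' (right_mem_Icc.2 hss)
    have hwi : P w ≤ ∫ r in s..s', P (γ r) := hη.seminorm_sub_le hγ hP hs hss hs'
    have hε0 : 0 ≤ ε := (apply_nonneg P w).trans hwε
    have seg : ∀ u ∈ Icc (0 : ℝ) 1, P (η s + u • w - η s) ≤ P w := by
      intro u hu
      rw [add_sub_cancel_left, map_smul_eq_mul, Real.norm_eq_abs, abs_of_nonneg hu.1]
      exact mul_le_of_le_one_left (apply_nonneg _ _) hu.2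
    have bnd := fun u (hu : u ∈ Icc (0 : ℝ) 1) => hb (η s) (mem_image_of_mem _ hsI)
      (η s + u • w) ((seg u hu).trans_lt (hwε.trans_lt hε))
    -- both terms are compared with the linear approximation of `g` at `η s`
    have e1 : |l (g (η s')) - l (g (η s)) - l (d 1 (η s) ![w])| ≤ ε * ∫ r in s..s', P (γ r) := by
      have := seminorm_sub_sub_le_of_hasDirDeriv hq (g := g) (z := η s) (w := w)
        (v := d 1 (η s) ![w]) (C := P w * P w)
        (fun u hu => h.hasDirDeriv_one hO hk1 (bnd u hu).1 w)
        (fun u hu => ((bnd u hu).2.2 w).2.trans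
          (mul_le_mul_of_nonneg_left (seg u hu) (apply_nonneg _ _)))
      rw [hqa, map_sub, map_sub, hw, add_sub_cancel] at this
      exact this.trans (mul_le_mul hwε hwi (apply_nonneg _ _) hε0)
    obtain ⟨L, hL⟩ := h.exists_clm hO hk1 (hηO hsI) l
    obtain ⟨iL, eL⟩ := hη.apply_sub hsI hsI' L
    have e2 : |l (d 1 (η s) ![w]) - ∫ r in s..s', ω r| ≤ ε * ∫ r in s..s', P (γ r) := by
      rw [← hL, eL, ← intervalIntegral.integral_sub iL (iω hsI hsI'),
        ← intervalIntegral.integral_const_mul, ← Real.norm_eq_abs]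
      refine intervalIntegral.norm_integral_le_of_norm_le hss (Eventually.of_forall fun r hr => ?_)
        ((iP hsI hsI').const_mul ε)
      have hr' : r ∈ Icc s s' := Ioc_subset_Icc_self hr
      have hPr : P (η s - η r) ≤ ε := by rw [map_sub_rev]; exact hvar r hr'
      have := ((hb (η r) (mem_image_of_mem _ (hsub hr')) (η s) (hPr.trans_lt hε)).2.2 (γ r)).2
      rw [hqa, map_sub] at this
      rw [hL, Real.norm_eq_abs]
      refine this.trans ?_
      rw [mul_comm]
      exact mul_le_mul_of_nonneg_right hPr (apply_nonneg _ _)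
    have := abs_sub_le (l (g (η s')) - l (g (η s))) (l (d 1 (η s) ![w])) (∫ r in s..s', ω r)
    linarith
  have hcA : ContinuousOn (fun t => ∫ r in (0 : ℝ)..t, P (γ r)) (Icc 0 1) := by
    have := intervalIntegral.continuousOn_primitive_interval
      (μ := volume) (f := fun r => P (γ r)) (a := 0) (b := 1) (by rwa [uIcc_of_le zero_le_one])
    rwa [uIcc_of_le zero_le_one] at this
  -- `∫ P (γ)` is uniformly continuous and bounds the variation of `η`
  have huc := Metric.uniformContinuousOn_iff.1 (isCompact_Icc.uniformContinuousOn_of_continuous hcA)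
  have hsubA : ∀ {a b : ℝ}, a ∈ Icc (0 : ℝ) 1 → b ∈ Icc (0 : ℝ) 1 →
      (∫ r in (0 : ℝ)..b, P (γ r)) - ∫ r in (0 : ℝ)..a, P (γ r) = ∫ r in a..b, P (γ r) :=
    fun ha hb => intervalIntegral.integral_interval_sub_left (iP (by simp) hb) (iP (by simp) ha)
  have hR := eq_of_increments_small (R := fun s => l (g (η s)) - ∫ r in (0 : ℝ)..s, ω r)
    (A := fun t => ∫ r in (0 : ℝ)..t, P (γ r)) ht.1 fun ε hε => by
      obtain ⟨δ, hδ, H⟩ := huc (min (ε / 2) (1 / 2)) (by positivity)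
      refine ⟨δ, hδ, fun s s' hs hss hs't hlt => ?_⟩
      have hs' := hs't.trans ht.2
      have hsI : s ∈ Icc (0 : ℝ) 1 := ⟨hs, hss.trans hs'⟩
      have hsI' : s' ∈ Icc (0 : ℝ) 1 := ⟨hs.trans hss, hs'⟩
      have := loc (min (ε / 2) (1 / 2)) ((min_le_right _ _).trans_lt (by norm_num)) s s' hs hss hs'
        fun r hr => by
          have hrI : r ∈ Icc (0 : ℝ) 1 := ⟨hs.trans hr.1, hr.2.trans hs'⟩
          have h1 := H r hrI s hsI (by
            rw [Real.dist_eq, abs_of_nonneg (sub_nonneg.2 hr.1)]; linarith [hr.2])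
          rw [Real.dist_eq, hsubA hsI hrI] at h1
          exact (hη.seminorm_sub_le hγ hP hs hr.1 hrI.2).trans ((le_abs_self _).trans h1.le)
      have hnn : 0 ≤ ∫ r in s..s', P (γ r) :=
        intervalIntegral.integral_nonneg hss fun r _ => apply_nonneg P _
      rw [hsubA hsI hsI', sub_sub_sub_comm, intervalIntegral.integral_interval_sub_left
        (iω (by simp) hsI') (iω (by simp) hsI)]
      refine this.trans (mul_le_mul_of_nonneg_right ?_ hnn)
      linarith [min_le_left (ε / 2) (1 / 2)]
  simp only [intervalIntegral.integral_same, sub_zero] at hR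
  rw [map_sub]
  linarith

end IsDerivFamily

end AbsolutelyContinuous

/-! ### Operations on absolutely continuous functions -/

section Operations

variable {E : Type*} [AddCommGroup E] [Module ℝ E] [TopologicalSpace E]
  {F : Type*} [AddCommGroup F] [Module ℝ F] [TopologicalSpace F]
  {p : ℝ≥0∞}

theorem LusinMeasurableOn.union {X : Type*} [TopologicalSpace X] {γ : ℝ → X} {I J : Set ℝ}
    (hI : LusinMeasurableOn γ I) (hJ : LusinMeasurableOn γ J) : LusinMeasurableOn γ (I ∪ J) := by
  obtain ⟨K, hK, hK0⟩ := hI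
  obtain ⟨L, hL, hL0⟩ := hJ
  let e := Equiv.natSumNatEquivNat.symm
  have hKL : ∀ m : ℕ ⊕ ℕ, IsCompact (Sum.elim K L m) ∧ Sum.elim K L m ⊆ I ∪ J ∧
      ContinuousOn γ (Sum.elim K L m) := by
    rintro (j | j)
    · exact ⟨(hK j).1, (hK j).2.1.trans subset_union_left, (hK j).2.2⟩
    · exact ⟨(hL j).1, (hL j).2.1.trans subset_union_right, (hL j).2.2⟩
  refine ⟨fun n => Sum.elim K L (e n), fun n => hKL (e n), measure_mono_null ?_
    (measure_union_null hK0 hL0)⟩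
  · have h : ∀ m : ℕ ⊕ ℕ, Sum.elim K L m ⊆ ⋃ n, Sum.elim K L (e n) := fun m => by
      have := subset_iUnion (fun n => Sum.elim K L (e n)) (e.symm m)
      simpa using this
    rintro x ⟨hx | hx, hn⟩
    · exact Or.inl ⟨hx, fun hx' => hn (by
        obtain ⟨j, hj⟩ := mem_iUnion.1 hx'; exact h (Sum.inl j) hj)⟩
    · exact Or.inr ⟨hx, fun hx' => hn (by
        obtain ⟨j, hj⟩ := mem_iUnion.1 hx'; exact h (Sum.inr j) hj)⟩

theorem LusinMeasurableOn.of_eq_off_endpoint {X : Type*} [TopologicalSpace X] {γ : ℝ → X}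
    {a b c : ℝ} {x : X} (h : ∀ s ∈ Icc a b, s ≠ c → γ s = x) (hc : c = a ∨ c = b) :
    LusinMeasurableOn γ (Icc a b) := by
  refine ⟨fun n => if c = a then Icc (a + 1 / (n + 1)) b else Icc a (b - 1 / (n + 1)),
    fun n => ?_, measure_mono_null (t := {c}) ?_ (measure_singleton c)⟩
  · have hn : 0 < 1 / ((n : ℝ) + 1) := by positivity
    split_ifs with hca
    · have hsub : Icc (a + 1 / ((n : ℝ) + 1)) b ⊆ Icc a b := Icc_subset_Icc_left (by linarith)
      refine ⟨isCompact_Icc, hsub, continuousOn_const.congr fun s hs => h s (hsub hs) ?_⟩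
      have := hs.1
      intro h'
      linarith
    · have hcb := hc.resolve_left hca
      have hsub : Icc a (b - 1 / ((n : ℝ) + 1)) ⊆ Icc a b := Icc_subset_Icc_right (by linarith)
      refine ⟨isCompact_Icc, hsub, continuousOn_const.congr fun s hs => h s (hsub hs) ?_⟩
      have := hs.2
      intro h'
      linarith
  · rintro s ⟨hs, hn⟩
    by_contra hsc
    have hsc : s ≠ c := hsc
    refine hn ?_
    rw [mem_iUnion]
    by_cases hca : c = a
    · have hlt : 0 < s - a := sub_pos.2 (lt_of_le_of_ne hs.1 fun h' => hsc (h' ▸ hca.symm))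
      obtain ⟨n, hn⟩ := exists_nat_one_div_lt hlt
      exact ⟨n, by rw [if_pos hca]; exact ⟨by linarith, hs.2⟩⟩
    · have hcb := hc.resolve_left hca
      have hlt : 0 < b - s := sub_pos.2 (lt_of_le_of_ne hs.2 fun h' => hsc (h'.trans hcb.symm))
      obtain ⟨n, hn⟩ := exists_nat_one_div_lt hlt
      exact ⟨n, by rw [if_neg hca]; exact ⟨hs.1, by linarith⟩⟩

theorem IsWeakPrimitiveOn.congr {γ η η' : ℝ → E} {a b : ℝ} (h : IsWeakPrimitiveOn γ η a b)
    (he : EqOn η η' (Icc a b)) : IsWeakPrimitiveOn γ η' a b := by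
  intro t ht l
  rw [← he ht, ← he (left_mem_Icc.2 (ht.1.trans ht.2))]
  exact h t ht l

theorem IsWeakPrimitiveOn.mono {γ η : ℝ → E} {a b c d : ℝ} (h : IsWeakPrimitiveOn γ η a b)
    (hac : a ≤ c) (hdb : d ≤ b) : IsWeakPrimitiveOn γ η c d := fun _ ht l =>
  h.apply_sub ⟨hac, (ht.1.trans ht.2).trans hdb⟩ ⟨hac.trans ht.1, ht.2.trans hdb⟩ l

theorem MemLpLC.mono_Icc {γ : ℝ → E} {a b c d : ℝ} (h : MemLpLC p γ (Icc a b))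
    (hac : a ≤ c) (hdb : d ≤ b) : MemLpLC p γ (Icc c d) := by
  have hsub : Icc c d ⊆ Icc a b := Icc_subset_Icc hac hdb
  obtain ⟨⟨K, hK, hK0⟩, hn⟩ := h
  refine ⟨⟨fun j => K j ∩ Icc c d, fun j => ⟨(hK j).1.inter_right isClosed_Icc,
    inter_subset_right, (hK j).2.2.mono inter_subset_left⟩, measure_mono_null ?_ hK0⟩,
    fun q hq => (eLpNorm_mono_measure _ (Measure.restrict_mono hsub le_rfl)).trans_lt (hn q hq)⟩
  rintro x ⟨hx, hx'⟩
  rw [← iUnion_inter] at hx'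
  exact ⟨hsub hx, fun h => hx' ⟨h, hx⟩⟩

theorem IsACOn.mono {η : ℝ → E} {a b c d : ℝ} (h : IsACOn p η a b) (hac : a ≤ c) (hdb : d ≤ b) :
    IsACOn p η c d := by
  obtain ⟨γ, h1, h2⟩ := h
  exact ⟨γ, h1.mono_Icc hac hdb, h2.mono hac hdb⟩

theorem eLpNorm_seminorm_indicator (q : Seminorm ℝ E) (γ : ℝ → E) {a b : ℝ} (ha : 0 ≤ a)
    (hb : b ≤ 1) : eLpNorm (fun s => q ((Icc a b).indicator γ s)) p (volume.restrict (Icc 0 1)) =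
      eLpNorm (fun s => q (γ s)) p (volume.restrict (Icc a b)) := by
  have e : (fun s => q ((Icc a b).indicator γ s)) = (Icc a b).indicator fun s => q (γ s) := by
    funext s
    by_cases hs : s ∈ Icc a b <;> simp [hs]
  rw [e, eLpNorm_indicator_eq_eLpNorm_restrict measurableSet_Icc,
    Measure.restrict_restrict measurableSet_Icc, inter_eq_left.2 (Icc_subset_Icc ha hb)]

theorem MemLpLC.indicator {γ : ℝ → E} {a b : ℝ} (h : MemLpLC p γ (Icc a b)) (ha : 0 ≤ a)
    (hab : a ≤ b) (hb : b ≤ 1) : MemLpLC p ((Icc a b).indicator γ) (Icc 0 1) := by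
  refine ⟨?_, fun q hq => by rw [eLpNorm_seminorm_indicator q γ ha hb]; exact h.2 q hq⟩
  have h1 : LusinMeasurableOn ((Icc a b).indicator γ) (Icc 0 a) :=
    LusinMeasurableOn.of_eq_off_endpoint (c := a) (x := 0) (fun s hs hsa =>
      indicator_of_notMem (fun h' => hsa (le_antisymm hs.2 h'.1)) _) (Or.inr rfl)
  have h2 : LusinMeasurableOn ((Icc a b).indicator γ) (Icc b 1) :=
    LusinMeasurableOn.of_eq_off_endpoint (c := b) (x := 0) (fun s hs hsa =>
      indicator_of_notMem (fun h' => hsa (le_antisymm h'.2 hs.1)) _) (Or.inl rfl)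
  have h3 : LusinMeasurableOn ((Icc a b).indicator γ) (Icc a b) := by
    obtain ⟨K, hK, hK0⟩ := h.1
    exact ⟨K, fun j => ⟨(hK j).1, (hK j).2.1, (hK j).2.2.congr fun s hs =>
      indicator_of_mem ((hK j).2.1 hs) _⟩, hK0⟩
  have := (h1.union h3).union h2
  rwa [Icc_union_Icc_eq_Icc ha hab, Icc_union_Icc_eq_Icc (ha.trans hab) hb] at this

/-- A function that is made constant to the left and to the right of `[a, b]` has the derivative of
the original function on `[a, b]` and the derivative `0` elsewhere. -/
theorem IsWeakPrimitiveOn.retractIcc {γ η : ℝ → E} {a b : ℝ} (h : IsWeakPrimitiveOn γ η a b)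
    (ha : 0 ≤ a) (hab : a ≤ b) :
    IsWeakPrimitiveOn ((Icc a b).indicator γ) (fun s => η (max a (min s b))) 0 1 := by
  intro t ht l
  have hm : max a (min t b) ∈ Icc a b := ⟨le_max_left _ _, max_le hab (min_le_right _ _)⟩
  have h0 : max a (min 0 b) = a := by
    rw [min_eq_left (ha.trans hab), max_eq_left ha]
  obtain ⟨-, e⟩ := h _ hm l
  obtain ⟨i1, -⟩ := h b (right_mem_Icc.2 hab) l
  have ei : (fun s => l ((Icc a b).indicator γ s)) = (Icc a b).indicator fun s => l (γ s) := by
    funext s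
    by_cases hs : s ∈ Icc a b <;> simp [hs]
  have hi : Integrable ((Icc a b).indicator fun s => l (γ s)) := by
    rw [integrable_indicator_iff measurableSet_Icc, integrableOn_Icc_iff_integrableOn_Ioc]
    exact (intervalIntegrable_iff_integrableOn_Ioc_of_le hab).1 i1
  refine ⟨by rw [ei]; exact hi.intervalIntegrable, ?_⟩
  simp only [h0]
  rw [e, ei, intervalIntegral.integral_of_le hm.1, intervalIntegral.integral_of_le ht.1,
    ← integral_Icc_eq_integral_Ioc, ← integral_Icc_eq_integral_Ioc,
    setIntegral_indicator measurableSet_Icc]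
  rcases le_total a t with hat | hat
  · congr 2
    ext s
    simp only [mem_Icc, mem_inter_iff, max_eq_right (le_min hat hab), le_min_iff]
    constructor
    · rintro ⟨h1, h2, h3⟩
      exact ⟨⟨ha.trans h1, h2⟩, h1, h3⟩
    · rintro ⟨⟨_, h2⟩, h1, h3⟩
      exact ⟨h1, h2, h3⟩
  · rw [max_eq_left ((min_le_left _ _).trans hat), Icc_self]
    have hsub : Icc 0 t ∩ Icc a b ⊆ {a} := fun s hs =>
      le_antisymm (hs.1.2.trans hat) hs.2.1
    rw [setIntegral_measure_zero _ (by simp),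
      setIntegral_measure_zero _ (measure_mono_null hsub (by simp))]

theorem IsACOn.retractIcc {η : ℝ → E} {a b : ℝ} (h : IsACOn p η a b) (ha : 0 ≤ a) (hab : a ≤ b)
    (hb : b ≤ 1) : IsACOn p (fun s => η (max a (min s b))) 0 1 := by
  obtain ⟨γ, h1, h2⟩ := h
  exact ⟨_, h1.indicator ha hab hb, h2.retractIcc ha hab⟩

/-- The retraction of `[0,1]` onto `[a,b]`. -/
def retractIcc (a b t : unitInterval) : unitInterval := max a (min t b)

theorem retractIcc_mem {a b : unitInterval} (hab : a ≤ b) (t : unitInterval) :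
    retractIcc a b t ∈ Icc a b :=
  ⟨le_max_left _ _, max_le hab (min_le_right _ _)⟩

theorem retractIcc_eq_self {a b t : unitInterval} (ht : t ∈ Icc a b) : retractIcc a b t = t := by
  rw [retractIcc, min_eq_left ht.2, max_eq_right ht.1]

theorem IccExtend_comp_retractIcc {X : Type*} (x : unitInterval → X) (a b : unitInterval) {s : ℝ}
    (hs : s ∈ Icc (0 : ℝ) 1) : IccExtend zero_le_one (fun t => x (retractIcc a b t)) s =
      IccExtend zero_le_one x (max (a : ℝ) (min s b)) := by
  have hm : max (a : ℝ) (min s b) ∈ Icc (0 : ℝ) 1 :=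
    ⟨a.2.1.trans (le_max_left _ _), max_le a.2.2 ((min_le_left _ _).trans hs.2)⟩
  rw [IccExtend_of_mem _ _ hs, IccExtend_of_mem _ _ hm]
  rfl

section

variable [IsTopologicalAddGroup E] [ContinuousSMul ℝ E]

theorem mem_acSubmodule {x : unitInterval → E} :
    x ∈ acSubmodule p E ↔ IsACOn p (IccExtend zero_le_one x) 0 1 := Iff.rfl

/-- A function is absolutely continuous on `[a, b]` if and only if its composition with the
retraction onto `[a, b]` is absolutely continuous on `[0, 1]`. -/
theorem comp_retractIcc_mem_acSubmodule_iff {x : unitInterval → E} {a b : unitInterval}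
    (hab : a ≤ b) :
    (fun t => x (retractIcc a b t)) ∈ acSubmodule p E ↔ IsACOn p (IccExtend zero_le_one x) a b := by
  rw [mem_acSubmodule]
  constructor
  · intro h
    obtain ⟨γ, h1, h2⟩ := h.mono a.2.1 b.2.2
    refine ⟨γ, h1, h2.congr fun s hs => ?_⟩
    rw [IccExtend_comp_retractIcc x a b ⟨a.2.1.trans hs.1, hs.2.trans b.2.2⟩, min_eq_left hs.2,
      max_eq_right hs.1]
  · intro h
    obtain ⟨γ, h1, h2⟩ := h.retractIcc a.2.1 hab b.2.2
    exact ⟨γ, h1, h2.congr fun s hs => (IccExtend_comp_retractIcc x a b hs).symm⟩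

theorem comp_retractIcc_mem_acSubmodule {x : unitInterval → E} (hx : x ∈ acSubmodule p E)
    {a b : unitInterval} (hab : a ≤ b) : (fun t => x (retractIcc a b t)) ∈ acSubmodule p E :=
  (comp_retractIcc_mem_acSubmodule_iff hab).2 ((mem_acSubmodule.1 hx).mono a.2.1 b.2.2)

theorem const_mem_acSubmodule (c : E) : (fun _ : unitInterval => c) ∈ acSubmodule p E := by
  refine ⟨0, MemLpLC.zero p, fun t _ l => ?_⟩
  simp [IccExtend]

variable [LocallyConvexSpace ℝ E]

theorem continuous_of_mem_acSubmodule [Fact (1 ≤ p)] {x : unitInterval → E}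
    (hx : x ∈ acSubmodule p E) : Continuous x := by
  obtain ⟨γ, h1, h2⟩ := hx
  have := (h2.continuousOn h1).comp_continuous continuous_subtype_val fun t : unitInterval => t.2
  exact this.congr fun t => IccExtend_val _ _ t

variable [IsTopologicalAddGroup F] [ContinuousSMul ℝ F]

theorem MemLpLC.prodMk {γ : ℝ → E} {δ : ℝ → F} {I : Set ℝ} (hγ : MemLpLC p γ I)
    (hδ : MemLpLC p δ I) : MemLpLC p (fun s => (γ s, δ s)) I := by
  have e1 : MemLpLC p (fun s => (γ s, (0 : F))) I := by
    refine ⟨hγ.1.comp (f := fun x => (x, (0 : F))) (by fun_prop), fun q hq => ?_⟩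
    exact hγ.2 (q.comp (LinearMap.inl ℝ E F)) (hq.comp (by fun_prop : Continuous fun x : E =>
      (x, (0 : F))))
  have e2 : MemLpLC p (fun s => ((0 : E), δ s)) I := by
    refine ⟨hδ.1.comp (f := fun x => ((0 : E), x)) (by fun_prop), fun q hq => ?_⟩
    exact hδ.2 (q.comp (LinearMap.inr ℝ E F)) (hq.comp (by fun_prop : Continuous fun x : F =>
      ((0 : E), x)))
  convert e1.add e2 using 2 with s
  simp

theorem IsWeakPrimitiveOn.prodMk {γ η : ℝ → E} {δ ξ : ℝ → F} {a b : ℝ}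
    (h : IsWeakPrimitiveOn γ η a b) (h' : IsWeakPrimitiveOn δ ξ a b) :
    IsWeakPrimitiveOn (fun s => (γ s, δ s)) (fun s => (η s, ξ s)) a b := by
  intro t ht l
  have e : ∀ x y, l (x, y) = l.comp (ContinuousLinearMap.inl ℝ E F) x +
      l.comp (ContinuousLinearMap.inr ℝ E F) y := fun x y => by
    simp [← map_add]
  obtain ⟨i1, e1⟩ := h t ht (l.comp (ContinuousLinearMap.inl ℝ E F))
  obtain ⟨i2, e2⟩ := h' t ht (l.comp (ContinuousLinearMap.inr ℝ E F))
  simp only [Prod.mk_sub_mk, e]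
  exact ⟨i1.add i2, by rw [e1, e2, intervalIntegral.integral_add i1 i2]⟩

theorem prodMk_mem_acSubmodule {x : unitInterval → E} {y : unitInterval → F}
    (hx : x ∈ acSubmodule p E) (hy : y ∈ acSubmodule p F) :
    (fun t => (x t, y t)) ∈ acSubmodule p (E × F) := by
  obtain ⟨γ, h1, h2⟩ := hx
  obtain ⟨δ, h3, h4⟩ := hy
  exact ⟨_, h1.prodMk h3, h2.prodMk h4⟩

variable [LocallyConvexSpace ℝ F] [T2Space F]

theorem BastianiOn.exists_isDerivFamily {n : ℕ} {g : E → F} {O : Set E} (hO : IsOpen O)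
    (hg : BastianiOn n g O) : ∃ d, IsDerivFamily n g O d := by
  obtain ⟨-, d, h0, h1, h2⟩ := contDiffLC_of_bastianiOn (k := n) hO
    fun m hm => hg.of_le (by exact_mod_cast hm)
  exact ⟨d, h0, h1, h2⟩

/-- Composition with a `C^2`-map preserves absolute continuity. -/
theorem comp_mem_acSubmodule [Fact (1 ≤ p)] {g : E → F} {O : Set E} (hO : IsOpen O)
    (hg : BastianiOn 2 g O) {x : unitInterval → E} (hx : x ∈ acSubmodule p E)
    (hxO : ∀ t, x t ∈ O) : (fun t => g (x t)) ∈ acSubmodule p F := by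
  obtain ⟨d, hd⟩ := hg.exists_isDerivFamily hO
  obtain ⟨γ, h1, h2⟩ := hx
  have hm : MapsTo (IccExtend zero_le_one x) (Icc 0 1) O := fun s _ => hxO _
  exact ⟨_, hd.memLpLC_comp hO (by norm_num) h1 (h2.continuousOn h1) hm,
    hd.isWeakPrimitiveOn_comp hO (by norm_num) h1 h2 hm⟩

end

/-- A function is the sum of its initial value and its increments over the intervals of
a partition. -/
theorem sum_comp_retractIcc_sub (t : ℕ → unitInterval) (ht : Monotone t) (h0 : t 0 = 0) {n : ℕ}
    (hn : t n = 1) (x : unitInterval → E) (s : unitInterval) :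
    x 0 + ∑ j ∈ Finset.range n,
      (x (retractIcc (t j) (t (j + 1)) s) - x (retractIcc (t j) (t (j + 1)) 0)) = x s := by
  have e : ∀ j, x (retractIcc (t j) (t (j + 1)) s) - x (retractIcc (t j) (t (j + 1)) 0)
      = x (min s (t (j + 1))) - x (min s (t j)) := by
    intro j
    have hz : retractIcc (t j) (t (j + 1)) 0 = t j := by
      rw [retractIcc, min_eq_left unitInterval.nonneg', max_eq_left unitInterval.nonneg']
    rw [hz]
    rcases le_total (t j) s with h | h
    · rw [retractIcc, max_eq_right (le_min h (ht j.le_succ)), min_eq_right h]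
    · rw [retractIcc, min_eq_left h, min_eq_left (h.trans (ht j.le_succ)), max_eq_left h, sub_self,
        sub_self]
  simp only [e]
  rw [Finset.sum_range_sub (fun j => x (min s (t j))), hn, h0,
    min_eq_left unitInterval.le_one', min_eq_right unitInterval.nonneg', add_sub_cancel]

end Operations

/-! ### The locally convex space of absolutely continuous functions -/

namespace ACSpace

variable {p : ℝ≥0∞} [Fact (1 ≤ p)]
  {E : Type*} [AddCommGroup E] [Module ℝ E] [TopologicalSpace E]
  [IsTopologicalAddGroup E] [ContinuousSMul ℝ E] [LocallyConvexSpace ℝ E]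
  {F : Type*} [AddCommGroup F] [Module ℝ F] [TopologicalSpace F]
  [IsTopologicalAddGroup F] [ContinuousSMul ℝ F] [LocallyConvexSpace ℝ F]

instance : IsTopologicalAddGroup (ACSpace p E) :=
  haveI : Nonempty {q : Seminorm ℝ E // Continuous q} := ⟨⟨0, continuous_const⟩⟩
  (withSeminorms (p := p) (E := E)).topologicalAddGroup

instance : ContinuousSMul ℝ (ACSpace p E) :=
  haveI : Nonempty {q : Seminorm ℝ E // Continuous q} := ⟨⟨0, continuous_const⟩⟩
  (withSeminorms (p := p) (E := E)).continuousSMul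

/-- The extension of an element of `AC_{L^p}([0,1], E)` to `ℝ` by constants. -/
noncomputable def extend (η : ACSpace p E) : ℝ → E := IccExtend zero_le_one (η : unitInterval → E)

theorem extend_coe (η : ACSpace p E) (t : unitInterval) : η.extend t = η t := IccExtend_val _ _ t

theorem isWeakPrimitiveOn_extend (η : ACSpace p E) :
    IsWeakPrimitiveOn η.derivRep η.extend 0 1 := η.isWeakPrimitiveOn_derivRep

theorem extend_zero (η : ACSpace p E) : η.extend 0 = η 0 := η.extend_coe 0

theorem seminorm_apply_le (η : ACSpace p E) {q : Seminorm ℝ E} (hq : Continuous q)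
    (t : unitInterval) : q (η t) ≤ acSeminorm ⟨q, hq⟩ η := by
  have := η.isWeakPrimitiveOn_extend.seminorm_le η.memLpLC_derivRep hq t.2
  rw [extend_coe, extend_zero] at this
  exact this

theorem lpDeriv_le (η : ACSpace p E) {q : Seminorm ℝ E} (hq : Continuous q) :
    lpDeriv q η ≤ acSeminorm ⟨q, hq⟩ η := le_add_of_nonneg_left (apply_nonneg q _)

/-- An upper bound for a seminorm of `η` from a pointwise bound for a derivative of `η`. -/
theorem acSeminorm_le (η : ACSpace p E) {γ : ℝ → E} (hγ : MemLpLC p γ (Icc 0 1))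
    (h : IsWeakPrimitiveOn γ η.extend 0 1) {q : Seminorm ℝ E} (hq : Continuous q)
    {b₁ b₂ : ℝ → ℝ} {c₁ c₂ : ℝ} (hb₁ : MemLp b₁ p (volume.restrict (Icc 0 1)))
    (hb₂ : MemLp b₂ p (volume.restrict (Icc 0 1))) (hc₁ : 0 ≤ c₁) (hc₂ : 0 ≤ c₂)
    (hb : ∀ s ∈ Icc (0 : ℝ) 1, q (γ s) ≤ c₁ * b₁ s + c₂ * b₂ s) :
    acSeminorm ⟨q, hq⟩ η ≤ q (η 0) +
      (c₁ * (eLpNorm b₁ p (volume.restrict (Icc 0 1))).toReal +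
        c₂ * (eLpNorm b₂ p (volume.restrict (Icc 0 1))).toReal) := by
  refine add_le_add_right ?_ (q (η 0))
  rw [lpDeriv_eq hq η hγ h]
  have m₁ := hb₁.const_mul c₁
  have m₂ := hb₂.const_mul c₂
  have e : ∀ {c : ℝ} {b : ℝ → ℝ}, 0 ≤ c →
      (eLpNorm (fun s => c * b s) p (volume.restrict (Icc 0 1))).toReal =
        c * (eLpNorm b p (volume.restrict (Icc 0 1))).toReal := by
    intro c b hc
    have := eLpNorm_const_smul c b p (volume.restrict (Icc (0 : ℝ) 1))
    rw [show (fun s => c * b s) = c • b from rfl, this, ENNReal.toReal_mul]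
    simp [abs_of_nonneg hc]
  rw [← e hc₁, ← e hc₂, ← ENNReal.toReal_add m₁.2.ne m₂.2.ne]
  refine ENNReal.toReal_mono (ENNReal.add_ne_top.2 ⟨m₁.2.ne, m₂.2.ne⟩) ?_
  refine le_trans (eLpNorm_mono_ae_real ?_) (eLpNorm_add_le m₁.1 m₂.1 (Fact.out : 1 ≤ p))
  rw [ae_restrict_iff' measurableSet_Icc]
  refine Eventually.of_forall fun s hs => ?_
  rw [Real.norm_eq_abs, abs_of_nonneg (apply_nonneg q _)]
  exact hb s hs

instance [T2Space E] : T2Space (ACSpace p E) := by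
  have : Nonempty {q : Seminorm ℝ E // Continuous q} := ⟨⟨0, continuous_const⟩⟩
  have : T1Space (ACSpace p E) := by
    refine (withSeminorms (p := p) (E := E)).T1_of_separating fun η hη => ?_
    by_contra! hcon
    refine hη (ext fun t => ?_)
    by_contra hne
    have hE := with_gaugeSeminormFamily (𝕜 := ℝ) (E := E)
    obtain ⟨i, hi⟩ := hE.separating_of_T1 (η t) hne
    have h1 := η.seminorm_apply_le (hE.continuous_seminorm i) t
    rw [hcon] at h1
    exact hi (le_antisymm h1 (apply_nonneg _ _))
  infer_instance

theorem continuous_of_seminorm_le {X : Type*} [AddCommGroup X] [Module ℝ X] [TopologicalSpace X]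
    [IsTopologicalAddGroup X] [ContinuousSMul ℝ X] (f : X →ₗ[ℝ] ACSpace p F)
    (h : ∀ q : {q : Seminorm ℝ F // Continuous q}, ∃ r : Seminorm ℝ X, Continuous r ∧
      ∀ x, acSeminorm q (f x) ≤ r x) : Continuous f := by
  refine (withSeminorms (p := p) (E := F)).continuous_of_continuous_comp f fun q => ?_
  obtain ⟨r, hr, hle⟩ := h q
  exact Seminorm.continuous_of_le hr hle

theorem continuous_acSeminorm (q : {q : Seminorm ℝ E // Continuous q}) :
    Continuous (acSeminorm (p := p) q) :=
  (withSeminorms (p := p) (E := E)).continuous_seminorm q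

/-- The continuous linear map that sends `η` to the constant function with value `η 0`. -/
noncomputable def constAtZero : ACSpace p E →L[ℝ] ACSpace p E where
  toFun η := mk _ (const_mem_acSubmodule (η 0))
  map_add' _ _ := rfl
  map_smul' _ _ := rfl
  cont := by
    refine continuous_of_seminorm_le
      { toFun := fun η : ACSpace p E => mk _ (const_mem_acSubmodule (η 0))
        map_add' := fun _ _ => rfl
        map_smul' := fun _ _ => rfl } fun q => ⟨acSeminorm q, continuous_acSeminorm q,
          fun η => ?_⟩
    have := acSeminorm_le (p := p) (mk _ (const_mem_acSubmodule (η 0))) (γ := 0) (MemLpLC.zero p)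
      (fun t _ l => by simp [extend, IccExtend, toFun, mk]) q.2 (MemLp.zero (ε := ℝ))
      (MemLp.zero (ε := ℝ)) le_rfl le_rfl (c₁ := 0) (c₂ := 0) (by simp)
    refine this.trans ?_
    simpa using η.seminorm_apply_le q.2 0

/-- The continuous linear map `η ↦ η ∘ retractIcc a b`. -/
noncomputable def retract {a b : unitInterval} (hab : a ≤ b) : ACSpace p E →L[ℝ] ACSpace p E where
  toFun η := mk _ (comp_retractIcc_mem_acSubmodule η.mem hab)
  map_add' _ _ := rfl
  map_smul' _ _ := rfl
  cont := by
    refine continuous_of_seminorm_le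
      { toFun := fun η : ACSpace p E => mk _ (comp_retractIcc_mem_acSubmodule η.mem hab)
        map_add' := fun _ _ => rfl
        map_smul' := fun _ _ => rfl } fun q => ⟨acSeminorm q + acSeminorm q,
          (continuous_acSeminorm q).add (continuous_acSeminorm q), fun η => ?_⟩
    have hm := η.memLpLC_derivRep.mono_Icc a.2.1 b.2.2
    have hw := (η.isWeakPrimitiveOn_extend.mono a.2.1 b.2.2).retractIcc a.2.1 hab
    have := acSeminorm_le (p := p) (mk _ (comp_retractIcc_mem_acSubmodule η.mem hab))
      (hm.indicator a.2.1 hab b.2.2)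
      (hw.congr fun s hs => (IccExtend_comp_retractIcc η.toFun a b hs).symm) q.2
      (b₁ := fun s => q.1 (η.derivRep s)) (b₂ := fun _ => 0) (c₁ := 1) (c₂ := 0)
      (η.memLpLC_derivRep.memLp q.2) MemLp.zero' zero_le_one le_rfl (fun s _ => by
        by_cases hs : s ∈ Icc (a : ℝ) b <;> simp [hs])
    refine this.trans (add_le_add (η.seminorm_apply_le q.2 _) ?_)
    rw [one_mul, zero_mul, add_zero]
    exact η.lpDeriv_le q.2

/-- The continuous linear map `(η, ξ) ↦ (t ↦ (η t, ξ t))`. -/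
noncomputable def pair : ACSpace p E × ACSpace p F →L[ℝ] ACSpace p (E × F) where
  toFun x := mk _ (prodMk_mem_acSubmodule x.1.mem x.2.mem)
  map_add' _ _ := rfl
  map_smul' _ _ := rfl
  cont := by
    refine continuous_of_seminorm_le
      { toFun := fun x : ACSpace p E × ACSpace p F => mk _ (prodMk_mem_acSubmodule x.1.mem x.2.mem)
        map_add' := fun _ _ => rfl
        map_smul' := fun _ _ => rfl } fun q => ?_
    have c₁ : Continuous (q.1.comp (LinearMap.inl ℝ E F)) :=
      q.2.comp (by fun_prop : Continuous fun x : E => (x, (0 : F)))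
    have c₂ : Continuous (q.1.comp (LinearMap.inr ℝ E F)) :=
      q.2.comp (by fun_prop : Continuous fun x : F => ((0 : E), x))
    have hle : ∀ x y, q.1 (x, y) ≤ q.1.comp (LinearMap.inl ℝ E F) x +
        q.1.comp (LinearMap.inr ℝ E F) y := fun x y => by
      simpa using map_add_le_add q.1 (x, 0) (0, y)
    refine ⟨(acSeminorm ⟨_, c₁⟩).comp (LinearMap.fst ℝ _ _) +
      (acSeminorm ⟨_, c₂⟩).comp (LinearMap.snd ℝ _ _),
      ((continuous_acSeminorm ⟨_, c₁⟩).comp continuous_fst).add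
        ((continuous_acSeminorm ⟨_, c₂⟩).comp continuous_snd), fun x => ?_⟩
    have := acSeminorm_le (p := p) (mk _ (prodMk_mem_acSubmodule x.1.mem x.2.mem))
      (x.1.memLpLC_derivRep.prodMk x.2.memLpLC_derivRep)
      (x.1.isWeakPrimitiveOn_extend.prodMk x.2.isWeakPrimitiveOn_extend) q.2
      (c₁ := 1) (c₂ := 1) (x.1.memLpLC_derivRep.memLp c₁) (x.2.memLpLC_derivRep.memLp c₂)
      zero_le_one zero_le_one fun s _ => by
        rw [one_mul, one_mul]; exact hle _ _
    rw [one_mul, one_mul] at this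
    refine this.trans ((add_le_add_left (hle (x.1 0) (x.2 0)) _).trans (le_of_eq ?_))
    rw [add_add_add_comm]
    rfl

/-! ### Superposition operators -/

open Classical in
/-- The superposition operator `η ↦ g ∘ η`. It takes the value `0` where `g ∘ η` is not absolutely
continuous. -/
noncomputable def postcomp (g : E → F) (η : ACSpace p E) : ACSpace p F :=
  if h : (fun t => g (η t)) ∈ acSubmodule p F then mk _ h else 0

theorem postcomp_apply {g : E → F} {η : ACSpace p E}
    (h : (fun t => g (η t)) ∈ acSubmodule p F) (t : unitInterval) : postcomp g η t = g (η t) := by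
  rw [postcomp, dif_pos h, mk_apply]

/-- The set of the absolutely continuous functions with values in `O`. -/
def valuesIn (p : ℝ≥0∞) (O : Set E) : Set (ACSpace p E) := {η | ∀ t, η t ∈ O}

theorem isCompact_image_extend (η : ACSpace p E) : IsCompact (η.extend '' Icc 0 1) :=
  isCompact_Icc.image_of_continuousOn (η.isWeakPrimitiveOn_extend.continuousOn η.memLpLC_derivRep)

theorem extend_mem {O : Set E} {η : ACSpace p E} (h : η ∈ valuesIn p O) (s : ℝ) :
    η.extend s ∈ O := h _

theorem image_extend_subset {O : Set E} {η : ACSpace p E} (h : η ∈ valuesIn p O) :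
    η.extend '' Icc 0 1 ⊆ O := image_subset_iff.2 fun s _ => extend_mem h s

theorem coe_mem_image_extend (η : ACSpace p E) (t : unitInterval) :
    η t ∈ η.extend '' Icc 0 1 := ⟨t, t.2, η.extend_coe t⟩

theorem eventually_acSeminorm_sub_lt (η₀ : ACSpace p E) (q : {q : Seminorm ℝ E // Continuous q})
    {ε : ℝ} (hε : 0 < ε) : ∀ᶠ η in 𝓝 η₀, acSeminorm q (η - η₀) < ε :=
  ((withSeminorms (p := p) (E := E)).tendsto_nhds id η₀).1 tendsto_id q ε hε

theorem isOpen_valuesIn {O : Set E} (hO : IsOpen O) : IsOpen (valuesIn p O) := by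
  rw [isOpen_iff_mem_nhds]
  intro η₀ hη₀
  -- the estimate is only used for the neighbourhood of the compact image that it provides
  obtain ⟨P, hP, h⟩ := exists_seminorm_prod_bound (F := ℝ) one_pos hO (D := fun _ _ => 0)
    continuousOn_const (fun _ _ => ⟨0, fun _ => rfl⟩) η₀.isCompact_image_extend
    (image_extend_subset hη₀) (q := normSeminorm ℝ ℝ) continuous_norm
  filter_upwards [eventually_acSeminorm_sub_lt η₀ ⟨P, hP⟩ one_pos] with η hη t
  exact (h _ (η₀.coe_mem_image_extend t) _ (((η - η₀).seminorm_apply_le hP t).trans_lt hη)).1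

variable [T2Space F] {g : E → F} {O : Set E}

theorem comp_mem (hO : IsOpen O) (hg : BastianiOn 2 g O) {η : ACSpace p E}
    (hη : η ∈ valuesIn p O) : (fun t => g (η t)) ∈ acSubmodule p F :=
  comp_mem_acSubmodule hO hg η.mem hη

theorem postcomp_apply_of_mem (hO : IsOpen O) (hg : BastianiOn 2 g O) {η : ACSpace p E}
    (hη : η ∈ valuesIn p O) (t : unitInterval) : postcomp g η t = g (η t) :=
  postcomp_apply (comp_mem hO hg hη) t

theorem extend_postcomp (hO : IsOpen O) (hg : BastianiOn 2 g O)
    {η : ACSpace p E} (hη : η ∈ valuesIn p O) :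
    (postcomp g η).extend = fun s => g (η.extend s) :=
  funext fun _ => postcomp_apply_of_mem hO hg hη _

section Derivative

variable {k : ℕ∞} {d : (j : ℕ) → E → (Fin j → E) → F}

theorem isWeakPrimitiveOn_postcomp (h : IsDerivFamily k g O d) (hO : IsOpen O) (hk : 2 ≤ k)
    (hg : BastianiOn 2 g O) {η : ACSpace p E} (hη : η ∈ valuesIn p O) :
    IsWeakPrimitiveOn (fun s => d 1 (η.extend s) ![η.derivRep s]) (postcomp g η).extend 0 1 := by
  rw [extend_postcomp hO hg hη]
  exact h.isWeakPrimitiveOn_comp hO hk η.memLpLC_derivRep η.isWeakPrimitiveOn_extend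
    fun s _ => extend_mem hη s

theorem memLpLC_postcomp (h : IsDerivFamily k g O d) (hO : IsOpen O) (hk : 1 ≤ k)
    {η : ACSpace p E} (hη : η ∈ valuesIn p O) :
    MemLpLC p (fun s => d 1 (η.extend s) ![η.derivRep s]) (Icc 0 1) :=
  h.memLpLC_comp hO hk η.memLpLC_derivRep
    (η.isWeakPrimitiveOn_extend.continuousOn η.memLpLC_derivRep) fun s _ => extend_mem hη s

end Derivative

end ACSpace

namespace ACSpace

section Superposition

variable {p : ℝ≥0∞} [Fact (1 ≤ p)]
  {E : Type*} [AddCommGroup E] [Module ℝ E] [TopologicalSpace E]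
  [IsTopologicalAddGroup E] [ContinuousSMul ℝ E] [LocallyConvexSpace ℝ E]
  {F : Type*} [AddCommGroup F] [Module ℝ F] [TopologicalSpace F]
  [IsTopologicalAddGroup F] [ContinuousSMul ℝ F] [LocallyConvexSpace ℝ F] [T2Space F]
  {g : E → F} {O : Set E}

theorem memLpLC_sub {γ δ : ℝ → E} {I : Set ℝ} (hγ : MemLpLC p γ I) (hδ : MemLpLC p δ I) :
    MemLpLC p (fun s => γ s - δ s) I := by
  convert hγ.add (hδ.smul (-1)) using 2 with s
  simp [sub_eq_add_neg]

theorem isWeakPrimitiveOn_sub {γ δ η ξ : ℝ → E} {a b : ℝ} (h : IsWeakPrimitiveOn γ η a b)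
    (h' : IsWeakPrimitiveOn δ ξ a b) :
    IsWeakPrimitiveOn (fun s => γ s - δ s) (fun s => η s - ξ s) a b := by
  convert h.add (h'.smul (-1)) using 2 with s s <;> simp [sub_eq_add_neg]

/-- Superposition operators of `C^2`-maps are continuous. -/
theorem continuousOn_postcomp (hO : IsOpen O) (hg : BastianiOn 2 g O) :
    ContinuousOn (postcomp g : ACSpace p E → ACSpace p F) (valuesIn p O) := by
  have : Nonempty {q : Seminorm ℝ F // Continuous q} := ⟨⟨0, continuous_const⟩⟩
  intro η₀ hη₀
  refine ContinuousAt.continuousWithinAt ?_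
  obtain ⟨d, hd⟩ := hg.exists_isDerivFamily hO
  refine ((withSeminorms (p := p) (E := F)).tendsto_nhds _ _).2 fun q ε hε => ?_
  obtain ⟨P, hP, hb⟩ := hd.exists_lipschitz_bound hO (by norm_num) η₀.isCompact_image_extend
    (image_extend_subset hη₀) q.2
  set C := lpDeriv P η₀ with hC
  have hC0 : 0 ≤ C := ENNReal.toReal_nonneg
  filter_upwards [eventually_acSeminorm_sub_lt η₀ ⟨P, hP⟩ one_pos,
    eventually_acSeminorm_sub_lt η₀ ⟨P, hP⟩ (ε := ε / (2 + C)) (by positivity)] with η h1 h2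
  set r := acSeminorm ⟨P, hP⟩ (η - η₀) with hr
  have hr0 : 0 ≤ r := apply_nonneg _ _
  have hPt : ∀ t, P (η t - η₀ t) ≤ r := fun t => (η - η₀).seminorm_apply_le hP t
  have bnd := fun t => hb (η₀ t) (η₀.coe_mem_image_extend t) (η t) ((hPt t).trans_lt h1)
  have hη : η ∈ valuesIn p O := fun t => (bnd t).1
  have m := memLpLC_sub (memLpLC_postcomp hd hO (by norm_num) hη)
    (memLpLC_postcomp hd hO (by norm_num) hη₀)
  have w := isWeakPrimitiveOn_sub (isWeakPrimitiveOn_postcomp hd hO (by norm_num) hg hη)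
    (isWeakPrimitiveOn_postcomp hd hO (by norm_num) hg hη₀)
  have md := memLpLC_sub η.memLpLC_derivRep η₀.memLpLC_derivRep
  have hle := acSeminorm_le (postcomp g η - postcomp g η₀) m w q.2 (c₁ := 1) (c₂ := r)
    (md.memLp hP) (η₀.memLpLC_derivRep.memLp hP) zero_le_one hr0 (fun s hs => by
      have hb' := (bnd ⟨s, hs⟩).2.2
      have e : η.extend s = η ⟨s, hs⟩ := η.extend_coe ⟨s, hs⟩
      have e₀ : η₀.extend s = η₀ ⟨s, hs⟩ := η₀.extend_coe ⟨s, hs⟩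
      -- the first term is small as the derivatives are close in `L^p`, the second one as the
      -- functions are uniformly close
      have e1 : d 1 (η.extend s) ![η.derivRep s] - d 1 (η₀.extend s) ![η₀.derivRep s] =
          d 1 (η.extend s) ![η.derivRep s - η₀.derivRep s] +
            (d 1 (η.extend s) ![η₀.derivRep s] - d 1 (η₀.extend s) ![η₀.derivRep s]) := by
        have := hd.map_add_one hO (by norm_num) (extend_mem hη s)
          (η.derivRep s - η₀.derivRep s) (η₀.derivRep s)
        rw [sub_add_cancel] at this
        rw [this]
        abel
      rw [e1, e, e₀, one_mul]
      refine (map_add_le_add q.1 _ _).trans (add_le_add (hb' _).1 ((hb' _).2.trans ?_))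
      rw [mul_comm]
      exact mul_le_mul_of_nonneg_right (hPt _) (apply_nonneg _ _))
  have h0 : q.1 ((postcomp g η - postcomp g η₀) 0) ≤ P (η 0 - η₀ 0) := by
    have : (postcomp g η - postcomp g η₀) 0 = g (η 0) - g (η₀ 0) := by
      rw [← postcomp_apply_of_mem hO hg hη, ← postcomp_apply_of_mem hO hg hη₀]
      rfl
    rw [this]
    exact (bnd 0).2.1
  have hr' : P (η 0 - η₀ 0) + (eLpNorm (fun s => P (η.derivRep s - η₀.derivRep s)) p
      (volume.restrict (Icc 0 1))).toReal = r := by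
    rw [hr, ← lpDeriv_eq hP (η - η₀) md
      (isWeakPrimitiveOn_sub η.isWeakPrimitiveOn_extend η₀.isWeakPrimitiveOn_extend)]
    rfl
  calc acSeminorm q (postcomp g η - postcomp g η₀) ≤ r + r * C := by
        refine hle.trans ?_
        rw [one_mul, ← add_assoc, ← hr']
        gcongr
        · exact le_of_eq rfl
    _ ≤ r * (2 + C) := by linarith
    _ < ε := (lt_div_iff₀ (by positivity)).1 h2

/-- The superposition operator of a `C^3`-map has directional derivatives, given by the
superposition operator of the derivative. -/
theorem hasDirDeriv_postcomp (hO : IsOpen O) (hg : BastianiOn 3 g O) {dg : E × E → F}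
    (hdg : ∀ x ∈ O, ∀ y, HasDirDeriv g (dg (x, y)) x y) (hdg2 : BastianiOn 2 dg (O ×ˢ univ))
    {η : ACSpace p E} (hη : η ∈ valuesIn p O) (ξ : ACSpace p E) :
    HasDirDeriv (postcomp g) (postcomp dg (pair (η, ξ)) : ACSpace p F) η ξ := by
  have : Nonempty {q : Seminorm ℝ F // Continuous q} := ⟨⟨0, continuous_const⟩⟩
  have hg2 : BastianiOn 2 g O := hg.of_succ
  obtain ⟨d, hd⟩ := hg.exists_isDerivFamily hO
  obtain ⟨d', hd'⟩ := hdg2.exists_isDerivFamily (hO.prod isOpen_univ)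
  have hOO : IsOpen (O ×ˢ (univ : Set E)) := hO.prod isOpen_univ
  have hηξ : pair (η, ξ) ∈ valuesIn p (O ×ˢ (univ : Set E)) := fun t => ⟨hη t, trivial⟩
  have edg : ∀ x ∈ O, ∀ y, dg (x, y) = d 1 x ![y] := fun x hx y =>
    (hdg x hx y).unique (hd.hasDirDeriv_one hO (by norm_num) hx y)
  -- the derivative of `(x, y) ↦ dg (x, y)`
  have ed' : ∀ x ∈ O, ∀ y v w, d' 1 (x, y) ![(v, w)] = d 2 x ![y, v] + d 1 x ![w] := by
    intro x hx y v w
    have h1 := hd'.hasDirDeriv_one hOO (by norm_num) (x := (x, y)) ⟨hx, trivial⟩ (v, w)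
    have h2 := hd.hasDirDeriv_prod hO (j := 1) (by norm_num) hx ![y] v ![w]
    have e1 : (Fin.snoc ![y] v : Fin 2 → E) = ![y, v] := by
      funext i; fin_cases i <;> rfl
    have e2 : Function.update ![y] 0 w = ![w] := by
      funext i; fin_cases i; rfl
    simp only [Finset.univ_unique, Fin.default_eq_zero, Finset.sum_singleton, e1,
      Matrix.cons_val_zero, e2] at h2
    have h3 : HasDirDeriv (fun z : E × E => d 1 z.1 ![z.2]) (d 2 x ![y, v] + d 1 x ![w]) (x, y)
        (v, w) := by
      simpa [HasDirDeriv] using h2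
    exact h1.unique (h3.congr_of_isOpen hOO ⟨hx, trivial⟩ fun z hz => (edg z.1 hz.1 z.2).symm)
  refine ((withSeminorms (p := p) (E := F)).tendsto_nhds _ _).2 fun q ε hε => ?_
  obtain ⟨P, hP, hb⟩ := hd.exists_lipschitz_bound hO (by norm_num) η.isCompact_image_extend
    (image_extend_subset hη) q.2
  obtain ⟨Q, hQ, hb'⟩ := hd.exists_taylor_bound hO (by norm_num) η.isCompact_image_extend
    (image_extend_subset hη) q.2
  set M := acSeminorm ⟨P, hP⟩ ξ with hM
  set N := acSeminorm ⟨Q, hQ⟩ ξ with hN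
  have hM0 : 0 ≤ M := apply_nonneg _ _
  have hN0 : 0 ≤ N := apply_nonneg _ _
  have hPt : ∀ t, P (ξ t) ≤ M := fun t => ξ.seminorm_apply_le hP t
  have hQt : ∀ t, Q (ξ t) ≤ N := fun t => ξ.seminorm_apply_le hQ t
  set C := N ^ 2 * lpDeriv Q η + M * lpDeriv P ξ with hC
  have hlim : ∀ c : ℝ, Tendsto (fun h : ℝ => |h| * c) (𝓝[≠] 0) (𝓝 0) := fun c =>
    (Continuous.tendsto' (by fun_prop) 0 0 (by simp)).mono_left nhdsWithin_le_nhds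
  -- the value at `0` converges by the definition of the directional derivative
  have hval : ∀ᶠ h : ℝ in 𝓝[≠] 0,
      q.1 (h⁻¹ • (g (η 0 + h • ξ 0) - g (η 0)) - dg (η 0, ξ 0)) < ε / 2 := by
    have := (q.2.tendsto _).comp ((hdg (η 0) (hη 0) (ξ 0)).sub_const (dg (η 0, ξ 0)))
    rw [sub_self, map_zero] at this
    exact this.eventually (gt_mem_nhds (half_pos hε))
  filter_upwards [hval, (hlim M).eventually (gt_mem_nhds one_pos),
    (hlim N).eventually (gt_mem_nhds one_pos), (hlim C).eventually (gt_mem_nhds (half_pos hε)),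
    self_mem_nhdsWithin] with h h1 h2 h3 h4 h0
  have h0 : h ≠ 0 := h0
  have hPh : ∀ t, P (h • ξ t) ≤ |h| * M := fun t => by
    rw [map_smul_eq_mul, Real.norm_eq_abs]
    exact mul_le_mul_of_nonneg_left (hPt t) (abs_nonneg _)
  have hQh : ∀ t, Q (h • ξ t) ≤ |h| * N := fun t => by
    rw [map_smul_eq_mul, Real.norm_eq_abs]
    exact mul_le_mul_of_nonneg_left (hQt t) (abs_nonneg _)
  have bnd := fun t => hb (η t) (η.coe_mem_image_extend t) (η t + h • ξ t)
    (by rw [add_sub_cancel_left]; exact (hPh t).trans_lt h2)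
  have bnd' := fun t => (hb' (η t) (η.coe_mem_image_extend t) (h • ξ t) ((hQh t).trans_lt h3)).2
  have hηh : η + h • ξ ∈ valuesIn p O := fun t => (bnd t).1
  -- a derivative of the shifted function, in terms of the chosen derivatives of `η` and `ξ`
  have mh : MemLpLC p (fun s => η.derivRep s + h • ξ.derivRep s) (Icc 0 1) :=
    η.memLpLC_derivRep.add (ξ.memLpLC_derivRep.smul h)
  have wh : IsWeakPrimitiveOn (fun s => η.derivRep s + h • ξ.derivRep s)
      (η + h • ξ).extend 0 1 :=
    η.isWeakPrimitiveOn_extend.add (ξ.isWeakPrimitiveOn_extend.smul h)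
  have hmaps : MapsTo (η + h • ξ).extend (Icc 0 1) O := fun s _ => extend_mem hηh s
  have m1 := hd.memLpLC_comp hO (by norm_num) mh (wh.continuousOn mh) hmaps
  have w1 := hd.isWeakPrimitiveOn_comp hO (by norm_num) mh wh hmaps
  have m2 := memLpLC_postcomp hd hO (by norm_num) hη
  have w2 := isWeakPrimitiveOn_postcomp hd hO (by norm_num) hg2 hη
  have mp := η.memLpLC_derivRep.prodMk ξ.memLpLC_derivRep
  have wp : IsWeakPrimitiveOn _ (pair (η, ξ)).extend 0 1 :=
    η.isWeakPrimitiveOn_extend.prodMk ξ.isWeakPrimitiveOn_extend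
  have hmaps' : MapsTo (pair (η, ξ)).extend (Icc 0 1) (O ×ˢ univ) :=
    fun s _ => extend_mem hηξ s
  have m3 := hd'.memLpLC_comp hOO (by norm_num) mp (wp.continuousOn mp) hmaps'
  have w3 := hd'.isWeakPrimitiveOn_comp hOO (by norm_num) mp wp hmaps'
  rw [← extend_postcomp hO hg2 hηh] at w1
  rw [← extend_postcomp hOO hdg2 hηξ] at w3
  have hle := acSeminorm_le (h⁻¹ • (postcomp g (η + h • ξ) - postcomp g η) -
      postcomp dg (pair (η, ξ))) (memLpLC_sub ((memLpLC_sub m1 m2).smul h⁻¹) m3)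
    (isWeakPrimitiveOn_sub ((isWeakPrimitiveOn_sub w1 w2).smul h⁻¹) w3) q.2
    (c₁ := |h| * N ^ 2) (c₂ := |h| * M) (η.memLpLC_derivRep.memLp hQ)
    (ξ.memLpLC_derivRep.memLp hP) (by positivity) (by positivity) (fun s hs => by
      set t : unitInterval := ⟨s, hs⟩ with ht
      have e : η.extend s = η t := η.extend_coe t
      have eh : (η + h • ξ).extend s = η t + h • ξ t := (η + h • ξ).extend_coe t
      have ep : (pair (η, ξ)).extend s = (η t, ξ t) := (pair (η, ξ)).extend_coe t
      have hz := (bnd t).1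
      -- the symmetry of `d 2` is needed to recognize the Taylor remainder of `d 1` at `η t`
      have key : h⁻¹ • (d 1 (η t + h • ξ t) ![η.derivRep s + h • ξ.derivRep s] -
            d 1 (η t) ![η.derivRep s]) -
            (d 2 (η t) ![ξ t, η.derivRep s] + d 1 (η t) ![ξ.derivRep s]) =
          h⁻¹ • (d 1 (η t + h • ξ t) ![η.derivRep s] - d 1 (η t) ![η.derivRep s] -
            d 2 (η t) ![η.derivRep s, h • ξ t]) +
          (d 1 (η t + h • ξ t) ![ξ.derivRep s] - d 1 (η t) ![ξ.derivRep s]) := by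
        rw [hd.map_add_one hO (by norm_num) hz, hd.map_smul_one hO (by norm_num) hz,
          hd.map_smul_two (by norm_num) (hη t), hd.symm_two hO (by norm_num) (hη t) (ξ t)]
        simp only [smul_sub, smul_add, inv_smul_smul₀ h0]
        abel
      have a1 := bnd' t (η.derivRep s)
      have a2 := ((bnd t).2.2 (ξ.derivRep s)).2
      rw [add_sub_cancel_left] at a2
      simp only [Pi.smul_apply, e, eh, ep]
      rw [ed' _ (hη t), key]
      refine (map_add_le_add q.1 _ _).trans (add_le_add ?_ (a2.trans ?_))
      · rw [map_smul_eq_mul, norm_inv, Real.norm_eq_abs, inv_mul_le_iff₀ (abs_pos.2 h0)]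
        refine a1.trans ?_
        have := pow_le_pow_left₀ (apply_nonneg Q _) (hQh t) 2
        calc Q (η.derivRep s) * Q (h • ξ t) ^ 2 ≤ Q (η.derivRep s) * (|h| * N) ^ 2 :=
              mul_le_mul_of_nonneg_left this (apply_nonneg _ _)
          _ = _ := by ring
      · rw [mul_comm]
        exact mul_le_mul_of_nonneg_right (hPh t) (apply_nonneg _ _))
  have hv : (h⁻¹ • (postcomp g (η + h • ξ) - postcomp g η) - postcomp dg (pair (η, ξ)) :
      ACSpace p F) 0 = h⁻¹ • (g (η 0 + h • ξ 0) - g (η 0)) - dg (η 0, ξ 0) := by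
    have i1 := postcomp_apply_of_mem hO hg2 hηh 0
    have i2 := postcomp_apply_of_mem hO hg2 hη 0
    have i3 := postcomp_apply_of_mem hOO hdg2 hηξ 0
    change h⁻¹ • (postcomp g (η + h • ξ) 0 - postcomp g η 0) - postcomp dg (pair (η, ξ)) 0 = _
    rw [i1, i2, i3]
    rfl
  rw [hv] at hle
  refine hle.trans_lt ?_
  have : |h| * N ^ 2 * lpDeriv Q η + |h| * M * lpDeriv P ξ = |h| * C := by
    rw [hC]; ring
  have hsum := add_lt_add h1 (this.trans_lt h4)
  rw [add_halves] at hsum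
  exact hsum

/-- Superposition operators of `C^(n+2)`-maps are `C^n`. -/
theorem bastianiOn_postcomp : ∀ (n : ℕ) {E : Type*} [AddCommGroup E] [Module ℝ E]
    [TopologicalSpace E] [IsTopologicalAddGroup E] [ContinuousSMul ℝ E] [LocallyConvexSpace ℝ E]
    {g : E → F} {O : Set E}, IsOpen O → BastianiOn (n + 2) g O →
      BastianiOn n (postcomp g : ACSpace p E → ACSpace p F) (valuesIn p O)
  | 0, _, _, _, _, _, _, _, _, _, hO, hg => continuousOn_postcomp hO hg
  | n + 1, _, _, _, _, _, _, _, g, O, hO, hg => by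
    have hg3 : BastianiOn 3 g O := hg.of_le (by omega)
    obtain ⟨hc, dg, hdg, hdg2⟩ := hg
    refine ⟨continuousOn_postcomp hO hg3.of_succ, fun z => postcomp dg (pair z), fun η hη ξ =>
      hasDirDeriv_postcomp hO hg3 hdg (hdg2.of_le (by omega)) hη ξ, ?_⟩
    exact ((bastianiOn_postcomp n (hO.prod isOpen_univ) hdg2).comp_clm pair).mono
      fun z hz t => ⟨hz.1 t, trivial⟩

end Superposition

end ACSpace

/-! ### Differentiable maps from locally convex spaces to Lie groups -/

section Into

variable (E : Type*) [AddCommGroup E] [Module ℝ E] [TopologicalSpace E]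
  {G : Type*} [TopologicalSpace G] [ChartedSpace E G]

/-- `u : X → G` is `C^n` on the subset `O` of a locally convex space `X`, as seen in the charts of
the given atlas of `G`. -/
def BastianiInto {X : Type*} [AddCommGroup X] [Module ℝ X] [TopologicalSpace X] (n : ℕ)
    (u : X → G) (O : Set X) : Prop :=
  ContinuousOn u O ∧ ∀ φ ∈ atlas E G, BastianiOn n (fun x => φ (u x)) (O ∩ u ⁻¹' φ.source)

variable {E} [IsTopologicalAddGroup E] [ContinuousSMul ℝ E] [LocallyConvexSpace ℝ E] [T2Space E]
  {F : Type*} [AddCommGroup F] [Module ℝ F] [TopologicalSpace F]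
  [IsTopologicalAddGroup F] [ContinuousSMul ℝ F] [LocallyConvexSpace ℝ F] [T2Space F]
  {H : Type*} [TopologicalSpace H] [ChartedSpace F H]
  {X : Type*} [AddCommGroup X] [Module ℝ X] [TopologicalSpace X]
  [IsTopologicalAddGroup X] [ContinuousSMul ℝ X]
  {Y : Type*} [AddCommGroup Y] [Module ℝ Y] [TopologicalSpace Y]
  [IsTopologicalAddGroup Y] [ContinuousSMul ℝ Y] {n : ℕ}

theorem BastianiInto.comp_clm {u : X → G} {O : Set X} (hu : BastianiInto E n u O) (A : Y →L[ℝ] X) :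
    BastianiInto E n (fun y => u (A y)) (A ⁻¹' O) :=
  ⟨hu.1.comp A.continuous.continuousOn fun _ hy => hy, fun φ hφ => (hu.2 φ hφ).comp_clm A⟩

theorem BastianiInto.mono {u : X → G} {O O' : Set X} (hu : BastianiInto E n u O) (h : O' ⊆ O) :
    BastianiInto E n u O' :=
  ⟨hu.1.mono h, fun φ hφ => (hu.2 φ hφ).mono (inter_subset_inter_left _ h)⟩

theorem bastianiInto_symm {κ : OpenPartialHomeomorph G E} (hκ : κ ∈ lcCharts E G) :
    BastianiInto E n κ.symm κ.target :=
  ⟨κ.continuousOn_symm, fun φ hφ => (hκ φ hφ).1.bastianiOn le_top⟩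

/-- The maximal atlas may be used in place of the given one. -/
theorem BastianiInto.bastianiOn {u : X → G} {O : Set X} (hu : BastianiInto E n u O)
    (hO : IsOpen O) {φ : OpenPartialHomeomorph G E} (hφ : φ ∈ lcCharts E G) :
    BastianiOn n (fun x => φ (u x)) (O ∩ u ⁻¹' φ.source) := by
  refine BastianiOn.of_locally fun x hx => ?_
  let ψ := chartAt E (u x)
  have hψ : ψ ∈ atlas E G := chart_mem_atlas E (u x)
  have hV : IsOpen ((O ∩ u ⁻¹' φ.source) ∩ (O ∩ u ⁻¹' ψ.source)) :=
    (hu.1.isOpen_inter_preimage hO φ.open_source).inter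
      (hu.1.isOpen_inter_preimage hO ψ.open_source)
  refine ⟨_, hV, ⟨hx, hx.1, mem_chart_source E (u x)⟩, inter_subset_left, ?_⟩
  have h1 := (hφ ψ hψ).2
  have h2 := BastianiOn.comp h1.1 (h1.bastianiOn (n := n) le_top)
    ((hu.2 ψ hψ).mono (inter_subset_right (s := O ∩ u ⁻¹' φ.source)))
    fun z hz => ⟨ψ.map_source hz.2.2, by
      rw [ψ.left_inv hz.2.2]
      exact hz.1.2⟩
  exact h2.congr hV fun z hz => by
    change φ (ψ.symm (ψ (u z))) = φ (u z)
    rw [ψ.left_inv hz.2.2]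

theorem mem_lcCharts_of_mem_atlas [Group G] [LieGroupLC E G] {φ : OpenPartialHomeomorph G E}
    (hφ : φ ∈ atlas E G) : φ ∈ lcCharts E G := fun ψ hψ =>
  ⟨LieGroupLC.smooth_transition φ hφ ψ hψ, LieGroupLC.smooth_transition ψ hψ φ hφ⟩

theorem BastianiInto.mul [Group G] [LieGroupLC E G] {u v : X → G} {O : Set X} (hO : IsOpen O)
    (hu : BastianiInto E n u O) (hv : BastianiInto E n v O) :
    BastianiInto E n (fun x => u x * v x) O := by
  have := LieGroupLC.isTopologicalGroup E (G := G)
  have hc : ContinuousOn (fun x => u x * v x) O := hu.1.mul hv.1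
  refine ⟨hc, fun ψ hψ => BastianiOn.of_locally fun x hx => ?_⟩
  let φ := chartAt E (u x)
  let φ' := chartAt E (v x)
  have hφ : φ ∈ atlas E G := chart_mem_atlas E (u x)
  have hφ' : φ' ∈ atlas E G := chart_mem_atlas E (v x)
  have hV : IsOpen ((O ∩ (fun x => u x * v x) ⁻¹' ψ.source) ∩
      ((O ∩ u ⁻¹' φ.source) ∩ (O ∩ v ⁻¹' φ'.source))) :=
    (hc.isOpen_inter_preimage hO ψ.open_source).inter
      ((hu.1.isOpen_inter_preimage hO φ.open_source).inter
        (hv.1.isOpen_inter_preimage hO φ'.open_source))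
  refine ⟨_, hV, ⟨hx, ⟨hx.1, mem_chart_source E (u x)⟩, hx.1, mem_chart_source E (v x)⟩,
    inter_subset_left, ?_⟩
  have h1 := LieGroupLC.smooth_mul φ hφ φ' hφ' ψ hψ
  have h2 := BastianiOn.comp h1.1 (h1.bastianiOn (n := n) le_top)
    (((hu.2 φ hφ).mono (V := (O ∩ (fun x => u x * v x) ⁻¹' ψ.source) ∩
      ((O ∩ u ⁻¹' φ.source) ∩ (O ∩ v ⁻¹' φ'.source))) fun z hz => hz.2.1).prodMk
      ((hv.2 φ' hφ').mono fun z hz => hz.2.2))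
    fun z hz => ⟨φ.map_source hz.2.1.2, φ'.map_source hz.2.2.2, by
      change φ.symm (φ (u z)) * φ'.symm (φ' (v z)) ∈ ψ.source
      rw [φ.left_inv hz.2.1.2, φ'.left_inv hz.2.2.2]
      exact hz.1.2⟩
  exact h2.congr hV fun z hz => by
    change ψ (φ.symm (φ (u z)) * φ'.symm (φ' (v z))) = _
    rw [φ.left_inv hz.2.1.2, φ'.left_inv hz.2.2.2]

theorem BastianiInto.inv [Group G] [LieGroupLC E G] {u : X → G} {O : Set X} (hO : IsOpen O)
    (hu : BastianiInto E n u O) : BastianiInto E n (fun x => (u x)⁻¹) O := by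
  have := LieGroupLC.isTopologicalGroup E (G := G)
  have hc : ContinuousOn (fun x => (u x)⁻¹) O := hu.1.inv
  refine ⟨hc, fun ψ hψ => BastianiOn.of_locally fun x hx => ?_⟩
  let φ := chartAt E (u x)
  have hφ : φ ∈ atlas E G := chart_mem_atlas E (u x)
  have hV : IsOpen ((O ∩ (fun x => (u x)⁻¹) ⁻¹' ψ.source) ∩ (O ∩ u ⁻¹' φ.source)) :=
    (hc.isOpen_inter_preimage hO ψ.open_source).inter
      (hu.1.isOpen_inter_preimage hO φ.open_source)
  refine ⟨_, hV, ⟨hx, hx.1, mem_chart_source E (u x)⟩, inter_subset_left, ?_⟩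
  have h1 := LieGroupLC.smooth_inv φ hφ ψ hψ
  have h2 := BastianiOn.comp h1.1 (h1.bastianiOn (n := n) le_top)
    ((hu.2 φ hφ).mono (inter_subset_right (s := O ∩ (fun x => (u x)⁻¹) ⁻¹' ψ.source)))
    fun z hz => ⟨φ.map_source hz.2.2, by
      rw [φ.left_inv hz.2.2]
      exact hz.1.2⟩
  exact h2.congr hV fun z hz => by
    change ψ (φ.symm (φ (u z)))⁻¹ = _
    rw [φ.left_inv hz.2.2]

theorem ContDiffInCharts.contDiffLC {k : ℕ∞} {f : G → H}
    (hf : ContDiffInCharts k (lcChartsPE E G) (lcChartsPE F H) f)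
    {φ : OpenPartialHomeomorph G E} (hφ : φ ∈ lcCharts E G)
    {ψ : OpenPartialHomeomorph H F} (hψ : ψ ∈ lcCharts F H) :
    ContDiffLC k (fun x => ψ (f (φ.symm x))) {x | x ∈ φ.target ∧ f (φ.symm x) ∈ ψ.source} :=
  hf.2 _ (mem_image_of_mem _ hφ) _ (mem_image_of_mem _ hψ)

theorem BastianiInto.comp_contDiff [Group G] [LieGroupLC E G] [Group H] [LieGroupLC F H] {k : ℕ∞}
    {f : G → H} (hf : ContDiffInCharts k (lcChartsPE E G) (lcChartsPE F H) f)
    (hn : (n : ℕ∞) ≤ k) {u : X → G} {O : Set X} (hO : IsOpen O) (hu : BastianiInto E n u O) :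
    BastianiInto F n (fun x => f (u x)) O := by
  have hc : ContinuousOn (fun x => f (u x)) O := hf.1.comp_continuousOn hu.1
  refine ⟨hc, fun ψ hψ => BastianiOn.of_locally fun x hx => ?_⟩
  let φ := chartAt E (u x)
  have hφ : φ ∈ atlas E G := chart_mem_atlas E (u x)
  have hV : IsOpen ((O ∩ (fun x => f (u x)) ⁻¹' ψ.source) ∩ (O ∩ u ⁻¹' φ.source)) :=
    (hc.isOpen_inter_preimage hO ψ.open_source).inter
      (hu.1.isOpen_inter_preimage hO φ.open_source)
  refine ⟨_, hV, ⟨hx, hx.1, mem_chart_source E (u x)⟩, inter_subset_left, ?_⟩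
  have h1 := hf.contDiffLC (mem_lcCharts_of_mem_atlas hφ) (mem_lcCharts_of_mem_atlas hψ)
  have h2 := BastianiOn.comp h1.1 (h1.bastianiOn (n := n) hn)
    ((hu.2 φ hφ).mono (inter_subset_right (s := O ∩ (fun x => f (u x)) ⁻¹' ψ.source)))
    fun z hz => ⟨φ.map_source hz.2.2, by
      rw [φ.left_inv hz.2.2]
      exact hz.1.2⟩
  exact h2.congr hV fun z hz => by
    change ψ (f (φ.symm (φ (u z)))) = _
    rw [φ.left_inv hz.2.2]

end Into

/-! ### Absolutely continuous maps to Lie groups -/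

section Partition

/-- The `j`-th point of the partition of `[0,1]` into `n` intervals of equal length. -/
noncomputable def partitionPoint (n j : ℕ) : unitInterval :=
  projIcc (0 : ℝ) 1 zero_le_one (j / n)

theorem monotone_partitionPoint (n : ℕ) : Monotone (partitionPoint n) := fun i j hij =>
  monotone_projIcc _ (by gcongr)

theorem partitionPoint_zero (n : ℕ) : partitionPoint n 0 = 0 := by
  simp [partitionPoint]

theorem coe_partitionPoint {n j : ℕ} (hj : j ≤ n) : (partitionPoint n j : ℝ) = j / n := by
  have : (j : ℝ) / n ∈ Icc (0 : ℝ) 1 :=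
    ⟨by positivity, div_le_one_of_le₀ (by exact_mod_cast hj) (by positivity)⟩
  rw [partitionPoint, projIcc_of_mem _ this]

theorem partitionPoint_self {n : ℕ} (hn : 0 < n) : partitionPoint n n = 1 := by
  have : (n : ℝ) ≠ 0 := by positivity
  apply Subtype.ext
  rw [coe_partitionPoint le_rfl, div_self this]
  rfl

/-- By compactness, an assignment of a neighbourhood to each point of `[0,1]` admits a partition
each of whose intervals lies in one of the neighbourhoods. -/
theorem exists_partition {P : unitInterval → Set unitInterval} (hP : ∀ s, P s ∈ 𝓝 s) :
    ∃ n, 0 < n ∧ ∀ j < n, ∃ s, Icc (partitionPoint n j) (partitionPoint n (j + 1)) ⊆ P s := by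
  obtain ⟨δ, hδ, H⟩ := lebesgue_number_lemma_of_metric (isCompact_univ (X := unitInterval))
    (c := fun s => interior (P s)) (fun _ => isOpen_interior)
    fun s _ => mem_iUnion.2 ⟨s, mem_interior_iff_mem_nhds.2 (hP s)⟩
  obtain ⟨n, hn⟩ := exists_nat_one_div_lt hδ
  refine ⟨n + 1, n.succ_pos, fun j hj => ?_⟩
  obtain ⟨s, hs⟩ := H (partitionPoint (n + 1) j) trivial
  refine ⟨s, fun r hr => interior_subset (hs ?_)⟩
  rw [Metric.mem_ball, Subtype.dist_eq, Real.dist_eq,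
    abs_of_nonneg (sub_nonneg.2 (Subtype.coe_le_coe.2 hr.1))]
  have h1 : (r : ℝ) ≤ partitionPoint (n + 1) (j + 1) := hr.2
  rw [coe_partitionPoint (by omega)] at h1 ⊢
  have h2 : ((j + 1 : ℕ) : ℝ) / (n + 1 : ℕ) = j / (n + 1 : ℕ) + 1 / ((n : ℝ) + 1) := by
    push_cast
    rw [add_div]
  linarith

end Partition

section ACMaps

variable (p : ℝ≥0∞) [Fact (1 ≤ p)]
  (E : Type*) [AddCommGroup E] [Module ℝ E] [TopologicalSpace E]
  [IsTopologicalAddGroup E] [ContinuousSMul ℝ E] [LocallyConvexSpace ℝ E] [T2Space E]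
  {G : Type*} [TopologicalSpace G] [ChartedSpace E G]

/-- `η` is absolutely continuous between `a` and `b` in a sense that does not depend on the choice
of charts: on every subinterval that `η` maps to the domain of a chart, it is absolutely continuous
in this chart. -/
def IsACBetween (η : unitInterval → G) (a b : unitInterval) : Prop :=
  ∀ ψ ∈ lcCharts E G, ∀ c d : unitInterval, a ≤ c → c ≤ d → d ≤ b → MapsTo η (Icc c d) ψ.source →
    (fun t => ψ (η (retractIcc c d t))) ∈ acSubmodule p E

variable {p E}

/-- A `C^2`-map from a locally convex space takes absolutely continuous functions to maps that are
absolutely continuous in all charts. -/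
theorem isACBetween_of_comp {X : Type*} [AddCommGroup X] [Module ℝ X] [TopologicalSpace X]
    [IsTopologicalAddGroup X] [ContinuousSMul ℝ X] [LocallyConvexSpace ℝ X]
    {u : X → G} {O : Set X} (hO : IsOpen O) (hu : BastianiInto E 2 u O) {x : unitInterval → X}
    (hx : x ∈ acSubmodule p X) {η : unitInterval → G} {a b : unitInterval}
    (h : ∀ t ∈ Icc a b, x t ∈ O ∧ u (x t) = η t) : IsACBetween p E η a b := by
  intro ψ hψ c d hac hcd hdb hm
  have ht : ∀ t, retractIcc c d t ∈ Icc a b := fun t =>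
    ⟨hac.trans (retractIcc_mem hcd t).1, (retractIcc_mem hcd t).2.trans hdb⟩
  have := comp_mem_acSubmodule (hu.1.isOpen_inter_preimage hO ψ.open_source) (hu.bastianiOn hO hψ)
    (comp_retractIcc_mem_acSubmodule hx hcd) fun t => ⟨(h _ (ht t)).1, by
      change u (x (retractIcc c d t)) ∈ ψ.source
      rw [(h _ (ht t)).2]
      exact hm (retractIcc_mem hcd t)⟩
  simpa only [(h _ (ht _)).2] using this

theorem mem_acSubmodule_of_partition {F : Type*} [AddCommGroup F] [Module ℝ F] [TopologicalSpace F]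
    [IsTopologicalAddGroup F] [ContinuousSMul ℝ F] {t : ℕ → unitInterval} (ht : Monotone t)
    (h0 : t 0 = 0) {n : ℕ} (hn : t n = 1) {x : unitInterval → F}
    (h : ∀ j < n, (fun s => x (retractIcc (t j) (t (j + 1)) s)) ∈ acSubmodule p F) :
    x ∈ acSubmodule p F := by
  have e : x = (fun _ => x 0) + ∑ j ∈ Finset.range n,
      ((fun s => x (retractIcc (t j) (t (j + 1)) s)) -
        fun _ => x (retractIcc (t j) (t (j + 1)) 0)) := by
    funext s
    rw [Pi.add_apply, Finset.sum_apply]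
    exact (sum_comp_retractIcc_sub t ht h0 hn x s).symm
  rw [e]
  exact add_mem (const_mem_acSubmodule _) (sum_mem fun j hj =>
    sub_mem (h j (Finset.mem_range.1 hj)) (const_mem_acSubmodule _))

/-- Absolute continuity on the intervals of a partition implies absolute continuity on `[0,1]`. -/
theorem isACBetween_of_partition {t : ℕ → unitInterval} (ht : Monotone t)
    (h0 : t 0 = 0) {n : ℕ} (hn : t n = 1) {η : unitInterval → G}
    (h : ∀ j < n, IsACBetween p E η (t j) (t (j + 1))) : IsACBetween p E η 0 1 := by
  intro ψ hψ c d _ hcd _ hm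
  refine mem_acSubmodule_of_partition ht h0 hn fun j hj => ?_
  have htj := ht j.le_succ
  by_cases hi : max c (t j) ≤ min d (t (j + 1))
  · have hcj : c ≤ t (j + 1) := (le_max_left _ _).trans (hi.trans (min_le_right _ _))
    have hjd : t j ≤ d := (le_max_right _ _).trans (hi.trans (min_le_left _ _))
    have := h j hj ψ hψ (max c (t j)) (min d (t (j + 1))) (le_max_right _ _) hi (min_le_right _ _)
      (hm.mono_left (Icc_subset_Icc (le_max_left _ _) (min_le_left _ _)))
    convert this using 4 with s
    simp only [retractIcc]
    rcases le_total s d with h1 | h1 <;> rcases le_total s (t (j + 1)) with h2 | h2 <;>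
      grind
  · -- the retractions onto disjoint intervals compose to a constant
    have hconst : ∃ e, ∀ s, retractIcc c d (retractIcc (t j) (t (j + 1)) s) = e := by
      rw [not_le, lt_max_iff, min_lt_iff, min_lt_iff] at hi
      rcases hi with (hi | hi) | (hi | hi)
      · exact absurd hcd (not_le.2 hi)
      · refine ⟨c, fun s => ?_⟩
        have := (retractIcc_mem htj s).2.trans hi.le
        rw [retractIcc, min_eq_left (this.trans hcd), max_eq_left this]
      · refine ⟨d, fun s => ?_⟩
        have := hi.le.trans (retractIcc_mem htj s).1
        rw [retractIcc, min_eq_right this, max_eq_right hcd]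
      · exact absurd htj (not_le.2 hi)
    obtain ⟨e, he⟩ := hconst
    simp only [he]
    exact const_mem_acSubmodule _

/-- Absolute continuity does not depend on the choice of charts, as changes of charts are smooth. -/
theorem IsACMap.isACBetween {η : unitInterval → G} (h : IsACMap p E η) :
    IsACBetween p E η 0 1 := by
  obtain ⟨-, n, t, htm, h0, hn, H⟩ := h
  have hI : ∀ i, t i ∈ Icc (0 : ℝ) 1 := fun i =>
    ⟨h0 ▸ htm.monotone (Fin.zero_le i), hn ▸ htm.monotone (Fin.le_last i)⟩
  let T : ℕ → unitInterval := fun j => ⟨t (Fin.ofNat (n + 1) (min j n)), hI _⟩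
  have hT : ∀ j (hj : j ≤ n), T j = ⟨t ⟨j, Nat.lt_succ_of_le hj⟩, hI _⟩ := by
    intro j hj
    apply Subtype.ext
    change t _ = t _
    congr 1
    apply Fin.ext
    simp only [Fin.ofNat, min_eq_left hj]
    exact Nat.mod_eq_of_lt (Nat.lt_succ_of_le hj)
  have hmono : Monotone T := by
    intro i j hij
    refine Subtype.coe_le_coe.1 (htm.monotone ?_)
    rw [Fin.le_def]
    simp only [Fin.ofNat]
    rw [Nat.mod_eq_of_lt (by omega), Nat.mod_eq_of_lt (by omega)]
    omega
  refine isACBetween_of_partition hmono (n := n) ?_ ?_ fun j hj => ?_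
  · rw [hT 0 n.zero_le]; exact Subtype.ext h0
  · rw [hT n le_rfl]; exact Subtype.ext hn
  · obtain ⟨φ, hφ, hm, hAC⟩ := H ⟨j, hj⟩
    have e1 : ((T j : unitInterval) : ℝ) = t (Fin.castSucc ⟨j, hj⟩) := by
      rw [hT j hj.le]; rfl
    have e2 : ((T (j + 1) : unitInterval) : ℝ) = t (Fin.succ ⟨j, hj⟩) := by
      rw [hT (j + 1) hj]; rfl
    rw [← e1, ← e2] at hm hAC
    have hφη := (comp_retractIcc_mem_acSubmodule_iff (x := fun s => φ (η s))
      (hmono j.le_succ)).2 hAC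
    have hsrc : ∀ s ∈ Icc (T j) (T (j + 1)), η s ∈ φ.source := fun s hs => by
      have := hm (show (s : ℝ) ∈ Icc (T j : ℝ) (T (j + 1)) from hs)
      rwa [IccExtend_val] at this
    refine isACBetween_of_comp φ.open_target (bastianiInto_symm hφ) hφη fun s hs => ?_
    rw [retractIcc_eq_self hs]
    exact ⟨φ.map_source (hsrc s hs), φ.left_inv (hsrc s hs)⟩

variable [Group G] [LieGroupLC E G]

/-- Locally absolutely continuous maps are absolutely continuous: by compactness, `[0,1]` is
a finite union of intervals that are mapped to chart domains. -/
theorem IsACBetween.isACMap {η : unitInterval → G} (hη : Continuous η)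
    (h : IsACBetween p E η 0 1) : IsACMap p E η := by
  obtain ⟨n, hn, H⟩ := exists_partition (P := fun s => η ⁻¹' (chartAt E (η s)).source) fun s =>
    hη.continuousAt.preimage_mem_nhds (chart_source_mem_nhds E (η s))
  have hn' : (0 : ℝ) < n := by exact_mod_cast hn
  refine ⟨hη, n, fun j => (j : ℝ) / n, fun i j hij => ?_, by simp, ?_, fun j => ?_⟩
  · exact div_lt_div_of_pos_right (by exact_mod_cast hij) hn'
  · simp [hn'.ne']
  · obtain ⟨s, hs⟩ := H j j.2
    have hφ : chartAt E (η s) ∈ lcCharts E G := mem_lcCharts_of_mem_atlas (chart_mem_atlas E _)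
    have hj := monotone_partitionPoint n (j : ℕ).le_succ
    have hAC := (comp_retractIcc_mem_acSubmodule_iff (x := fun t => chartAt E (η s) (η t)) hj).1
      (h _ hφ _ _ unitInterval.nonneg' hj unitInterval.le_one' hs)
    rw [coe_partitionPoint j.2.le, coe_partitionPoint j.2] at hAC
    simp only [Fin.val_castSucc, Fin.val_succ]
    refine ⟨chartAt E (η s), hφ, fun r hr => hs ?_, hAC⟩
    rw [← coe_partitionPoint j.2.le, ← coe_partitionPoint j.2] at hr
    have hr' : r ∈ Icc (0 : ℝ) 1 :=
      ⟨(partitionPoint n j).2.1.trans hr.1, hr.2.trans (partitionPoint n (j + 1)).2.2⟩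
    rw [projIcc_of_mem _ hr']
    exact hr

theorem IsACMap.mem_acSubmodule {η : unitInterval → G} (h : IsACMap p E η)
    {ψ : OpenPartialHomeomorph G E} (hψ : ψ ∈ lcCharts E G) (hs : ∀ t, η t ∈ ψ.source) :
    (fun t => ψ (η t)) ∈ acSubmodule p E := by
  have := h.isACBetween ψ hψ 0 1 le_rfl zero_le_one le_rfl fun t _ => hs t
  have e : ∀ t, retractIcc 0 1 t = t := fun t =>
    retractIcc_eq_self ⟨unitInterval.nonneg', unitInterval.le_one'⟩
  simpa only [e] using this

theorem IsACMap.chart_symm {φ : OpenPartialHomeomorph G E} (hφ : φ ∈ lcCharts E G)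
    {x : unitInterval → E} (hx : x ∈ acSubmodule p E) (hxφ : ∀ t, x t ∈ φ.target) :
    IsACMap p E (fun t => φ.symm (x t)) :=
  IsACBetween.isACMap (φ.continuousOn_symm.comp_continuous (continuous_of_mem_acSubmodule hx) hxφ)
    (isACBetween_of_comp φ.open_target (bastianiInto_symm hφ) hx fun t _ => ⟨hxφ t, rfl⟩)

/-- A common partition for two continuous maps to manifolds, on whose intervals both take values in
chart domains. -/
theorem exists_partition_chartAt {F H : Type*} [TopologicalSpace F] [TopologicalSpace H]
    [ChartedSpace F H] {η : unitInterval → G} (hη : Continuous η) {ξ : unitInterval → H}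
    (hξ : Continuous ξ) : ∃ n, 0 < n ∧ ∃ s : ℕ → unitInterval, ∀ j < n,
      MapsTo η (Icc (partitionPoint n j) (partitionPoint n (j + 1))) (chartAt E (η (s j))).source ∧
      MapsTo ξ (Icc (partitionPoint n j) (partitionPoint n (j + 1)))
        (chartAt F (ξ (s j))).source := by
  obtain ⟨n, hn, H⟩ := exists_partition
    (P := fun s => η ⁻¹' (chartAt E (η s)).source ∩ ξ ⁻¹' (chartAt F (ξ s)).source) fun s =>
    inter_mem (hη.continuousAt.preimage_mem_nhds (chart_source_mem_nhds E (η s)))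
      (hξ.continuousAt.preimage_mem_nhds (chart_source_mem_nhds F (ξ s)))
  choose! s hs using H
  exact ⟨n, hn, s, fun j hj => ⟨fun t ht => (hs j hj ht).1, fun t ht => (hs j hj ht).2⟩⟩

theorem IsACMap.mul {η ξ : unitInterval → G} (hη : IsACMap p E η) (hξ : IsACMap p E ξ) :
    IsACMap p E (fun t => η t * ξ t) := by
  have := LieGroupLC.isTopologicalGroup E (G := G)
  obtain ⟨n, hn, s, hs⟩ := exists_partition_chartAt (E := E) (F := E) hη.1 hξ.1
  refine IsACBetween.isACMap (hη.1.mul hξ.1) (isACBetween_of_partition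
    (monotone_partitionPoint n) (partitionPoint_zero n) (partitionPoint_self hn) fun j hj => ?_)
  have hj' := monotone_partitionPoint n j.le_succ
  have hκ : chartAt E (η (s j)) ∈ lcCharts E G := mem_lcCharts_of_mem_atlas (chart_mem_atlas E _)
  have hl : chartAt E (ξ (s j)) ∈ lcCharts E G := mem_lcCharts_of_mem_atlas (chart_mem_atlas E _)
  obtain ⟨h1, h2⟩ := hs j hj
  set κ := chartAt E (η (s j))
  set l := chartAt E (ξ (s j))
  have hO : IsOpen (κ.target ×ˢ l.target) := κ.open_target.prod l.open_target
  have hu : BastianiInto E 2 (fun z : E × E => κ.symm z.1 * l.symm z.2) (κ.target ×ˢ l.target) :=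
    (((bastianiInto_symm hκ).comp_clm (ContinuousLinearMap.fst ℝ E E)).mono fun z hz => hz.1).mul hO
      (((bastianiInto_symm hl).comp_clm (ContinuousLinearMap.snd ℝ E E)).mono fun z hz => hz.2)
  refine isACBetween_of_comp hO hu (prodMk_mem_acSubmodule
    (hη.isACBetween κ hκ _ _ unitInterval.nonneg' hj' unitInterval.le_one' h1)
    (hξ.isACBetween l hl _ _ unitInterval.nonneg' hj' unitInterval.le_one' h2)) fun t ht => ?_
  simp only [Nat.succ_eq_add_one, retractIcc_eq_self ht]
  exact ⟨⟨κ.map_source (h1 ht), l.map_source (h2 ht)⟩, by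
    rw [κ.left_inv (h1 ht), l.left_inv (h2 ht)]⟩

theorem IsACMap.inv {η : unitInterval → G} (hη : IsACMap p E η) :
    IsACMap p E (fun t => (η t)⁻¹) := by
  have := LieGroupLC.isTopologicalGroup E (G := G)
  obtain ⟨n, hn, s, hs⟩ := exists_partition_chartAt (E := E) (F := E) hη.1 hη.1
  refine IsACBetween.isACMap hη.1.inv (isACBetween_of_partition
    (monotone_partitionPoint n) (partitionPoint_zero n) (partitionPoint_self hn) fun j hj => ?_)
  have hj' := monotone_partitionPoint n j.le_succ
  have hκ : chartAt E (η (s j)) ∈ lcCharts E G := mem_lcCharts_of_mem_atlas (chart_mem_atlas E _)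
  have h1 := (hs j hj).1
  set κ := chartAt E (η (s j))
  refine isACBetween_of_comp κ.open_target ((bastianiInto_symm hκ).inv κ.open_target)
    (hη.isACBetween κ hκ _ _ unitInterval.nonneg' hj' unitInterval.le_one' h1) fun t ht => ?_
  simp only [Nat.succ_eq_add_one, retractIcc_eq_self ht]
  exact ⟨κ.map_source (h1 ht), by rw [κ.left_inv (h1 ht)]⟩

variable {F : Type*} [AddCommGroup F] [Module ℝ F] [TopologicalSpace F]
  [IsTopologicalAddGroup F] [ContinuousSMul ℝ F] [LocallyConvexSpace ℝ F] [T2Space F]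
  {H : Type*} [TopologicalSpace H] [ChartedSpace F H] [Group H] [LieGroupLC F H]

theorem IsACMap.comp_contDiff {k : ℕ∞} {f : G → H}
    (hf : ContDiffInCharts k (lcChartsPE E G) (lcChartsPE F H) f) (hk : 2 ≤ k)
    {η : unitInterval → G} (hη : IsACMap p E η) : IsACMap p F (fun t => f (η t)) := by
  obtain ⟨n, hn, s, hs⟩ := exists_partition_chartAt (E := E) (F := E) hη.1 hη.1
  refine IsACBetween.isACMap (hf.1.comp hη.1) (isACBetween_of_partition
    (monotone_partitionPoint n) (partitionPoint_zero n) (partitionPoint_self hn) fun j hj => ?_)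
  have hj' := monotone_partitionPoint n j.le_succ
  have hκ : chartAt E (η (s j)) ∈ lcCharts E G := mem_lcCharts_of_mem_atlas (chart_mem_atlas E _)
  have h1 := (hs j hj).1
  set κ := chartAt E (η (s j))
  refine isACBetween_of_comp κ.open_target
    ((bastianiInto_symm hκ).comp_contDiff hf (by exact_mod_cast hk) κ.open_target)
    (hη.isACBetween κ hκ _ _ unitInterval.nonneg' hj' unitInterval.le_one' h1) fun t ht => ?_
  simp only [Nat.succ_eq_add_one, retractIcc_eq_self ht]
  exact ⟨κ.map_source (h1 ht), by rw [κ.left_inv (h1 ht)]⟩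

end ACMaps

/-! ### The superposition operator in the charts of the Lie groups of absolutely continuous maps -/

section Charts

variable {p : ℝ≥0∞} [Fact (1 ≤ p)]
  {E : Type*} [AddCommGroup E] [Module ℝ E] [TopologicalSpace E]
  [IsTopologicalAddGroup E] [ContinuousSMul ℝ E] [LocallyConvexSpace ℝ E] [T2Space E]
  {G : Type*} [TopologicalSpace G] [ChartedSpace E G] [Group G] [LieGroupLC E G]
  {F : Type*} [AddCommGroup F] [Module ℝ F] [TopologicalSpace F]
  [IsTopologicalAddGroup F] [ContinuousSMul ℝ F] [LocallyConvexSpace ℝ F] [T2Space F]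
  {H : Type*} [TopologicalSpace H] [ChartedSpace F H] [Group H] [LieGroupLC F H]

theorem isACMap_acChart_symm {φ : OpenPartialHomeomorph G E} (hφ : φ ∈ lcCharts E G)
    (γ : ACMap p E G) {x : ACSpace p E} (hx : x ∈ ACSpace.valuesIn p φ.target) :
    IsACMap p E (fun t => φ.symm (x t) * γ t) :=
  (IsACMap.chart_symm hφ x.mem hx).mul γ.isACMap

theorem mem_acChart_target_iff {φ : OpenPartialHomeomorph G E} (hφ : φ ∈ lcCharts E G)
    {γ : ACMap p E G} {x : ACSpace p E} :
    x ∈ (acChart φ γ).target ↔ x ∈ ACSpace.valuesIn p φ.target :=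
  ⟨fun h => h.1, fun h => ⟨h, isACMap_acChart_symm hφ γ h⟩⟩

theorem mem_acChart_source_iff {φ : OpenPartialHomeomorph G E} (hφ : φ ∈ lcCharts E G)
    {γ η : ACMap p E G} :
    η ∈ (acChart φ γ).source ↔ ∀ t, η t * (γ t)⁻¹ ∈ φ.source :=
  ⟨fun h => h.1, fun h => ⟨h, (η.isACMap.mul γ.isACMap.inv).mem_acSubmodule hφ h⟩⟩

theorem acChart_symm_apply {φ : OpenPartialHomeomorph G E} {γ : ACMap p E G} {x : ACSpace p E}
    (hx : x ∈ (acChart φ γ).target) (t : unitInterval) :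
    (acChart φ γ).symm x t = φ.symm (x t) * γ t := by
  exact congrArg (fun ξ : ACMap p E G => ξ t) (dif_pos hx.2)

theorem acChart_apply {φ : OpenPartialHomeomorph G E} {γ η : ACMap p E G}
    (hη : η ∈ (acChart φ γ).source) (t : unitInterval) :
    acChart φ γ η t = φ (η t * (γ t)⁻¹) := by
  exact congrArg (fun x : ACSpace p E => x t) (dif_pos hη.2)

/-- The local representative `(z, c, e) ↦ ψ (f (φ⁻¹ z · κ⁻¹ c) · (l⁻¹ e)⁻¹)` of the pointwise
operation, in which the time dependent translations are replaced by additional variables. -/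
noncomputable def localRep (f : G → H) (φ κ : OpenPartialHomeomorph G E)
    (ψ l : OpenPartialHomeomorph H F) (z : E × (E × F)) : F :=
  ψ (f (φ.symm z.1 * κ.symm z.2.1) * (l.symm z.2.2)⁻¹)

/-- The domain of `localRep`. -/
def localDom (f : G → H) (φ κ : OpenPartialHomeomorph G E) (ψ l : OpenPartialHomeomorph H F) :
    Set (E × (E × F)) :=
  φ.target ×ˢ (κ.target ×ˢ l.target) ∩
    (fun z => f (φ.symm z.1 * κ.symm z.2.1) * (l.symm z.2.2)⁻¹) ⁻¹' ψ.source

/-- `localRep` is of the same class as `f`, since the group operations are smooth. -/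
theorem localRep_bastianiOn {k : ℕ∞} {f : G → H}
    (hf : ContDiffInCharts k (lcChartsPE E G) (lcChartsPE F H) f) {n : ℕ} (hn : (n : ℕ∞) ≤ k)
    {φ κ : OpenPartialHomeomorph G E} (hφ : φ ∈ lcCharts E G) (hκ : κ ∈ lcCharts E G)
    {ψ l : OpenPartialHomeomorph H F} (hψ : ψ ∈ lcCharts F H) (hl : l ∈ lcCharts F H) :
    IsOpen (localDom f φ κ ψ l) ∧
      BastianiOn n (localRep f φ κ ψ l) (localDom f φ κ ψ l) := by
  have hO : IsOpen (φ.target ×ˢ (κ.target ×ˢ l.target)) :=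
    φ.open_target.prod (κ.open_target.prod l.open_target)
  have u1 : BastianiInto E n (fun z : E × (E × F) => φ.symm z.1)
      (φ.target ×ˢ (κ.target ×ˢ l.target)) :=
    ((bastianiInto_symm hφ).comp_clm (ContinuousLinearMap.fst ℝ E (E × F))).mono fun z hz => hz.1
  have u2 : BastianiInto E n (fun z : E × (E × F) => κ.symm z.2.1)
      (φ.target ×ˢ (κ.target ×ˢ l.target)) :=
    ((bastianiInto_symm hκ).comp_clm ((ContinuousLinearMap.fst ℝ E F).comp
      (ContinuousLinearMap.snd ℝ E (E × F)))).mono fun z hz => hz.2.1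
  have u3 : BastianiInto F n (fun z : E × (E × F) => l.symm z.2.2)
      (φ.target ×ˢ (κ.target ×ˢ l.target)) :=
    ((bastianiInto_symm hl).comp_clm ((ContinuousLinearMap.snd ℝ E F).comp
      (ContinuousLinearMap.snd ℝ E (E × F)))).mono fun z hz => hz.2.2
  have u := ((u1.mul hO u2).comp_contDiff hf hn hO).mul hO (u3.inv hO)
  exact ⟨u.1.isOpen_inter_preimage hO ψ.open_source, u.bastianiOn hO hψ⟩

/-- The domain on which the composition with `f` is expressed in the charts around `γ` and `δ`. -/
def chartDom (f : G → H) (φ : OpenPartialHomeomorph G E) (γ : ACMap p E G)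
    (ψ : OpenPartialHomeomorph H F) (δ : ACMap p F H) : Set (ACSpace p E) :=
  {x | ∀ t, x t ∈ φ.target ∧ f (φ.symm (x t) * γ t) * (δ t)⁻¹ ∈ ψ.source}

theorem exists_mem_Icc_of_le {X : Type*} [LinearOrder X] {T : ℕ → X} {t : X} (h0 : T 0 ≤ t) {n : ℕ}
    (hn : t ≤ T n) (hpos : 0 < n) : ∃ j < n, t ∈ Icc (T j) (T (j + 1)) := by
  induction n with
  | zero => exact absurd hpos (lt_irrefl 0)
  | succ m ih =>
    rcases le_total (T m) t with h | h
    · exact ⟨m, m.lt_succ_self, h, hn⟩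
    · rcases m.eq_zero_or_pos with rfl | hm
      · exact ⟨0, one_pos, h0, hn⟩
      · obtain ⟨j, hj, ht⟩ := ih h hm
        exact ⟨j, hj.trans m.lt_succ_self, ht⟩

/-- The composition with `f` in charts. On the intervals of a fine partition, the translations by
`γ` and `δ` are read in charts as well, which gives superposition operators with a fixed
function `localRep`. Each of these operators agrees with the given one on one interval, and their
increments are added up. -/
theorem bastianiOn_chartDom {k : ℕ∞} {f : G → H}
    (hf : ContDiffInCharts (k + 2) (lcChartsPE E G) (lcChartsPE F H) f)
    {φ : OpenPartialHomeomorph G E} (hφ : φ ∈ lcCharts E G) (γ : ACMap p E G)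
    {ψ : OpenPartialHomeomorph H F} (hψ : ψ ∈ lcCharts F H) (δ : ACMap p F H)
    {N : ACSpace p E → ACSpace p F}
    (hN : ∀ x ∈ chartDom f φ γ ψ δ, ∀ t, N x t = ψ (f (φ.symm (x t) * γ t) * (δ t)⁻¹)) :
    IsOpen (chartDom f φ γ ψ δ) ∧
      ∀ m : ℕ, (m : ℕ∞) ≤ k → BastianiOn m N (chartDom f φ γ ψ δ) := by
  obtain ⟨n, hn, s, hs⟩ := exists_partition_chartAt (E := E) (F := F) γ.isACMap.1 δ.isACMap.1
  set T := partitionPoint n with hT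
  have hTm : Monotone T := monotone_partitionPoint n
  have hTj : ∀ j, T j ≤ T (j + 1) := fun j => hTm j.le_succ
  set κ : ℕ → OpenPartialHomeomorph G E := fun j => chartAt E (γ (s j)) with hκ_def
  set l : ℕ → OpenPartialHomeomorph H F := fun j => chartAt F (δ (s j)) with hl_def
  have hκ : ∀ j, κ j ∈ lcCharts E G := fun j => mem_lcCharts_of_mem_atlas (chart_mem_atlas E _)
  have hl : ∀ j, l j ∈ lcCharts F H := fun j => mem_lcCharts_of_mem_atlas (chart_mem_atlas F _)
  have hg := fun (m : ℕ) (hm : (m : ℕ∞) ≤ k + 2) j =>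
    localRep_bastianiOn hf hm hφ (hκ j) hψ (hl j)
  have hO := fun j => (hg 0 (by simp) j).1
  have hc : ∀ j < n, (fun t => κ j (γ (retractIcc (T j) (T (j + 1)) t))) ∈ acSubmodule p E :=
    fun j hj => γ.isACMap.isACBetween _ (hκ j) _ _ unitInterval.nonneg' (hTj j)
      unitInterval.le_one' (hs j hj).1
  have he : ∀ j < n, (fun t => l j (δ (retractIcc (T j) (T (j + 1)) t))) ∈ acSubmodule p F :=
    fun j hj => δ.isACMap.isACBetween _ (hl j) _ _ unitInterval.nonneg' (hTj j)
      unitInterval.le_one' (hs j hj).2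
  -- the coordinates of `γ` and `δ` on the `j`-th interval; the value for `j ≥ n` is irrelevant
  have hb : ∀ j, ∃ b : ACSpace p (E × F), j < n → ∀ t,
      b t = (κ j (γ (retractIcc (T j) (T (j + 1)) t)),
        l j (δ (retractIcc (T j) (T (j + 1)) t))) := by
    intro j
    by_cases hj : j < n
    · exact ⟨ACSpace.mk _ (prodMk_mem_acSubmodule (hc j hj) (he j hj)), fun _ _ => rfl⟩
    · exact ⟨0, fun h => absurd h hj⟩
  choose b hb using hb
  let A : ℕ → ACSpace p E →L[ℝ] ACSpace p (E × (E × F)) := fun j =>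
    (ACSpace.pair.comp (ContinuousLinearMap.inl ℝ (ACSpace p E) (ACSpace p (E × F)))).comp
      (ACSpace.retract (hTj j))
  let B : ℕ → ACSpace p (E × (E × F)) := fun j => ACSpace.pair (0, b j)
  have hAB : ∀ j < n, ∀ x t, (A j x + B j) t = (x (retractIcc (T j) (T (j + 1)) t),
      (κ j (γ (retractIcc (T j) (T (j + 1)) t)), l j (δ (retractIcc (T j) (T (j + 1)) t)))) := by
    intro j hj x t
    change (x (retractIcc (T j) (T (j + 1)) t) + 0, 0 + b j t) = _
    rw [add_zero, zero_add, hb j hj]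
  have hγ : ∀ j < n, ∀ t, γ (retractIcc (T j) (T (j + 1)) t) ∈ (κ j).source := fun j hj t =>
    (hs j hj).1 (retractIcc_mem (hTj j) t)
  have hδ : ∀ j < n, ∀ t, δ (retractIcc (T j) (T (j + 1)) t) ∈ (l j).source := fun j hj t =>
    (hs j hj).2 (retractIcc_mem (hTj j) t)
  let S : ℕ → Set (ACSpace p E) := fun j =>
    {x | A j x + B j ∈ ACSpace.valuesIn p (localDom f φ (κ j) ψ (l j))}
  have hS : ∀ j, IsOpen (S j) := fun j => (ACSpace.isOpen_valuesIn (hO j)).preimage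
    ((A j).continuous.add continuous_const)
  have memS : ∀ j < n, ∀ x, x ∈ S j ↔ ∀ t, x (retractIcc (T j) (T (j + 1)) t) ∈ φ.target ∧
      f (φ.symm (x (retractIcc (T j) (T (j + 1)) t)) * γ (retractIcc (T j) (T (j + 1)) t)) *
        (δ (retractIcc (T j) (T (j + 1)) t))⁻¹ ∈ ψ.source := by
    intro j hj x
    refine forall_congr' fun t => ?_
    rw [hAB j hj]
    have h1 := hγ j hj t
    have h2 := hδ j hj t
    simp only [localDom, mem_inter_iff, mem_prod, mem_preimage, (κ j).left_inv h1,
      (l j).left_inv h2, (κ j).map_source h1, (l j).map_source h2, and_true]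
  -- a condition for each `t` is a condition on each interval, which is open by the above
  have hdom : chartDom f φ γ ψ δ = ⋂ j ∈ Finset.range n, S j := by
    ext x
    simp only [mem_iInter, Finset.mem_range]
    constructor
    · exact fun hx j hj => (memS j hj x).2 fun t => hx _
    · intro hx t
      obtain ⟨j, hj, ht⟩ := exists_mem_Icc_of_le (T := T) (t := t)
        (by rw [hT, partitionPoint_zero]; exact unitInterval.nonneg')
        (by rw [hT, partitionPoint_self hn]; exact unitInterval.le_one') hn
      have := (memS j hj x).1 (hx j hj) t
      rwa [retractIcc_eq_self ht] at this
  have hopen : IsOpen (chartDom f φ γ ψ δ) := by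
    rw [hdom]
    exact isOpen_biInter_finset fun j _ => hS j
  refine ⟨hopen, fun m hm => ?_⟩
  have hm2 : ((m + 2 : ℕ) : ℕ∞) ≤ k + 2 := by push_cast; gcongr
  let P : ℕ → ACSpace p E → ACSpace p F := fun j x =>
    ACSpace.postcomp (localRep f φ (κ j) ψ (l j)) (A j x + B j)
  have hP : ∀ j < n, BastianiOn m (P j) (chartDom f φ γ ψ δ) := fun j hj =>
    ((ACSpace.bastianiOn_postcomp m (hO j) (hg _ hm2 j).2).comp_affine (A j) (B j)).mono (by
      rw [hdom]; exact biInter_subset_of_mem (Finset.mem_range.2 hj))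
  have hPN : ∀ j < n, ∀ x ∈ chartDom f φ γ ψ δ, ∀ t,
      P j x t = N x (retractIcc (T j) (T (j + 1)) t) := by
    intro j hj x hx t
    have hxS : x ∈ S j := (memS j hj x).2 fun t => hx _
    have h2 : ((2 : ℕ) : ℕ∞) ≤ k + 2 := le_add_self
    rw [hN x hx, ACSpace.postcomp_apply_of_mem (hO j) (hg 2 h2 j).2 hxS, hAB j hj, localRep]
    simp only
    rw [(κ j).left_inv (hγ j hj t), (l j).left_inv (hδ j hj t)]
  have hsum := (hP 0 hn).clm_comp ACSpace.constAtZero |>.add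
    (BastianiOn.sum (Finset.range n) fun j hj => (hP j (Finset.mem_range.1 hj)).clm_comp
      (ContinuousLinearMap.id ℝ (ACSpace p F) - ACSpace.constAtZero))
  -- the telescoping sum recovers `N x` from the `P j x`; it is evaluated at `t`
  refine hsum.congr hopen fun x hx => ACSpace.ext fun t => ?_
  let ev : ACSpace p F →ₗ[ℝ] F :=
    { toFun := fun η => η t, map_add' := fun _ _ => rfl, map_smul' := fun _ _ => rfl }
  refine (?_ : ev (ACSpace.constAtZero (P 0 x) + ∑ j ∈ Finset.range n,
    (ContinuousLinearMap.id ℝ (ACSpace p F) - ACSpace.constAtZero :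
      ACSpace p F →L[ℝ] ACSpace p F) (P j x)) = N x t)
  rw [map_add, map_sum]
  change P 0 x 0 + ∑ j ∈ Finset.range n, (P j x t - P j x 0) = N x t
  have hz : retractIcc (T 0) (T (0 + 1)) 0 = 0 := by
    rw [hT, partitionPoint_zero, retractIcc, max_eq_right unitInterval.nonneg',
      min_eq_left unitInterval.nonneg']
  rw [hPN 0 hn x hx, hz, Finset.sum_congr rfl fun j hj => by
    rw [hPN j (Finset.mem_range.1 hj) x hx, hPN j (Finset.mem_range.1 hj) x hx]]
  exact sum_comp_retractIcc_sub T hTm (partitionPoint_zero n) (partitionPoint_self hn) (N x) t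

variable {k : ℕ∞} {f : G → H}

/-- In the charts of the Lie groups of absolutely continuous maps, the composition with `f` is
a `C^k`-map on an open set. -/
theorem contDiffLC_acChart (hf : ContDiffInCharts (k + 2) (lcChartsPE E G) (lcChartsPE F H) f)
    (hAC : ∀ γ : ACMap p E G, IsACMap p F (fun t => f (γ t)))
    {φ : OpenPartialHomeomorph G E} (hφ : φ ∈ lcCharts E G) (γ : ACMap p E G)
    {ψ : OpenPartialHomeomorph H F} (hψ : ψ ∈ lcCharts F H) (δ : ACMap p F H) :
    ContDiffLC k (fun x => acChart ψ δ ⟨fun t => f ((acChart φ γ).symm x t), hAC _⟩)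
      {x | x ∈ (acChart φ γ).target ∧
        (⟨fun t => f ((acChart φ γ).symm x t), hAC _⟩ : ACMap p F H) ∈ (acChart ψ δ).source} := by
  have hdom : {x | x ∈ (acChart φ γ).target ∧
      (⟨fun t => f ((acChart φ γ).symm x t), hAC _⟩ : ACMap p F H) ∈ (acChart ψ δ).source} =
        chartDom f φ γ ψ δ := by
    ext x
    rw [mem_ofPred_eq, mem_acChart_source_iff hψ]
    constructor
    · rintro ⟨h1, h2⟩ t
      have := h2 t
      simp only [acChart_symm_apply h1] at this
      exact ⟨h1.1 t, this⟩
    · intro h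
      have h1 : x ∈ (acChart φ γ).target := (mem_acChart_target_iff hφ).2 fun t => (h t).1
      refine ⟨h1, fun t => ?_⟩
      simp only [acChart_symm_apply h1]
      exact (h t).2
  have hN := bastianiOn_chartDom hf hφ γ hψ δ
    (N := fun x => acChart ψ δ ⟨fun t => f ((acChart φ γ).symm x t), hAC _⟩) fun x hx t => by
      rw [← hdom] at hx
      rw [acChart_apply hx.2]
      simp only [acChart_symm_apply hx.1]
  rw [hdom]
  exact contDiffLC_of_bastianiOn hN.1 hN.2

/-- The inverse of a chart is continuous by the definition of the topology as a final one. -/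
theorem continuous_acChart_symm {φ : OpenPartialHomeomorph G E} (hφ : φ ∈ lcCharts E G)
    (h1 : (1 : G) ∈ φ.source) (γ : ACMap p E G) :
    Continuous fun x : (acChart φ γ).target => (acChart φ γ).symm x.1 := by
  let c : acCharts p E G := ⟨acChart φ γ, φ, hφ, h1, γ, rfl⟩
  rw [continuous_iff_coinduced_le]
  exact le_iSup (fun c : acCharts p E G =>
    TopologicalSpace.coinduced (fun x : c.1.target => c.1.symm x.1) inferInstance) c

/-- The composition with `f` is continuous. Near a given `η`, it is the composition of its
representative in a chart around `f ∘ η` and of the continuous inverse of this chart. -/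
theorem continuous_postcomp_acMap
    (hf : ContDiffInCharts (k + 2) (lcChartsPE E G) (lcChartsPE F H) f)
    (hAC : ∀ γ : ACMap p E G, IsACMap p F (fun t => f (γ t))) :
    Continuous fun γ : ACMap p E G => (⟨fun t => f (γ t), hAC γ⟩ : ACMap p F H) := by
  refine continuous_iSup_dom.2 ?_
  rintro ⟨_, φ, hφ, hφ1, γ, rfl⟩
  refine continuous_coinduced_dom.2 (continuous_iff_continuousAt.2 fun x₀ => ?_)
  set Φ := acChart φ γ
  let fs : ACMap p E G → ACMap p F H := fun η => ⟨fun t => f (η t), hAC η⟩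
  let ψ := chartAt F (1 : H)
  have hψ : ψ ∈ lcCharts F H := mem_lcCharts_of_mem_atlas (chart_mem_atlas F 1)
  have hψ1 : (1 : H) ∈ ψ.source := mem_chart_source F 1
  set δ := fs (Φ.symm x₀)
  obtain ⟨hopen, d, hd0, -, hdc⟩ := contDiffLC_acChart hf hAC hφ γ hψ δ
  set S := {x | x ∈ Φ.target ∧ fs (Φ.symm x) ∈ (acChart ψ δ).source}
  have hcont : ContinuousOn (fun x => acChart ψ δ (fs (Φ.symm x))) S := by
    refine ContinuousOn.congr ((hdc 0 (by simp)).comp (f := fun x => (x, (0 : Fin 0 → ACSpace p E)))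
      (by fun_prop) fun x hx => ⟨hx, trivial⟩) fun x hx => (hd0 x hx _).symm
  have hx₀ : x₀.1 ∈ S := ⟨x₀.2, (mem_acChart_source_iff hψ).2 fun t => by
    rw [mul_inv_cancel]; exact hψ1⟩
  have hS : IsOpen ((fun x : Φ.target => x.1) ⁻¹' S) := hopen.preimage continuous_subtype_val
  refine ContinuousOn.continuousAt ?_ (hS.mem_nhds hx₀)
  rw [continuousOn_iff_continuous_domRestrict]
  have h1 : Continuous fun x : (fun x : Φ.target => x.1) ⁻¹' S =>
      (⟨acChart ψ δ (fs (Φ.symm x.1.1)), (acChart ψ δ).map_source x.2.2⟩ :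
        (acChart ψ δ).target) :=
    Continuous.subtype_mk (hcont.comp_continuous (by fun_prop) fun x => x.2) _
  refine ((continuous_acChart_symm hψ hψ1 δ).comp h1).congr fun x => ?_
  exact (acChart ψ δ).left_inv x.2.2

end Charts

theorem mainTheorem8
    {E F G H : Type*}
    [AddCommGroup E] [Module ℝ E] [TopologicalSpace E] [IsTopologicalAddGroup E]
    [ContinuousSMul ℝ E] [LocallyConvexSpace ℝ E] [T2Space E] (hE : SeqCompleteTVS E)
    [AddCommGroup F] [Module ℝ F] [TopologicalSpace F] [IsTopologicalAddGroup F]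
    [ContinuousSMul ℝ F] [LocallyConvexSpace ℝ F] [T2Space F] (hF : SeqCompleteTVS F)
    [TopologicalSpace G] [ChartedSpace E G] [Group G] [LieGroupLC E G]
    [TopologicalSpace H] [ChartedSpace F H] [Group H] [LieGroupLC F H]
    (p : ℝ≥0∞) [Fact (1 ≤ p)] (k : ℕ∞)
    (f : G → H) (hf : ContDiffInCharts (k + 2) (lcChartsPE E G) (lcChartsPE F H) f) :
    ∃ hAC : ∀ γ : ACMap p E G, IsACMap p F (fun t => f (γ t)),
      ContDiffInCharts k (acCharts p E G) (acCharts p F H)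
        (fun γ : ACMap p E G => (⟨fun t => f (γ t), hAC γ⟩ : ACMap p F H)) := by
  have hAC : ∀ γ : ACMap p E G, IsACMap p F (fun t => f (γ t)) := fun γ =>
    γ.isACMap.comp_contDiff hf le_add_self
  refine ⟨hAC, continuous_postcomp_acMap hf hAC, ?_⟩
  rintro _ ⟨φ, hφ, -, γ, rfl⟩ _ ⟨ψ, hψ, -, δ, rfl⟩
  exact contDiffLC_acChart hf hAC hφ γ hψ δ
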